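/- Let $n\ge 2$ be an integer, let $m\ge 1$ and $s>1/2$ be real numbers, and write $\langle x\rangle=(1+|x|^2)^{1/2}$. Let $a_m\in C^\infty(\mathbb R^n\setminus 0)$ be real-valued with $a_m(\lambda\xi)=\lambda^m a_m(\xi)$ for all $\lambda>0$, $\xi\neq0$, and let $a:\mathbb R^n\to\mathbb R$ satisfy one of the following two conditions. (H) $a(\xi)=a_m(\xi)$ and $\nabla a_m(\xi)\neq 0$ for all $\xi\in\mathbb R^n\setminus 0$. (L) $a\in C^\infty(\mathbb R^n)$, $\nabla a(\xi)\ne0$ for all $\xi\in\mathbb R^n$, $\nabla a_m(\xi)\neq0$ for all $\xi\in\mathbb R^n\setminus0$, and for every multi-index $\alpha$ there is a constant $C_\alpha$ with $|\partial^\alpha(a-a_m)(\xi)|\le C_\alpha|\xi|^{m-1-|\alpha|}$ for all $|\xi|\ge1$. For a symbol $\sigma$ let $\sigma(D_x)=\mathcal F^{-1}\sigma(\xi)\mathcal F$, where $\mathcal F u(\xi)=\int e^{-ix\cdot\xi}u(x)\,dx$. Then there is a constant $C$, depending only on $n,m,s,a,a_m$, such that for all measurable $f:\mathbb R\times\mathbb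 R^n\to\mathbb C$ with $\langle x\rangle^s f\in L^2(\mathbb R_t\times\mathbb R^n_x)$ $$\Big\|\langle x\rangle^{-s}|D_x|^{m-1}\int_0^t e^{i(t-\tau)a(D_x)}f(\tau,x)\,d\tau\Big\|_{L^2(\mathbb R_t\times\mathbb R^n_x)}\le C\,\big\|\langle x\rangle^{s}f(t,x)\big\|_{L^2(\mathbb R_t\times\mathbb R^n_x)}.$$ Here, for every $t\in\mathbb R$, the integral over $\tau$ exists as a Bochner integral in $L^2(\mathbb R^n)$, and $|D_x|^{m-1}$ of it, taken in the sense of tempered distributions on $\mathbb R^n$, is for almost every $t$ given by a function of $x$; these functions form a measurable function of $(t,x)$ whose norm is the left-hand side. -/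

import Mathlib

open MeasureTheory FourierTransform
open scoped ContDiff NNReal ENNReal SchwartzMap Gradient

noncomputable section

namespace Smoothing

/-- Euclidean space `ℝⁿ`. -/
abbrev Rn (n : ℕ) : Type := EuclideanSpace ℝ (Fin n)

/-- The complex Hilbert space `L²(ℝⁿ)`. -/
abbrev L2 (n : ℕ) : Type := Lp (α := Rn n) ℂ 2

/-- `am` is smooth on `ℝⁿ ∖ 0` and positively homogeneous of degree `m` there
(real-valued by its type). -/
structure IsPrincipalSymbol {n : ℕ} (m : ℝ) (am : Rn n → ℝ) : Prop where
  smooth : ContDiffOn ℝ ∞ am {0}ᶜ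
  homogeneous : ∀ c : ℝ, 0 < c → ∀ ξ : Rn n, ξ ≠ 0 → am (c • ξ) = c ^ m * am ξ

/-- The iterated partial derivative `∂_{j 0} ⋯ ∂_{j (k-1)} b` at `ξ`. -/
def partialDeriv {n k : ℕ} (j : Fin k → Fin n) (b : Rn n → ℝ) (ξ : Rn n) : ℝ :=
  iteratedFDeriv ℝ k b ξ (fun i => EuclideanSpace.single (j i) 1)

/-- Condition (H): `a` is its homogeneous principal part, whose gradient has no zero off the
origin. -/
structure DispersiveH {n : ℕ} (a am : Rn n → ℝ) : Prop where
  eq_principal : ∀ ξ : Rn n, ξ ≠ 0 → a ξ = am ξ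
  gradient_principal_ne : ∀ ξ : Rn n, ξ ≠ 0 → ∇ am ξ ≠ 0

/-- Condition (L): `a` is smooth with nowhere vanishing gradient, the gradient of the principal
part has no zero off the origin, and `a - am` is a lower order term. -/
structure DispersiveL {n : ℕ} (m : ℝ) (a am : Rn n → ℝ) : Prop where
  smooth : ContDiff ℝ ∞ a
  gradient_ne : ∀ ξ : Rn n, ∇ a ξ ≠ 0
  gradient_principal_ne : ∀ ξ : Rn n, ξ ≠ 0 → ∇ am ξ ≠ 0
  lower_order : ∀ (k : ℕ) (j : Fin k → Fin n), ∃ C : ℝ, ∀ ξ : Rn n, 1 ≤ ‖ξ‖ →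
    |partialDeriv j (fun η => a η - am η) ξ| ≤ C * ‖ξ‖ ^ (m - 1 - k)

open Classical in
/-- The Fourier multiplier `σ(D)` on `L²(ℝⁿ)`, `D = -i∇`, set to `0` at those `g` with
`σ(D) g ∉ L²`. Mathlib's Fourier transform has the kernel `exp(-2πi x·ξ)`, so that `D` corresponds
to the multiplication by `2πξ`. -/
def fourierMultiplier {n : ℕ} (σ : Rn n → ℂ) (g : L2 n) : L2 n :=
  if h : MemLp (fun ξ : Rn n => σ ((2 * Real.pi) • ξ) * (𝓕 g : L2 n) ξ) 2 volume then
    𝓕⁻ (h.toLp _ : L2 n)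
  else 0

/-- The propagator `e^{ita(D)}` on `L²(ℝⁿ)`. -/
def propagator {n : ℕ} (a : Rn n → ℝ) (t : ℝ) : L2 n → L2 n :=
  fourierMultiplier (fun ξ => Complex.exp (Complex.I * t * a ξ))

/-- The default value is not met in `propagator`. -/
theorem fourier_propagator {n : ℕ} {a : Rn n → ℝ} (ha : Measurable a) (t : ℝ) (g : L2 n) :
    (𝓕 (propagator a t g) : L2 n) =ᵐ[volume] fun ξ : Rn n =>
      Complex.exp (Complex.I * t * a ((2 * Real.pi) • ξ)) * (𝓕 g : L2 n) ξ := by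
  have h : MemLp (fun ξ : Rn n =>
      Complex.exp (Complex.I * t * a ((2 * Real.pi) • ξ)) * (𝓕 g : L2 n) ξ) 2 volume := by
    have hm : Measurable fun ξ : Rn n =>
        Complex.exp (Complex.I * t * a ((2 * Real.pi) • ξ)) := by fun_prop
    refine (Lp.memLp (𝓕 g : L2 n)).congr_norm
      (hm.aestronglyMeasurable.mul (Lp.aestronglyMeasurable _)) (ae_of_all _ fun ξ => ?_)
    have : Complex.I * t * a ((2 * Real.pi) • ξ)
        = ((t * a ((2 * Real.pi) • ξ) : ℝ) : ℂ) * Complex.I := by push_cast; ring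
    rw [norm_mul, this, Complex.norm_exp_ofReal_mul_I, one_mul]
  rw [propagator, fourierMultiplier, dif_pos h, fourier_fourierInv_eq]
  exact h.coeFn_toLp

open Classical in
/-- The time slice `f(τ, ·)` as an element of `L²(ℝⁿ)` (for `f ∈ L²(ℝ × ℝⁿ)` this is defined for
almost every `τ`, and set to `0` for the other `τ`). -/
def slice {n : ℕ} (f : ℝ × Rn n → ℂ) (τ : ℝ) : L2 n :=
  if h : MemLp (fun x : Rn n => f (τ, x)) 2 volume then h.toLp _ else 0

/-- The Duhamel integral `∫₀ᵗ e^{i(t-τ)a(D)} f(τ, ·) dτ`, a Bochner integral in `L²(ℝⁿ)`. -/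
def duhamel {n : ℕ} (a : Rn n → ℝ) (f : ℝ × Rn n → ℂ) (t : ℝ) : L2 n :=
  ∫ τ in (0 : ℝ)..t, propagator a (t - τ) (slice f τ)

/-- `|D|^κ u = v` in the sense of tempered distributions, for `u ∈ L²(ℝⁿ)` and a function `v`:
the distributional Fourier transform of `v` is `|2πξ|^κ (𝓕 u)(ξ)`. -/
def IsAbsDPow {n : ℕ} (κ : ℝ) (u : L2 n) (v : Rn n → ℂ) : Prop :=
  ∀ φ : 𝓢(Rn n, ℂ),
    Integrable (fun x : Rn n => v x * (𝓕 φ : 𝓢(Rn n, ℂ)) x) volume ∧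
    ∫ x : Rn n, v x * (𝓕 φ : 𝓢(Rn n, ℂ)) x =
      ∫ ξ : Rn n, ((‖(2 * Real.pi) • ξ‖ ^ κ : ℝ) : ℂ) * (𝓕 u : L2 n) ξ * φ ξ

/-- The function `⟨x⟩^r f(t, x)` with `⟨x⟩ = (1 + |x|²)^{1/2}`. -/
def weighted {n : ℕ} (r : ℝ) (f : ℝ × Rn n → ℂ) : ℝ × Rn n → ℂ :=
  fun p => ((Real.sqrt (1 + ‖p.2‖ ^ 2) ^ r : ℝ) : ℂ) * f p

end Smoothing

end

/-! The estimate is a uniform resolvent bound in disguise (Kato smoothing). Damp the solution by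
`e^{-εt}` on `t > 0` and take the Fourier transform in time: at frequency `l` the Duhamel integral
becomes `i (a(D) - λ + iε)⁻¹`, `λ = 2πl`, applied to the transform of the damped source
(`fourier_damped_duhamelFactor`, `fourier_dampedField`). Plancherel in time on both sides and
Fatou's lemma as `ε → 0` leave a bound for `⟨x⟩^{-s} |D|^{m-1} (a(D) - λ - iε)⁻¹ ⟨x⟩^{-s}` that is
independent of `λ` and of `ε ≠ 0` (`ResolventBound`). Negative times reduce to positive ones with
`-a` in place of `a`.

The resolvent bound is proved for its sesquilinear form, the integral of `|ξ|^{m-1} 𝓕h conj(𝓕g) /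
(a(ξ) - λ - iε)` (`IsDispersive.exists_bilinear`). By compactness of the set of directions, a finite
partition of unity cuts frequency space into regions on each of which some `∂ⱼa` has a fixed sign
and dominates `size^{m-1}` (`IsDispersive.exists_isAdapted`). There `a` is strictly monotone along
lines in the `j`-th direction, so each line meets at most one root of `a - λ`. Near the root the
integrand is compared with a multiple of `1 / (βy - iε)`, whose integral over a symmetric interval
is at most `π/β` whatever `ε` is. Since `β ≥ c size^{m-1}`, this pays for exactly `m - 1`
derivatives. The error of the comparison is integrable because the numerator is Hölder continuous,
and away from the root the integrand is dominated by `|𝓕h 𝓕g| / min(1, size)`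
(`IsLineSymbol.norm_integral_le`).

The condition `s > 1/2` enters twice when these line estimates are integrated over all parallel
lines. On lines, `𝓕h` is bounded and Hölder continuous of exponent `γ < s - 1/2`, with constants
that are square integrable in the transversal variables (`trace_bounds`,
`lintegral_traceMaj_sq_le`); and the factor `1 / min(1, |ξ|)` is absorbed by a Hardy type inequality
(`exists_hardy`).

Conditions (H) and (L) are treated together by lifting `ξ` to `(κ₀, ξ)` with `κ₀ = 0` or `κ₀ = 1`,
so that `size` is `|ξ|` or `⟨ξ⟩`. The closure of the directions is the unit sphere of `ℝⁿ` or a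
closed hemisphere. In the second case the open hemisphere is a copy of `ℝⁿ`, where `∇a ≠ 0` is used,
and the equator represents infinity, where `∇a_m ≠ 0` is used.

For finite sums of products `1_A(t) h(x)` with `h` Schwartz all objects are explicit integrals. Such
sums are dense in the weighted space (`denseRange_tensorSum`), so the solution operator extends by
continuity, and pairing with Schwartz functions identifies the extension with `|D|^{m-1}` of the
Bochner integral (`ResolventBound.exists_smoothing`). -/

noncomputable section

namespace Smoothing

/-! ### Fourier integrals of integrable functions and Plancherel's identity -/

section Plancherel

variable {V : Type*} [NormedAddCommGroup V] [InnerProductSpace ℝ V] [FiniteDimensional ℝ V]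
  [MeasurableSpace V] [BorelSpace V]

/-- The multiplication formula `∫ 𝓕f · g = ∫ f · 𝓕g` for integrable functions. -/
theorem integral_fourier_mul {f g : V → ℂ} (hf : Integrable f) (hg : Integrable g) :
    ∫ ξ, 𝓕 f ξ * g ξ = ∫ x, f x * 𝓕 g x := by
  have h := VectorFourier.integral_fourierIntegral_smul_eq_flip (μ := (volume : Measure V))
    (ν := (volume : Measure V)) (L := innerₗ V) Real.continuous_fourierChar
    continuous_inner hf hg
  rw [flip_innerₗ] at h
  exact h

theorem continuous_fourier_of_integrable {f : V → ℂ} (hf : Integrable f) : Continuous (𝓕 f) :=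
  VectorFourier.fourierIntegral_continuous Real.continuous_fourierChar
    (L := innerₗ V) continuous_inner hf

theorem norm_fourier_le {f : V → ℂ} (ξ : V) : ‖𝓕 f ξ‖ ≤ ∫ x, ‖f x‖ :=
  VectorFourier.norm_fourierIntegral_le_integral_norm _ _ _ _ _

/-- On `L¹ ∩ L²` the Fourier transform of `L²` is given by the Fourier integral. -/
theorem fourier_toLp_ae_eq {f : V → ℂ} (hf : Integrable f) (hf2 : MemLp f 2) :
    (𝓕 (hf2.toLp f) : Lp (α := V) ℂ 2) =ᵐ[volume] 𝓕 f := by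
  refine ae_eq_of_integral_contDiff_smul_eq
    ((Lp.memLp _).locallyIntegrable (by norm_num))
    (continuous_fourier_of_integrable hf).locallyIntegrable fun g hg hgc => ?_
  have hc : HasCompactSupport (fun x => (g x : ℂ)) := hgc.comp_left (g := fun r : ℝ => (r : ℂ)) rfl
  have hs : ContDiff ℝ ∞ (fun x => (g x : ℂ)) := Complex.ofRealCLM.contDiff.comp hg
  -- The test function becomes a Schwartz function, so that the `L²` transform can be read off from
  -- its action as a tempered distribution.
  set φ : 𝓢(V, ℂ) := hc.toSchwartzMap hs with hφ
  have hφx : ∀ x, φ x = (g x : ℂ) := fun x => rfl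
  have h1 := congrArg (fun T => T φ) (Lp.fourier_toTemperedDistribution_eq (E := V) (F := ℂ) (hf2.toLp f))
  simp only [TemperedDistribution.fourier_apply, Lp.toTemperedDistribution_apply] at h1
  have h2 := integral_fourier_mul hf (φ.integrable (μ := volume))
  calc _ = ∫ x, φ x • (𝓕 (hf2.toLp f) : Lp (α := V) ℂ 2 volume) x := by
        refine integral_congr_ae (ae_of_all _ fun x => ?_)
        simp [hφx]
    _ = ∫ x, (𝓕 φ) x • hf2.toLp f x := h1.symm
    _ = ∫ x, f x * (𝓕 (φ : V → ℂ)) x := by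
        refine integral_congr_ae ?_
        filter_upwards [hf2.coeFn_toLp] with x hx
        rw [hx, smul_eq_mul, mul_comm, SchwartzMap.fourier_coe]
    _ = _ := by
        rw [← h2]
        refine integral_congr_ae (ae_of_all _ fun x => ?_)
        simp [hφx, mul_comm]

/-- Plancherel's identity on `L¹ ∩ L²`. -/
theorem eLpNorm_fourier {f : V → ℂ} (hf : Integrable f) (hf2 : MemLp f 2) :
    eLpNorm (𝓕 f) 2 = eLpNorm f 2 := by
  rw [← eLpNorm_congr_ae (fourier_toLp_ae_eq hf hf2), ← eLpNorm_congr_ae hf2.coeFn_toLp,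
    ← Lp.enorm_def, ← Lp.enorm_def, ← ofReal_norm, ← ofReal_norm,
    Lp.norm_fourier_eq]

theorem lintegral_enorm_sq_eq {α : Type*} [MeasurableSpace α] (μ : Measure α) (f : α → ℂ) :
    ∫⁻ x, ‖f x‖ₑ ^ 2 ∂μ = eLpNorm f 2 μ ^ 2 := by
  have := eLpNorm_nnreal_pow_eq_lintegral (f := f) (μ := μ) (p := 2) (by norm_num)
  simpa using this.symm

theorem lintegral_fourier_sq {f : V → ℂ} (hf : Integrable f) (hf2 : MemLp f 2) :
    ∫⁻ ξ, ‖𝓕 f ξ‖ₑ ^ 2 = ∫⁻ x, ‖f x‖ₑ ^ 2 := by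
  rw [lintegral_enorm_sq_eq, lintegral_enorm_sq_eq, eLpNorm_fourier hf hf2]

theorem fourierInv_apply_eq (f : V → ℂ) (x : V) : 𝓕⁻ f x = 𝓕 f (-x) := by
  rw [Real.fourierInv_eq_fourier_neg]

end Plancherel

/-! ### Monotone symbols on a line: lower bounds and comparison with the model singularity -/

section Line

/-- A real symbol `b` on a line which is increasing on the interval `J`, with an amplitude `ψ`
living well inside `J`; everything is controlled by the size function `P`. -/
structure IsLineSymbol (κ c C δ γ : ℝ) (P b b' ψ : ℝ → ℝ) (J : Set ℝ) : Prop where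
  size_pos : ∀ η, 0 < P η
  size_lipschitz : ∀ η η', |P η - P η'| ≤ |η - η'|
  ordConnected : J.OrdConnected
  hasDerivAt : ∀ η ∈ J, HasDerivAt b (b' η) η
  le_deriv : ∀ η ∈ J, c * P η ^ κ ≤ b' η
  deriv_lipschitz : ∀ η₀ ∈ J, ∀ η ∈ J, |η - η₀| ≤ P η₀ / 4 →
    |b' η - b' η₀| ≤ C * P η₀ ^ (κ - 1) * |η - η₀|
  amplitude_le : ∀ η, |ψ η| ≤ P η ^ κ
  support_subset : ∀ η, ψ η ≠ 0 → Set.Icc (η - δ * P η) (η + δ * P η) ⊆ J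
  amplitude_holder : ∀ η₀ η, |η - η₀| ≤ P η₀ / 4 →
    |ψ η - ψ η₀| ≤ C * P η₀ ^ κ * (|η - η₀| / P η₀) ^ γ
  measurable_symbol : Measurable b
  measurable_amplitude : Measurable ψ

namespace IsLineSymbol

variable {κ c C δ γ : ℝ} {P b b' ψ : ℝ → ℝ} {J : Set ℝ}

theorem size_le (h : IsLineSymbol κ c C δ γ P b b' ψ J) {η η' : ℝ} (hd : |η' - η| ≤ P η / 4) :
    3 / 4 * P η ≤ P η' := by
  have := abs_le.1 (h.size_lipschitz η' η)
  linarith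

theorem exists_deriv_eq (h : IsLineSymbol κ c C δ γ P b b' ψ J) {x y : ℝ} (hx : x ∈ J) (hy : y ∈ J)
    (hxy : x ≤ y) : ∃ ζ ∈ Set.Icc x y, b y - b x = b' ζ * (y - x) := by
  rcases hxy.eq_or_lt with rfl | hlt
  · exact ⟨x, ⟨le_rfl, le_rfl⟩, by simp⟩
  have hJ : Set.Icc x y ⊆ J := h.ordConnected.out hx hy
  obtain ⟨ζ, hζ, he⟩ := exists_hasDerivAt_eq_slope b b' hlt
    (fun z hz => (h.hasDerivAt z (hJ hz)).continuousAt.continuousWithinAt)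
    (fun z hz => h.hasDerivAt z (hJ ⟨hz.1.le, hz.2.le⟩))
  refine ⟨ζ, ⟨hζ.1.le, hζ.2.le⟩, ?_⟩
  rw [he, div_mul_cancel₀ _ (by linarith)]

theorem monotoneOn (h : IsLineSymbol κ c C δ γ P b b' ψ J) (hc : 0 < c) {x y : ℝ} (hx : x ∈ J)
    (hy : y ∈ J) (hxy : x ≤ y) : b x ≤ b y := by
  obtain ⟨ζ, hζ, he⟩ := h.exists_deriv_eq hx hy hxy
  have h1 := h.le_deriv ζ (h.ordConnected.out hx hy hζ)
  have h2 : 0 < c * P ζ ^ κ := mul_pos hc (Real.rpow_pos_of_pos (h.size_pos ζ) κ)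
  nlinarith [mul_nonneg (h2.le.trans h1) (sub_nonneg.2 hxy)]

/-- The increment of `b` over an interval close to `η`. -/
theorem increment_le (h : IsLineSymbol κ c C δ γ P b b' ψ J) (hc : 0 < c) (hκ : 0 ≤ κ) {η x y : ℝ}
    (hx : x ∈ J) (hy : y ∈ J) (hxy : x ≤ y) (hx' : |x - η| ≤ P η / 4) (hy' : |y - η| ≤ P η / 4) :
    c * (3 / 4) ^ κ * P η ^ κ * (y - x) ≤ b y - b x := by
  obtain ⟨ζ, hζ, he⟩ := h.exists_deriv_eq hx hy hxy
  have h1 := h.le_deriv ζ (h.ordConnected.out hx hy hζ)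
  have h3 : |ζ - η| ≤ P η / 4 := by
    rw [abs_le] at *
    constructor <;> linarith [hζ.1, hζ.2]
  have h4 := h.size_le h3
  have h5 : (3 / 4 * P η) ^ κ ≤ P ζ ^ κ :=
    Real.rpow_le_rpow (by linarith [h.size_pos η]) h4 hκ
  rw [Real.mul_rpow (by norm_num) (h.size_pos η).le] at h5
  rw [he]
  refine mul_le_mul_of_nonneg_right ?_ (sub_nonneg.2 hxy)
  calc c * (3 / 4) ^ κ * P η ^ κ = c * ((3 / 4) ^ κ * P η ^ κ) := by ring
    _ ≤ c * P ζ ^ κ := by gcongr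
    _ ≤ _ := h1

/-- Only a stretch of length `d` next to `η` is used, where `P` is comparable to `P η` and
`increment_le` applies. On the rest of the way to `η₀` monotonicity alone prevents the increment
from being lost, however `P` behaves there. -/
theorem abs_sub_root_le (h : IsLineSymbol κ c C δ γ P b b' ψ J) (hc : 0 < c) (hκ : 0 ≤ κ)
    (hδ : 0 < δ) (hδ' : δ ≤ 1 / 4) {η η₀ : ℝ} (hη : ψ η ≠ 0) (hη₀ : η₀ ∈ J) :
    c * (3 / 4) ^ κ * P η ^ κ * min |η - η₀| (δ * min 1 (P η)) ≤ |b η - b η₀| := by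
  have hP := h.size_pos η
  have hηJ : η ∈ J := h.support_subset η hη ⟨by nlinarith, by nlinarith⟩
  set d := min |η - η₀| (δ * min 1 (P η)) with hd
  have hd0 : 0 ≤ d := le_min (abs_nonneg _) (by positivity)
  have hd1 : d ≤ |η - η₀| := min_le_left _ _
  have hd2 : d ≤ P η / 4 := by
    calc d ≤ δ * min 1 (P η) := min_le_right _ _
      _ ≤ 1 / 4 * P η := by gcongr; exact min_le_right _ _
      _ = _ := by ring
  rcases le_total η₀ η with hle | hle
  · rw [abs_of_nonneg (sub_nonneg.2 hle)] at hd1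
    have hJ : η - d ∈ J := h.ordConnected.out hη₀ hηJ ⟨by linarith, by linarith⟩
    have h1 := h.increment_le hc hκ (η := η) hJ hηJ (by linarith)
      (by rw [abs_le]; constructor <;> linarith) (by simp; positivity)
    have h2 := h.monotoneOn hc hη₀ hJ (by linarith)
    calc _ = c * (3 / 4) ^ κ * P η ^ κ * (η - (η - d)) := by ring
      _ ≤ b η - b η₀ := by linarith
      _ ≤ _ := le_abs_self _
  · rw [abs_of_nonpos (by linarith)] at hd1
    have hJ : η + d ∈ J := h.ordConnected.out hηJ hη₀ ⟨by linarith, by linarith⟩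
    have h1 := h.increment_le hc hκ (η := η) hηJ hJ (by linarith) (by simp; positivity)
      (by rw [abs_le]; constructor <;> linarith)
    have h2 := h.monotoneOn hc hJ hη₀ (by linarith)
    calc _ = c * (3 / 4) ^ κ * P η ^ κ * (η + d - η) := by ring
      _ ≤ -(b η - b η₀) := by linarith
      _ ≤ _ := neg_le_abs _

/-- Since the support of `ψ` lies well inside `J`, one can move from `η` towards the level `lam` by
`d` without leaving `J`. By the intermediate value theorem `lam` is not reached, so the whole
increment of `b` over that stretch separates `b η` from `lam`. -/
theorem abs_sub_le_of_no_root (h : IsLineSymbol κ c C δ γ P b b' ψ J) (hc : 0 < c) (hκ : 0 ≤ κ)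
    (hδ : 0 < δ) (hδ' : δ ≤ 1 / 4) {η lam : ℝ} (hη : ψ η ≠ 0) (hno : ∀ η₀ ∈ J, b η₀ ≠ lam) :
    c * (3 / 4) ^ κ * P η ^ κ * (δ * min 1 (P η)) ≤ |b η - lam| := by
  have hP := h.size_pos η
  set d := δ * min 1 (P η) with hd
  have hd0 : 0 ≤ d := by positivity
  have hd1 : d ≤ δ * P η := by rw [hd]; gcongr; exact min_le_right _ _
  have hd2 : d ≤ P η / 4 := by nlinarith
  have hsub := h.support_subset η hη
  have hηJ : η ∈ J := hsub ⟨by nlinarith, by nlinarith⟩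
  have hc' : ContinuousOn b J := fun z hz => (h.hasDerivAt z hz).continuousAt.continuousWithinAt
  rcases lt_or_gt_of_ne (hno η hηJ) with hlt | hgt
  · have hJ : η + d ∈ J := hsub ⟨by nlinarith, by nlinarith⟩
    have h1 := h.increment_le hc hκ (η := η) hηJ hJ (by linarith) (by simp; positivity)
      (by rw [abs_le]; constructor <;> linarith)
    have h2 : b (η + d) < lam := by
      by_contra! hcon
      obtain ⟨z, hz, hzl⟩ := intermediate_value_Icc (by linarith : η ≤ η + d)
        (hc'.mono (h.ordConnected.out hηJ hJ)) ⟨hlt.le, hcon⟩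
      exact hno z (h.ordConnected.out hηJ hJ hz) hzl
    calc _ = c * (3 / 4) ^ κ * P η ^ κ * (η + d - η) := by ring
      _ ≤ -(b η - lam) := by linarith
      _ ≤ _ := neg_le_abs _
  · have hJ : η - d ∈ J := hsub ⟨by nlinarith, by nlinarith⟩
    have h1 := h.increment_le hc hκ (η := η) hJ hηJ (by linarith)
      (by rw [abs_le]; constructor <;> linarith) (by simp; positivity)
    have h2 : lam < b (η - d) := by
      by_contra! hcon
      obtain ⟨z, hz, hzl⟩ := intermediate_value_Icc (by linarith : η - d ≤ η)
        (hc'.mono (h.ordConnected.out hJ hηJ)) ⟨hcon, hgt.le⟩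
      exact hno z (h.ordConnected.out hJ hηJ hz) hzl
    calc _ = c * (3 / 4) ^ κ * P η ^ κ * (η - (η - d)) := by ring
      _ ≤ b η - lam := by linarith
      _ ≤ _ := le_abs_self _

/-- Pointwise comparison with the model singularity `1 / (β y - iε)` at a root of `b - b η₀`. -/
theorem norm_sub_model_le (h : IsLineSymbol κ c C δ γ P b b' ψ J) (hc : 0 < c) (hκ : 0 ≤ κ)
    (hC : 0 ≤ C) (hγ : 0 < γ) (hγ1 : γ ≤ 1) {F : ℝ → ℂ} {A ε η₀ y : ℝ}
    (hA : ∀ η, ‖F η‖ ≤ A) (hF : ∀ η η', ‖F η - F η'‖ ≤ A * |η - η'| ^ γ)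
    (hη₀ : η₀ ∈ J) (hyJ : η₀ + y ∈ J) (hy0 : y ≠ 0) (hy : |y| ≤ min 1 (P η₀) / 4) :
    ‖(ψ (η₀ + y) : ℂ) * F (η₀ + y) / (((b (η₀ + y) - b η₀ : ℝ) : ℂ) - Complex.I * ε)
        - (ψ η₀ : ℂ) * F η₀ / (((b' η₀ * y : ℝ) : ℂ) - Complex.I * ε)‖
      ≤ ((C + 1) / (c * (3 / 4) ^ κ) + C / (c * (3 / 4) ^ κ * c)) * A *
        ((|y| / min 1 (P η₀)) ^ γ / |y|) := by
  have hP := h.size_pos η₀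
  set ρ := min 1 (P η₀) with hρ
  have hρ0 : 0 < ρ := lt_min one_pos hP
  have hρ1 : ρ ≤ 1 := min_le_left _ _
  have hρP : ρ ≤ P η₀ := min_le_right _ _
  have hy' : 0 < |y| := abs_pos.2 hy0
  have hA0 : 0 ≤ A := (norm_nonneg _).trans (hA 0)
  have hyP : |η₀ + y - η₀| ≤ P η₀ / 4 := by rw [add_sub_cancel_left]; linarith
  set c₃ := c * (3 / 4 : ℝ) ^ κ with hc₃
  have hc₃0 : 0 < c₃ := by positivity
  set Q := P η₀ ^ κ with hQ
  have hQ0 : 0 < Q := Real.rpow_pos_of_pos hP κ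
  set B := b (η₀ + y) - b η₀ with hB
  set β := b' η₀ with hβ
  have hβc : c * Q ≤ β := h.le_deriv η₀ hη₀
  have hη₀r : |η₀ - η₀| ≤ P η₀ / 4 := by simp; positivity
  have hBl : c₃ * Q * |y| ≤ |B| := by
    rcases le_total 0 y with h0 | h0
    · have := h.increment_le hc hκ (η := η₀) hη₀ hyJ (by linarith) hη₀r hyP
      rw [abs_of_nonneg h0]
      refine le_trans (le_of_eq_of_le ?_ this) (le_abs_self _)
      ring
    · have := h.increment_le hc hκ (η := η₀) hyJ hη₀ (by linarith) hyP hη₀r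
      rw [abs_of_nonpos h0]
      refine le_trans (le_of_eq_of_le ?_ this) (le_of_eq_of_le ?_ (neg_le_abs _))
      · ring
      · rw [hB]; ring
  have hBβ : |B - β * y| ≤ C * P η₀ ^ (κ - 1) * |y| * |y| := by
    -- The mean value theorem replaces `B` by `b' ζ * y`; the Lipschitz bound on `b'` then makes the
    -- linearisation error quadratic in `y`.
    have key : ∃ ζ ∈ J, |ζ - η₀| ≤ |y| ∧ B = b' ζ * y := by
      rcases le_total 0 y with h0 | h0
      · obtain ⟨ζ, hζ, he⟩ := h.exists_deriv_eq hη₀ hyJ (by linarith)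
        refine ⟨ζ, h.ordConnected.out hη₀ hyJ hζ, ?_, ?_⟩
        · rw [abs_of_nonneg h0, abs_of_nonneg (by linarith [hζ.1])]; linarith [hζ.2]
        · rw [hB, he]; ring
      · obtain ⟨ζ, hζ, he⟩ := h.exists_deriv_eq hyJ hη₀ (by linarith)
        refine ⟨ζ, h.ordConnected.out hyJ hη₀ hζ, ?_, ?_⟩
        · rw [abs_of_nonpos h0, abs_of_nonpos (by linarith [hζ.2])]; linarith [hζ.1]
        · have : B = -(b η₀ - b (η₀ + y)) := by rw [hB]; ring
          rw [this, he]; ring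
    obtain ⟨ζ, hζJ, hζ, he⟩ := key
    have h1 := h.deriv_lipschitz η₀ hη₀ ζ hζJ (by linarith)
    rw [he, ← sub_mul, abs_mul]
    have h2 : C * P η₀ ^ (κ - 1) * |ζ - η₀| ≤ C * P η₀ ^ (κ - 1) * |y| := by gcongr
    exact mul_le_mul_of_nonneg_right (h1.trans h2) (abs_nonneg _)
  set w := ((B : ℝ) : ℂ) - Complex.I * ε with hw
  set w' := ((β * y : ℝ) : ℂ) - Complex.I * ε with hw'
  have hwB : |B| ≤ ‖w‖ := by
    have := Complex.abs_re_le_norm w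
    simpa [hw] using this
  have hwβ : c * Q * |y| ≤ ‖w'‖ := by
    have := Complex.abs_re_le_norm w'
    have h2 : w'.re = β * y := by simp [hw']
    rw [h2, abs_mul] at this
    refine le_trans ?_ this
    gcongr
    exact hβc.trans (le_abs_self _)
  have hw0 : 0 < ‖w‖ := lt_of_lt_of_le (by positivity) (hBl.trans hwB)
  have hw'0 : 0 < ‖w'‖ := lt_of_lt_of_le (by positivity) hwβ
  -- The change of the numerator is controlled by Hölder continuity, the change of the denominator
  -- by the quadratic error `hBβ`.
  have hid : (ψ (η₀ + y) : ℂ) * F (η₀ + y) / w - (ψ η₀ : ℂ) * F η₀ / w'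
      = ((ψ (η₀ + y) : ℂ) * F (η₀ + y) - (ψ η₀ : ℂ) * F η₀) / w
        + (ψ η₀ : ℂ) * F η₀ * (w' - w) / (w * w') := by
    have := norm_pos_iff.1 hw0
    have := norm_pos_iff.1 hw'0
    field_simp
    ring
  -- The amplitude varies on the scale `P η₀` and `F` on the scale `1`; with `ρ` the smaller of the
  -- two, `t` dominates both Hölder moduli, and also `|y| / ρ` because `γ ≤ 1`.
  set t := (|y| / ρ) ^ γ with ht
  have ht0 : 0 ≤ t := by positivity
  have hyρ : |y| / ρ ≤ 1 := by rw [div_le_one hρ0]; linarith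
  have hty : |y| / ρ ≤ t := by
    have := Real.rpow_le_rpow_of_exponent_ge (by positivity : 0 < |y| / ρ) hyρ hγ1
    simpa using this
  have hnum : ‖(ψ (η₀ + y) : ℂ) * F (η₀ + y) - (ψ η₀ : ℂ) * F η₀‖ ≤ (C + 1) * A * Q * t := by
    have e : (ψ (η₀ + y) : ℂ) * F (η₀ + y) - (ψ η₀ : ℂ) * F η₀
        = ((ψ (η₀ + y) - ψ η₀ : ℝ) : ℂ) * F (η₀ + y) + (ψ η₀ : ℂ) * (F (η₀ + y) - F η₀) := by
      push_cast; ring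
    rw [e]
    refine (norm_add_le _ _).trans ?_
    rw [norm_mul, norm_mul, Complex.norm_real, Complex.norm_real, Real.norm_eq_abs,
      Real.norm_eq_abs]
    have h1 := h.amplitude_holder η₀ (η₀ + y) hyP
    have h2 := hF (η₀ + y) η₀
    rw [add_sub_cancel_left] at h1 h2
    have h3 : (|y| / P η₀) ^ γ ≤ t := by rw [ht]; gcongr
    have h4 : |y| ^ γ ≤ t := by
      rw [ht]
      refine Real.rpow_le_rpow (abs_nonneg _) ?_ hγ.le
      rw [le_div_iff₀ hρ0]; nlinarith
    calc |ψ (η₀ + y) - ψ η₀| * ‖F (η₀ + y)‖ + |ψ η₀| * ‖F (η₀ + y) - F η₀‖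
        ≤ (C * Q * t) * A + Q * (A * t) := by
          gcongr
          · exact h1.trans (by gcongr)
          · exact hA _
          · exact h.amplitude_le η₀
          · exact h2.trans (by gcongr)
      _ = _ := by ring
  have hψF : ‖(ψ η₀ : ℂ) * F η₀‖ ≤ Q * A := by
    rw [norm_mul, Complex.norm_real, Real.norm_eq_abs]
    gcongr
    · exact h.amplitude_le η₀
    · exact hA _
  have hww : ‖w' - w‖ ≤ C * P η₀ ^ (κ - 1) * |y| * |y| := by
    have : w' - w = ((-(B - β * y) : ℝ) : ℂ) := by rw [hw, hw']; push_cast; ring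
    rw [this, Complex.norm_real, Real.norm_eq_abs, abs_neg]
    exact hBβ
  have hPκ : P η₀ ^ (κ - 1) = Q / P η₀ := by rw [Real.rpow_sub hP, Real.rpow_one]
  rw [hid]
  refine (norm_add_le _ _).trans ?_
  rw [norm_div, norm_div, norm_mul _ (w' - w), norm_mul w]
  have hT1 : ‖(ψ (η₀ + y) : ℂ) * F (η₀ + y) - (ψ η₀ : ℂ) * F η₀‖ / ‖w‖
      ≤ (C + 1) / c₃ * A * (t / |y|) := by
    calc _ ≤ (C + 1) * A * Q * t / (c₃ * Q * |y|) := by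
          gcongr
          exact hBl.trans hwB
      _ = _ := by field_simp
  have hT2 : ‖(ψ η₀ : ℂ) * F η₀‖ * ‖w' - w‖ / (‖w‖ * ‖w'‖) ≤ C / (c₃ * c) * A * (t / |y|) := by
    calc _ ≤ (Q * A) * (C * P η₀ ^ (κ - 1) * |y| * |y|) / ((c₃ * Q * |y|) * (c * Q * |y|)) := by
          gcongr
          exact hBl.trans hwB
      _ = C / (c₃ * c) * A * (1 / P η₀) := by rw [hPκ]; field_simp
      _ ≤ C / (c₃ * c) * A * (t / |y|) := by
          gcongr C / (c₃ * c) * A * ?_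
          rw [div_le_div_iff₀ hP hy', one_mul]
          calc |y| = |y| / ρ * ρ := by field_simp
            _ ≤ t * P η₀ := by gcongr
  calc _ ≤ _ := add_le_add hT1 hT2
    _ = _ := by ring

end IsLineSymbol

end Line

/-! ### The uniform one-dimensional singular integral estimate -/

section Line

theorem integrableOn_abs_rpow {γ r : ℝ} (hγ : 0 < γ) (hr : 0 ≤ r) :
    IntervalIntegrable (fun y : ℝ => |y| ^ (γ - 1)) volume (-r) r ∧
      ∫ y in (-r)..r, |y| ^ (γ - 1) = 2 * (r ^ γ / γ) := by
  have h1 : IntervalIntegrable (fun y : ℝ => |y| ^ (γ - 1)) volume 0 r := by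
    refine (intervalIntegral.intervalIntegrable_rpow' (by linarith : -1 < γ - 1)).congr ?_
    intro y hy
    rw [Set.uIoc_of_le hr] at hy
    simp only [abs_of_pos hy.1]
  have h2 : IntervalIntegrable (fun y : ℝ => |y| ^ (γ - 1)) volume (-r) 0 := by
    have := ((IntervalIntegrable.iff_comp_neg (by simp)).1 h1).symm
    simpa using this
  have e1 : ∫ y in (0 : ℝ)..r, |y| ^ (γ - 1) = r ^ γ / γ := by
    rw [intervalIntegral.integral_congr (g := fun y : ℝ => y ^ (γ - 1)),
      integral_rpow (Or.inl (by linarith))]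
    · simp [Real.zero_rpow hγ.ne']
    · intro y hy
      rw [Set.uIcc_of_le hr] at hy
      simp only [abs_of_nonneg hy.1]
  have e2 : ∫ y in (-r)..0, |y| ^ (γ - 1) = r ^ γ / γ := by
    rw [← e1]
    have := intervalIntegral.integral_comp_neg (a := 0) (b := r) (fun y : ℝ => |y| ^ (γ - 1))
    simp only [abs_neg, neg_zero] at this
    exact this.symm
  refine ⟨h2.trans h1, ?_⟩
  rw [← intervalIntegral.integral_add_adjacent_intervals h2 h1, e1, e2]
  ring

/-- The model singular integral over a symmetric interval is bounded. -/
theorem norm_integral_model_le {β ε r : ℝ} (hβ : 0 < β) (hε : ε ≠ 0) (hr : 0 ≤ r) :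
    ‖∫ y in (-r)..r, (1 : ℂ) / (((β * y : ℝ) : ℂ) - Complex.I * ε)‖ ≤ Real.pi / β := by
  set g : ℝ → ℂ := fun y => (1 : ℂ) / (((β * y : ℝ) : ℂ) - Complex.I * ε) with hg
  have hden : ∀ y : ℝ, ((β * y : ℝ) : ℂ) - Complex.I * ε ≠ 0 := by
    intro y h0
    have := congrArg Complex.im h0
    simp at this
    exact hε this
  have hgc : Continuous g := by
    refine Continuous.div continuous_const ?_ hden
    fun_prop
  have hsymm : ∫ y in (-r)..r, g y = ∫ y in (-r)..r, g (-y) := by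
    have := intervalIntegral.integral_comp_neg (a := -r) (b := r) g
    rw [neg_neg] at this
    exact this.symm
  have hpos : ∀ y : ℝ, 0 < (β * y) ^ 2 + ε ^ 2 := fun y => by positivity
  -- Symmetrising in `y` cancels the odd principal value part. What is left is a Poisson kernel,
  -- whose primitive is an arctangent; this is why the bound depends on neither `ε` nor `r`.
  have hsum : ∀ y : ℝ, g y + g (-y) = 2 * (Complex.I * ((ε / ((β * y) ^ 2 + ε ^ 2) : ℝ) : ℂ)) := by
    intro y
    have h1 := hden y
    have h2 := hden (-y)
    have h3 : (((β * y) ^ 2 + ε ^ 2 : ℝ) : ℂ) ≠ 0 := by exact_mod_cast (hpos y).ne'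
    simp only [hg]
    rw [Complex.ofReal_div]
    rw [div_add_div _ _ h1 h2, ← mul_assoc, ← mul_div_assoc, div_eq_div_iff (mul_ne_zero h1 h2) h3]
    push_cast
    linear_combination (-(2 * Complex.I * ε) * (ε:ℂ)^2 ) * Complex.I_sq
  have hdouble : 2 * ∫ y in (-r)..r, g y
      = 2 * ∫ y in (-r)..r, Complex.I * ((ε / ((β * y) ^ 2 + ε ^ 2) : ℝ) : ℂ) := by
    rw [two_mul]
    nth_rw 2 [hsymm]
    have hgc' : Continuous fun y => g (-y) := hgc.comp continuous_neg
    rw [← intervalIntegral.integral_add (hgc.intervalIntegrable _ _)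
      (hgc'.intervalIntegrable _ _), ← intervalIntegral.integral_const_mul]
    exact intervalIntegral.integral_congr fun y _ => hsum y
  rw [mul_left_cancel₀ two_ne_zero hdouble]
  have hcont : Continuous fun y : ℝ => |ε| / ((β * y) ^ 2 + ε ^ 2) :=
    continuous_const.div (by fun_prop) fun y => (hpos y).ne'
  have hder : ∀ y : ℝ, HasDerivAt (fun y : ℝ => Real.arctan (β * y / |ε|) / β)
      (|ε| / ((β * y) ^ 2 + ε ^ 2)) y := by
    intro y
    have hε' : 0 < |ε| := abs_pos.2 hε
    have h1 : HasDerivAt (fun y : ℝ => β * y / |ε|) (β / |ε|) y := by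
      simpa using ((hasDerivAt_id y).const_mul β).div_const |ε|
    convert! (h1.arctan).div_const β using 1
    have h3 := (hpos y).ne'
    rw [div_pow, sq_abs]
    have h4 : (1 + (β * y) ^ 2 / ε ^ 2) ≠ 0 := by positivity
    field_simp
    rw [show |ε| ^ 2 = ε ^ 2 from sq_abs ε]
    ring
  refine (intervalIntegral.norm_integral_le_integral_norm (by linarith)).trans ?_
  have hnorm : ∀ y : ℝ, ‖Complex.I * ((ε / ((β * y) ^ 2 + ε ^ 2) : ℝ) : ℂ)‖
      = |ε| / ((β * y) ^ 2 + ε ^ 2) := by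
    intro y
    rw [norm_mul, Complex.norm_I, one_mul, Complex.norm_real, Real.norm_eq_abs, abs_div,
      abs_of_pos (hpos y)]
  simp_rw [hnorm]
  rw [intervalIntegral.integral_eq_sub_of_hasDerivAt (fun y _ => hder y)
    (hcont.intervalIntegrable _ _), ← sub_div]
  gcongr
  have h1 := Real.arctan_lt_pi_div_two (β * r / |ε|)
  have h2 := Real.neg_pi_div_two_lt_arctan (β * (-r) / |ε|)
  linarith

namespace IsLineSymbol

variable {κ c C δ γ : ℝ} {P b b' ψ : ℝ → ℝ} {J : Set ℝ}

theorem continuous_size (h : IsLineSymbol κ c C δ γ P b b' ψ J) : Continuous P := by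
  have : LipschitzWith 1 P := LipschitzWith.of_dist_le_mul fun x y => by
    simpa [Real.dist_eq] using h.size_lipschitz x y
  exact this.continuous

theorem sub_I_mul_ne_zero {x ε : ℝ} (hε : ε ≠ 0) : (x : ℂ) - Complex.I * ε ≠ 0 := by
  intro h0
  have := congrArg Complex.im h0
  simp at this
  exact hε this

theorem abs_le_norm_sub_I_mul (x ε : ℝ) : |x| ≤ ‖(x : ℂ) - Complex.I * ε‖ := by
  have := Complex.abs_re_le_norm ((x : ℂ) - Complex.I * ε)
  simpa using this

theorem abs_le_norm_sub_I_mul' (x ε : ℝ) : |ε| ≤ ‖(x : ℂ) - Complex.I * ε‖ := by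
  have := Complex.abs_im_le_norm ((x : ℂ) - Complex.I * ε)
  simpa using this

/-- The integrand away from the singularity. -/
theorem norm_div_le_of_le (h : IsLineSymbol κ c C δ γ P b b' ψ J) {e lam ε η : ℝ} (he : 0 < e)
    {z : ℂ} (hlow : ψ η ≠ 0 → e * P η ^ κ * min 1 (P η) ≤ |b η - lam|) :
    ‖(ψ η : ℂ) * z / (((b η - lam : ℝ) : ℂ) - Complex.I * ε)‖ ≤ 1 / e * (‖z‖ / min 1 (P η)) := by
  have hP := h.size_pos η
  by_cases hψ : ψ η = 0
  · rw [hψ]; simp; positivity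
  have hQ : 0 < P η ^ κ := Real.rpow_pos_of_pos hP κ
  have hρ : 0 < min 1 (P η) := lt_min one_pos hP
  rw [norm_div, norm_mul, Complex.norm_real, Real.norm_eq_abs]
  calc _ ≤ P η ^ κ * ‖z‖ / (e * P η ^ κ * min 1 (P η)) := by
        gcongr
        · exact h.amplitude_le η
        · exact (hlow hψ).trans (abs_le_norm_sub_I_mul _ _)
    _ = _ := by field_simp

set_option maxHeartbeats 1000000 in
/-- The one-dimensional resolvent estimate: no oscillation is used, only the boundedness and
the Hölder continuity of `F`. -/
theorem norm_integral_le (h : IsLineSymbol κ c C δ γ P b b' ψ J) (hc : 0 < c) (hκ : 0 ≤ κ)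
    (hC : 0 ≤ C) (hδ : 0 < δ) (hδ' : δ ≤ 1 / 4) (hγ : 0 < γ) (hγ1 : γ ≤ 1) {F : ℝ → ℂ}
    {A ε : ℝ} (lam : ℝ) (hε : ε ≠ 0)
    (hA : ∀ η, ‖F η‖ ≤ A) (hF : ∀ η η', ‖F η - F η'‖ ≤ A * |η - η'| ^ γ)
    (hFm : Measurable F) (hFi : Integrable fun η => ‖F η‖ / min 1 (P η)) :
    ‖∫ η, (ψ η : ℂ) * F η / (((b η - lam : ℝ) : ℂ) - Complex.I * ε)‖ ≤
      (1 / (c * (3 / 4) ^ κ * (3 / 16 * δ)) +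
        ((C + 1) / (c * (3 / 4) ^ κ) + C / (c * (3 / 4) ^ κ * c)) * (2 / γ) + Real.pi / c) *
        (A + ∫ η, ‖F η‖ / min 1 (P η)) := by
  set c₃ := c * (3 / 4 : ℝ) ^ κ with hc₃
  have hc₃0 : 0 < c₃ := by positivity
  set K₁ := 1 / (c₃ * (3 / 16 * δ)) with hK₁
  set K₂ := (C + 1) / c₃ + C / (c₃ * c) with hK₂
  have hK₁0 : 0 ≤ K₁ := by positivity
  have hK₂0 : 0 ≤ K₂ := by positivity
  have hA0 : 0 ≤ A := (norm_nonneg _).trans (hA 0)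
  set D := ∫ η, ‖F η‖ / min 1 (P η) with hD
  have hρpos : ∀ η, 0 < min 1 (P η) := fun η => lt_min one_pos (h.size_pos η)
  have hD0 : 0 ≤ D := integral_nonneg fun η => div_nonneg (norm_nonneg _) (hρpos η).le
  set G : ℝ → ℂ := fun η => (ψ η : ℂ) * F η / (((b η - lam : ℝ) : ℂ) - Complex.I * ε) with hG
  have hGm : Measurable G := by
    have := h.measurable_symbol
    have := h.measurable_amplitude
    fun_prop
  have hπ := Real.pi_pos
  have hfar : ∀ η, (ψ η ≠ 0 → c₃ * (3 / 16 * δ) * P η ^ κ * min 1 (P η) ≤ |b η - lam|) →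
      ‖G η‖ ≤ K₁ * (‖F η‖ / min 1 (P η)) := fun η hη =>
    h.norm_div_le_of_le (by positivity) hη
  -- This settles the case in which no singularity meets the support of `ψ`. It is used twice: when
  -- `lam` is not attained on `J`, and when `ψ` vanishes near the root.
  have htriv : (∀ η, ψ η ≠ 0 → c₃ * (3 / 16 * δ) * P η ^ κ * min 1 (P η) ≤ |b η - lam|) →
      ‖∫ η, G η‖ ≤ (K₁ + K₂ * (2 / γ) + Real.pi / c) * (A + D) := by
    intro hall
    calc ‖∫ η, G η‖ ≤ ∫ η, K₁ * (‖F η‖ / min 1 (P η)) :=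
          norm_integral_le_of_norm_le (hFi.const_mul _) (ae_of_all _ fun η => hfar η (hall η))
      _ = K₁ * D := integral_const_mul _ _
      _ ≤ (K₁ + K₂ * (2 / γ) + Real.pi / c) * (A + D) := by
          have h1 : 0 ≤ K₂ * (2 / γ) + Real.pi / c := by positivity
          nlinarith [mul_nonneg h1 (add_nonneg hA0 hD0), mul_nonneg hK₁0 hA0]
  by_cases hroot : ∃ η₀ ∈ J, b η₀ = lam
  swap
  · push Not at hroot
    refine htriv fun η hη => ?_
    refine le_trans ?_ (h.abs_sub_le_of_no_root hc hκ hδ hδ' hη hroot)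
    have h1 : 0 ≤ c₃ * P η ^ κ * (δ * min 1 (P η)) :=
      mul_nonneg (mul_nonneg hc₃0.le (Real.rpow_nonneg (h.size_pos η).le _))
        (mul_nonneg hδ.le (hρpos η).le)
    nlinarith
  obtain ⟨η₀, hη₀, rfl⟩ := hroot
  have hP₀ := h.size_pos η₀
  -- The factor `1/4` leaves room for the interval of radius `r` about the root inside the interval
  -- that `support_subset` places in `J`. Together with the loss `3/4` from comparing `P η₀` with `P
  -- η` it produces the constant `3/16`.
  set r := min 1 (P η₀) * δ / 4 with hr
  have hr0 : 0 < r := by have := hρpos η₀; positivity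
  have hrP : r ≤ P η₀ * δ / 4 := by rw [hr]; gcongr; exact min_le_right _ _
  have hout : ∀ η, r ≤ |η - η₀| →
      (ψ η ≠ 0 → c₃ * (3 / 16 * δ) * P η ^ κ * min 1 (P η) ≤ |b η - b η₀|) := by
    intro η hη hψ
    refine le_trans ?_ (h.abs_sub_root_le hc hκ hδ hδ' hψ hη₀)
    have hPη := h.size_pos η
    have hρ := hρpos η
    have h1 : 3 / 16 * δ * min 1 (P η) ≤ min |η - η₀| (δ * min 1 (P η)) := by
      refine le_min ?_ (by nlinarith [mul_pos hδ hρ])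
      by_cases hcase : δ * min 1 (P η) ≤ |η - η₀|
      · nlinarith [mul_pos hδ hρ]
      · push Not at hcase
        have h2 : δ * min 1 (P η) ≤ P η / 4 := by
          have := min_le_right 1 (P η)
          nlinarith
        have h3 := h.size_le (η := η) (η' := η₀) (by rw [abs_sub_comm]; linarith)
        have h4 : 3 / 4 * min 1 (P η) ≤ min 1 (P η₀) := by
          refine le_min ?_ ?_
          · have := min_le_left 1 (P η); linarith
          · have := min_le_right 1 (P η); linarith
        calc 3 / 16 * δ * min 1 (P η) = (3 / 4 * min 1 (P η)) * δ / 4 := by ring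
          _ ≤ r := by rw [hr]; gcongr
          _ ≤ _ := hη
    calc c₃ * (3 / 16 * δ) * P η ^ κ * min 1 (P η)
        = c₃ * P η ^ κ * (3 / 16 * δ * min 1 (P η)) := by ring
      _ ≤ _ := by
        have := Real.rpow_nonneg hPη.le κ
        gcongr
  by_cases hnear : ∃ η₁, ψ η₁ ≠ 0 ∧ |η₁ - η₀| < r
  swap
  · push Not at hnear
    exact htriv fun η hη => hout η (hnear η hη) hη
  obtain ⟨η₁, hψ₁, hη₁⟩ := hnear
  -- A single support point `η₁` near the root is enough: `2 r ≤ δ P η₀ / 2`, while `δ P η₁ ≥ 3 δ P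
  -- η₀ / 4`.
  have hNJ : Set.Icc (η₀ - r) (η₀ + r) ⊆ J := by
    refine subset_trans ?_ (h.support_subset η₁ hψ₁)
    have h1 : 3 / 4 * P η₀ ≤ P η₁ := h.size_le (by nlinarith)
    rw [abs_lt] at hη₁
    refine Set.Icc_subset_Icc ?_ ?_ <;> nlinarith [mul_pos hδ hP₀]
  set N := Set.Icc (η₀ - r) (η₀ + r) with hN
  have hNm : MeasurableSet N := measurableSet_Icc
  have hβ : 0 < b' η₀ := lt_of_lt_of_le (mul_pos hc (Real.rpow_pos_of_pos hP₀ κ)) (h.le_deriv η₀ hη₀)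
  -- the part away from the root
  have hGfar : ∀ η ∈ Nᶜ, ‖G η‖ ≤ K₁ * (‖F η‖ / min 1 (P η)) := by
    intro η hη
    refine hfar η (hout η ?_)
    by_contra! hcon
    rw [abs_lt] at hcon
    exact hη ⟨by linarith, by linarith⟩
  have hGi2 : IntegrableOn G Nᶜ :=
    ((hFi.const_mul K₁).integrableOn).mono' hGm.aestronglyMeasurable
      ((ae_restrict_iff' hNm.compl).2 (ae_of_all _ hGfar))
  have hfarint : ‖∫ η in Nᶜ, G η‖ ≤ K₁ * D := by
    calc _ ≤ ∫ η in Nᶜ, K₁ * (‖F η‖ / min 1 (P η)) :=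
          norm_integral_le_of_norm_le (hFi.const_mul K₁).integrableOn
            ((ae_restrict_iff' hNm.compl).2 (ae_of_all _ hGfar))
      _ ≤ ∫ η, K₁ * (‖F η‖ / min 1 (P η)) :=
          setIntegral_le_integral (hFi.const_mul K₁)
            (ae_of_all _ fun η => mul_nonneg hK₁0 (div_nonneg (norm_nonneg _) (hρpos η).le))
      _ = K₁ * D := integral_const_mul _ _
  -- the part near the root
  have hGi1 : IntegrableOn G N := by
    obtain ⟨M, hM⟩ := (isCompact_Icc (a := η₀ - r) (b := η₀ + r)).exists_bound_of_continuousOn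
      (f := fun η => P η ^ κ) (h.continuous_size.rpow_const fun η => Or.inr hκ).continuousOn
    refine Measure.integrableOn_of_bounded (M := M * A / |ε|) (by simp [hN])
      hGm.aestronglyMeasurable
      ((ae_restrict_iff' hNm).2 (ae_of_all _ fun η hη => ?_))
    have h1 := hM η hη
    have h2 : |ψ η| ≤ M := (h.amplitude_le η).trans ((le_abs_self _).trans h1)
    have h3 : 0 < |ε| := abs_pos.2 hε
    simp only [hG]
    rw [norm_div, norm_mul, Complex.norm_real, Real.norm_eq_abs]
    have h4 : 0 ≤ M := (abs_nonneg _).trans h2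
    gcongr
    · exact hA η
    · exact abs_le_norm_sub_I_mul' _ _
  set mdl : ℝ → ℂ := fun y => (ψ η₀ : ℂ) * F η₀ *
    ((1 : ℂ) / (((b' η₀ * y : ℝ) : ℂ) - Complex.I * ε)) with hmdl
  have hmc : Continuous mdl := by
    refine continuous_const.mul (continuous_const.div (by fun_prop) fun y => ?_)
    exact sub_I_mul_ne_zero hε
  have hGN : ∫ η in N, G η = ∫ y in (-r)..r, G (η₀ + y) := by
    rw [intervalIntegral.integral_comp_add_left (fun y => G y), ← sub_eq_add_neg,
      intervalIntegral.integral_of_le (by linarith), integral_Icc_eq_integral_Ioc]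
  have hGi1' : IntervalIntegrable (fun y => G (η₀ + y)) volume (-r) r := by
    have h1 : IntervalIntegrable G volume (η₀ - r) (η₀ + r) := by
      rw [intervalIntegrable_iff_integrableOn_Icc_of_le (by linarith)]
      exact hGi1
    have := h1.comp_add_left η₀
    simpa using this
  obtain ⟨hri, hre⟩ := integrableOn_abs_rpow hγ hr0.le
  set ρ := min 1 (P η₀) with hρ
  have hρ0 : 0 < ρ := hρpos η₀
  have hpt : ∀ y : ℝ, y ∈ Set.Ioc (-r) r → ‖G (η₀ + y) - mdl y‖ ≤
      K₂ * A * ρ ^ (-γ) * |y| ^ (γ - 1) ∨ y = 0 := by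
    intro y hy
    by_cases hy0 : y = 0
    · exact Or.inr hy0
    left
    have hyr : |y| ≤ r := abs_le.2 ⟨hy.1.le, hy.2⟩
    have h1 := h.norm_sub_model_le hc hκ hC hγ hγ1 (ε := ε) hA hF hη₀
      (hNJ ⟨by linarith [hy.1], by linarith [hy.2]⟩) hy0 (hyr.trans (by rw [hr]; nlinarith))
    have h2 : (|y| / ρ) ^ γ / |y| = ρ ^ (-γ) * |y| ^ (γ - 1) := by
      rw [Real.div_rpow (abs_nonneg _) hρ0.le, Real.rpow_neg hρ0.le,
        Real.rpow_sub (abs_pos.2 hy0), Real.rpow_one]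
      field_simp
    rw [h2] at h1
    calc _ = _ := by rw [hmdl]; simp only [hG, mul_one_div]
      _ ≤ _ := h1
      _ = _ := by ring
  -- The error is `O(ρ^{-γ} |y|^{γ-1})`; its integral contains the scale only through `(r / ρ)^γ ≤
  -- 1`.
  have hdiff : ‖∫ y in (-r)..r, (G (η₀ + y) - mdl y)‖ ≤ K₂ * (2 / γ) * A := by
    calc _ ≤ ∫ y in (-r)..r, K₂ * A * ρ ^ (-γ) * |y| ^ (γ - 1) := by
          refine intervalIntegral.norm_integral_le_of_norm_le (by linarith) ?_
            (hri.const_mul _)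
          have h0 : ∀ᵐ y : ℝ, y ≠ 0 := by simp [ae_iff]
          filter_upwards [h0] with y hy0 hy
          exact (hpt y hy).resolve_right hy0
      _ = K₂ * A * ρ ^ (-γ) * (2 * (r ^ γ / γ)) := by
          rw [intervalIntegral.integral_const_mul, hre]
      _ = K₂ * (2 / γ) * A * (r / ρ) ^ γ := by
          rw [Real.div_rpow hr0.le hρ0.le, Real.rpow_neg hρ0.le]
          field_simp
      _ ≤ K₂ * (2 / γ) * A * 1 := by
          gcongr
          refine Real.rpow_le_one (by positivity) ?_ hγ.le
          rw [div_le_one hρ0, hr]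
          nlinarith
      _ = _ := by ring
  have hmodel : ‖∫ y in (-r)..r, mdl y‖ ≤ Real.pi / c * A := by
    have hQ := Real.rpow_pos_of_pos hP₀ κ
    simp only [hmdl]
    rw [intervalIntegral.integral_const_mul, norm_mul, norm_mul, Complex.norm_real,
      Real.norm_eq_abs]
    calc _ ≤ P η₀ ^ κ * A * (Real.pi / (c * P η₀ ^ κ)) := by
          gcongr
          · exact h.amplitude_le η₀
          · exact hA η₀
          · exact (norm_integral_model_le hβ hε hr0.le).trans (by gcongr; exact h.le_deriv η₀ hη₀)
      _ = _ := by field_simp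
  have hnearint : ‖∫ η in N, G η‖ ≤ (K₂ * (2 / γ) + Real.pi / c) * A := by
    have e : ∫ y in (-r)..r, G (η₀ + y)
        = (∫ y in (-r)..r, (G (η₀ + y) - mdl y)) + ∫ y in (-r)..r, mdl y := by
      rw [← intervalIntegral.integral_add (hGi1'.sub (hmc.intervalIntegrable _ _))
        (hmc.intervalIntegrable _ _)]
      simp
    rw [hGN, e]
    refine (norm_add_le _ _).trans ?_
    rw [add_mul]
    exact add_le_add hdiff hmodel
  have hGi : Integrable G := by
    rw [← integrableOn_univ, ← Set.union_compl_self N]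
    exact hGi1.union hGi2
  rw [← integral_add_compl hNm hGi]
  refine (norm_add_le _ _).trans ((add_le_add hnearint hfarint).trans ?_)
  have h1 : 0 ≤ K₂ * (2 / γ) + Real.pi / c := by positivity
  nlinarith [mul_nonneg h1 hD0, mul_nonneg hK₁0 hA0]

end IsLineSymbol

end Line

/-! ### Lifted frequencies, directions, and the hypotheses on symbols -/

section Geometry

/-- `ℝ × ℝⁿ` with its Euclidean norm. -/
abbrev Ext (n : ℕ) : Type := WithLp 2 (ℝ × Rn n)

/-- The point `(κ₀, X)`. -/
def lift {n : ℕ} (κ₀ : ℝ) (X : Rn n) : Ext n := WithLp.toLp 2 (κ₀, X)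

/-- `(κ₀² + |X|²)^{1/2}`. -/
def size {n : ℕ} (κ₀ : ℝ) (X : Rn n) : ℝ := ‖lift κ₀ X‖

/-- The direction of `(κ₀, X)`. -/
def dir {n : ℕ} (κ₀ : ℝ) (X : Rn n) : Ext n := (size κ₀ X)⁻¹ • lift κ₀ X

/-- The closure of the set of directions. -/
def dirs (n : ℕ) (κ₀ : ℝ) : Set (Ext n) := {Θ | ‖Θ‖ = 1 ∧ 0 ≤ Θ.fst ∧ (κ₀ = 0 → Θ.fst = 0)}

/-- The `j`-th unit vector. -/
abbrev unitVec {n : ℕ} (j : Fin n) : Rn n := EuclideanSpace.single j 1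

variable {n : ℕ}

theorem lift_sub_lift (κ₀ : ℝ) (X X' : Rn n) : ‖lift κ₀ X - lift κ₀ X'‖ = ‖X - X'‖ := by
  have h : lift κ₀ X - lift κ₀ X' = WithLp.toLp 2 ((0 : ℝ), X - X') := by
    unfold lift; rw [← WithLp.toLp_sub, Prod.mk_sub_mk, sub_self]
  have h2 := WithLp.prod_norm_sq_eq_of_L2 (lift κ₀ X - lift κ₀ X')
  rw [h] at h2 ⊢
  simp only [WithLp.toLp_fst, WithLp.toLp_snd, norm_zero, ne_eq, OfNat.ofNat_ne_zero,
    not_false_eq_true, zero_pow, zero_add] at h2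
  exact (sq_eq_sq₀ (norm_nonneg _) (norm_nonneg _)).1 h2

theorem size_sq (κ₀ : ℝ) (X : Rn n) : size κ₀ X ^ 2 = κ₀ ^ 2 + ‖X‖ ^ 2 := by
  rw [size, WithLp.prod_norm_sq_eq_of_L2]
  simp [lift]

theorem size_nonneg (κ₀ : ℝ) (X : Rn n) : 0 ≤ size κ₀ X := norm_nonneg _

theorem norm_le_size (κ₀ : ℝ) (X : Rn n) : ‖X‖ ≤ size κ₀ X := by
  refine (sq_le_sq₀ (norm_nonneg _) (size_nonneg _ _)).1 ?_
  rw [size_sq]; nlinarith [sq_nonneg κ₀]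

theorem le_size (κ₀ : ℝ) (X : Rn n) : |κ₀| ≤ size κ₀ X := by
  refine (sq_le_sq₀ (abs_nonneg _) (size_nonneg _ _)).1 ?_
  rw [size_sq, sq_abs]; nlinarith [sq_nonneg ‖X‖]

theorem size_zero (X : Rn n) : size 0 X = ‖X‖ := by
  refine (sq_eq_sq₀ (size_nonneg _ _) (norm_nonneg _)).1 ?_
  rw [size_sq]; simp

theorem abs_size_sub_le (κ₀ : ℝ) (X X' : Rn n) : |size κ₀ X - size κ₀ X'| ≤ ‖X - X'‖ := by
  rw [← lift_sub_lift κ₀]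
  exact abs_norm_sub_norm_le _ _

theorem norm_unitVec (j : Fin n) : ‖unitVec j‖ = 1 := by simp [unitVec]

theorem norm_add_smul_sub (X : Rn n) (j : Fin n) (t t' : ℝ) :
    ‖(X + t • unitVec j) - (X + t' • unitVec j)‖ = |t - t'| := by
  rw [add_sub_add_left_eq_sub, ← sub_smul, norm_smul, norm_unitVec, mul_one, Real.norm_eq_abs]

theorem continuous_lift (κ₀ : ℝ) : Continuous (lift (n := n) κ₀) := by
  refine Metric.continuous_iff.2 fun X ε hε => ⟨ε, hε, fun X' h => ?_⟩
  rw [dist_eq_norm, lift_sub_lift, ← dist_eq_norm]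
  exact h

theorem continuous_size (κ₀ : ℝ) : Continuous (size (n := n) κ₀) := (continuous_lift κ₀).norm

theorem norm_dir {κ₀ : ℝ} {X : Rn n} (h : 0 < size κ₀ X) : ‖dir κ₀ X‖ = 1 := by
  rw [dir, norm_smul, norm_inv, Real.norm_eq_abs, abs_of_pos h]
  exact inv_mul_cancel₀ h.ne'

theorem dir_mem {κ₀ : ℝ} (hκ₀ : 0 ≤ κ₀) {X : Rn n} (h : 0 < size κ₀ X) :
    dir κ₀ X ∈ dirs n κ₀ := by
  refine ⟨norm_dir h, ?_, fun h0 => ?_⟩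
  · simp only [dir, lift, WithLp.smul_fst, WithLp.toLp_fst, smul_eq_mul]
    positivity
  · simp [dir, lift, h0]

/-- Moving the point and renormalising its length each contribute one copy of `‖X' - X‖ / size κ₀
X`. This is the source of all the scale invariant Lipschitz bounds for the cut-offs. -/
theorem norm_dir_sub_le {κ₀ : ℝ} {X X' : Rn n} (h : 0 < size κ₀ X) (h' : 0 < size κ₀ X') :
    ‖dir κ₀ X' - dir κ₀ X‖ ≤ 2 * (‖X' - X‖ / size κ₀ X) := by
  have e : dir κ₀ X' - dir κ₀ X
      = (size κ₀ X)⁻¹ • (lift κ₀ X' - lift κ₀ X) +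
        ((size κ₀ X)⁻¹ * (size κ₀ X - size κ₀ X')) • dir κ₀ X' := by
    have h2 : lift κ₀ X' = size κ₀ X' • dir κ₀ X' := by
      rw [dir, smul_smul, mul_inv_cancel₀ h'.ne', one_smul]
    rw [h2, smul_sub, smul_smul, mul_sub, sub_smul, inv_mul_cancel₀ h.ne', one_smul, dir]
    abel
  rw [e]
  refine (norm_add_le _ _).trans ?_
  rw [norm_smul, norm_smul, lift_sub_lift, norm_dir h', mul_one, norm_mul, norm_inv,
    Real.norm_eq_abs, Real.norm_eq_abs, abs_of_pos h, abs_sub_comm]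
  have := abs_size_sub_le κ₀ X' X
  have h3 : (size κ₀ X)⁻¹ * |size κ₀ X' - size κ₀ X| ≤ (size κ₀ X)⁻¹ * ‖X' - X‖ := by gcongr
  calc _ ≤ (size κ₀ X)⁻¹ * ‖X' - X‖ + (size κ₀ X)⁻¹ * ‖X' - X‖ := by gcongr
    _ = _ := by ring

/-- For `κ₀ = 0` the set is the unit sphere of `ℝⁿ`. For `κ₀ ≠ 0` it is a closed hemisphere whose
equator plays the role of infinity, and compactness gives uniformity up to infinity. -/
theorem isCompact_dirs (κ₀ : ℝ) : IsCompact (dirs n κ₀) := by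
  have hc : Continuous fun Θ : Ext n => Θ.fst := by fun_prop
  have h : dirs n κ₀ = Metric.sphere (0 : Ext n) 1 ∩
      ({Θ | 0 ≤ Θ.fst} ∩ {Θ | κ₀ = 0 → Θ.fst = 0}) := by
    ext Θ; simp [dirs]
  rw [h]
  refine (isCompact_sphere _ _).inter_right (IsClosed.inter (isClosed_le continuous_const hc) ?_)
  by_cases h0 : κ₀ = 0
  · simpa [h0] using isClosed_eq hc continuous_const
  · simp [h0]

/-- A circular cap, seen as a cone. -/
theorem convex_cap (Θ : Ext n) {a : ℝ} (ha : 0 ≤ a) :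
    Convex ℝ {Y : Ext n | a * ‖Y‖ < inner ℝ Y Θ} := by
  intro Y hY Z hZ s t hs ht hst
  simp only [Set.mem_ofPred_eq] at *
  rw [inner_add_left, real_inner_smul_left, real_inner_smul_left]
  have h1 : ‖s • Y + t • Z‖ ≤ s * ‖Y‖ + t * ‖Z‖ := by
    refine (norm_add_le _ _).trans ?_
    rw [norm_smul, norm_smul, Real.norm_eq_abs, Real.norm_eq_abs, abs_of_nonneg hs,
      abs_of_nonneg ht]
  have h2 : a * ‖s • Y + t • Z‖ ≤ s * (a * ‖Y‖) + t * (a * ‖Z‖) := by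
    calc _ ≤ a * (s * ‖Y‖ + t * ‖Z‖) := by gcongr
      _ = _ := by ring
  rcases hs.eq_or_lt with rfl | hs'
  · have : t = 1 := by linarith
    subst this
    linarith
  · nlinarith [mul_lt_mul_of_pos_left hY hs', mul_le_mul_of_nonneg_left hZ.le ht]

/-- A line in `ℝⁿ` lifts to an affine line, which meets the convex cone of `convex_cap` in an
interval. These intervals serve as the sets `J` of `IsLineSymbol`. -/
theorem ordConnected_cap (κ₀ : ℝ) (X : Rn n) (j : Fin n) (Θ : Ext n) {a : ℝ} (ha : 0 ≤ a) :
    {t : ℝ | a * size κ₀ (X + t • unitVec j) < inner ℝ (lift κ₀ (X + t • unitVec j)) Θ}.OrdConnected := by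
  refine Convex.ordConnected ?_
  intro x hx y hy s t hs ht hst
  have h := convex_cap Θ ha hx hy hs ht hst
  have e : s • lift κ₀ (X + x • unitVec j) + t • lift κ₀ (X + y • unitVec j)
      = lift κ₀ (X + (s • x + t • y) • unitVec j) := by
    change WithLp.toLp 2 (s • (κ₀, X + x • unitVec j) + t • (κ₀, X + y • unitVec j)) = _
    unfold lift
    congr 1
    refine Prod.ext ?_ ?_
    · simp only [Prod.fst_add, Prod.smul_fst, smul_eq_mul]
      rw [← add_mul, hst, one_mul]
    · simp only [Prod.snd_add, Prod.smul_snd]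
      calc _ = (s + t) • X + (s • x + t • y) • unitVec j := by module
        _ = _ := by rw [hst, one_smul]
  rw [e] at h
  exact h

/-- For `κ ≤ 1` this is subadditivity of `x ↦ x^κ`, for `κ ≥ 1` the mean value theorem on `[0, 2]`.
It gives the amplitude `‖X‖^κ` its Hölder bound at points where `‖X‖` may vanish although `size`
does not. -/
theorem abs_rpow_sub_rpow_le {κ γ : ℝ} (hκ : 0 ≤ κ) (hγ : 0 < γ) (hγ1 : γ ≤ 1)
    (hγκ : κ = 0 ∨ γ ≤ κ) {u v : ℝ} (hu : 0 ≤ u) (hv : 0 ≤ v) (hu2 : u ≤ 2) (hv2 : v ≤ 2)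
    (huv : |u - v| ≤ 1) : |u ^ κ - v ^ κ| ≤ (κ * 2 ^ κ + 1) * |u - v| ^ γ := by
  wlog hle : v ≤ u generalizing u v
  · rw [abs_sub_comm, abs_sub_comm u v]
    exact this hv hu hv2 hu2 (by rwa [abs_sub_comm]) (le_of_not_ge hle)
  have hd : 0 ≤ u - v := by linarith
  have hm : v ^ κ ≤ u ^ κ := Real.rpow_le_rpow hv hle hκ
  rw [abs_of_nonneg hd] at huv ⊢
  rw [abs_of_nonneg (by linarith)]
  have hd0 : 0 ≤ (u - v) ^ γ := by positivity
  have h2 : 0 ≤ κ * 2 ^ κ := by positivity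
  rcases hγκ with h0 | h0
  · rw [h0]; simp; positivity
  rcases le_total κ 1 with h1 | h1
  · have h3 := Real.rpow_add_le_add_rpow hv hd hκ h1
    rw [add_sub_cancel] at h3
    have h4 : (u - v) ^ κ ≤ (u - v) ^ γ := Real.rpow_le_rpow_of_exponent_ge_of_imp hd huv h0
      (fun _ h => absurd h (by linarith))
    nlinarith [mul_nonneg h2 hd0]
  · have h3 : u ^ κ - v ^ κ ≤ κ * 2 ^ κ * (u - v) := by
      have := Convex.norm_image_sub_le_of_norm_hasDerivWithin_le (f := fun x : ℝ => x ^ κ)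
        (f' := fun x => κ * x ^ (κ - 1)) (s := Set.Icc 0 2) (C := κ * 2 ^ κ) (x := v) (y := u)
        (fun x hx => (Real.hasDerivAt_rpow_const (Or.inr h1)).hasDerivWithinAt)
        (fun x hx => by
          rw [Real.norm_eq_abs, abs_of_nonneg (mul_nonneg hκ (Real.rpow_nonneg hx.1 _))]
          gcongr
          calc x ^ (κ - 1) ≤ 2 ^ (κ - 1) := Real.rpow_le_rpow hx.1 hx.2 (by linarith)
            _ ≤ 2 ^ κ := Real.rpow_le_rpow_of_exponent_le (by norm_num) (by linarith))
        (convex_Icc _ _) ⟨hv, hv2⟩ ⟨hu, hu2⟩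
      rw [Real.norm_eq_abs, Real.norm_eq_abs, abs_of_nonneg hd] at this
      exact (le_abs_self _).trans this
    have h4 : u - v ≤ (u - v) ^ γ := by
      have := Real.rpow_le_rpow_of_exponent_ge_of_imp hd huv hγ1
        (fun _ h => absurd h one_ne_zero)
      simpa using this
    nlinarith [mul_le_mul_of_nonneg_left h4 h2]

/-- A dispersive symbol: its partial derivatives `D j` are comparable to `size ^ κ` times a
continuous function of the direction, and the gradient does not vanish. -/
structure IsDispersive (κ κ₀ C : ℝ) (p : Rn n → ℝ) (D : Fin n → Rn n → ℝ)
    (G : Fin n → Ext n → ℝ) : Prop where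
  nonneg : 0 ≤ κ₀
  measurable : Measurable p
  hasDerivAt : ∀ j X, 0 < size κ₀ X → HasDerivAt (fun t : ℝ => p (X + t • unitVec j)) (D j X) 0
  eq_angular : ∀ j X, 0 < size κ₀ X → D j X = size κ₀ X ^ κ * G j (dir κ₀ X)
  continuousOn : ∀ j, ContinuousOn (G j) (dirs n κ₀)
  exists_ne : ∀ Θ ∈ dirs n κ₀, ∃ j, G j Θ ≠ 0
  deriv_lipschitz : ∀ j X, 0 < size κ₀ X → ∀ t : ℝ, |t| ≤ size κ₀ X / 4 →
    |D j (X + t • unitVec j) - D j X| ≤ C * size κ₀ X ^ (κ - 1) * |t|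

/-- A finite partition of unity adapted to a dispersive symbol, along whose pieces the symbol is
strictly monotone in a coordinate direction. -/
structure IsAdapted (κ κ₀ c C δ γ : ℝ) (p : Rn n → ℝ) {N : ℕ} (j : Fin N → Fin n) (σ : Fin N → ℝ)
    (χ : Fin N → Rn n → ℝ) : Prop where
  measurable : ∀ i, Measurable (χ i)
  nonneg : ∀ i X, 0 ≤ χ i X
  le_one : ∀ i X, χ i X ≤ 1
  sign : ∀ i, σ i = 1 ∨ σ i = -1
  sum_eq_one : ∀ X, 0 < size κ₀ X → ∑ i, χ i X = 1
  isLineSymbol : ∀ i X, (∀ t : ℝ, 0 < size κ₀ (X + t • unitVec (j i))) → ∃ b' J,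
    IsLineSymbol κ c C δ γ (fun t => size κ₀ (X + t • unitVec (j i)))
      (fun t => σ i * p (X + t • unitVec (j i))) b'
      (fun t => χ i (X + t • unitVec (j i)) * ‖X + t • unitVec (j i)‖ ^ κ) J

end Geometry

/-! ### The partition of unity adapted to a dispersive symbol -/

section Partition

variable {n : ℕ} {κ κ₀ C : ℝ} {p : Rn n → ℝ} {D : Fin n → Rn n → ℝ} {G : Fin n → Ext n → ℝ}

namespace IsDispersive

/-- Near a direction, one of the coordinate derivatives has a fixed sign. -/
theorem exists_cap (h : IsDispersive κ κ₀ C p D G) {Θ₀ : Ext n} (hΘ₀ : Θ₀ ∈ dirs n κ₀) :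
    ∃ j : Fin n, ∃ σ c μ : ℝ, (σ = 1 ∨ σ = -1) ∧ 0 < c ∧ 0 < μ ∧ μ ≤ 1 ∧
      ∀ Θ ∈ dirs n κ₀, 1 - μ < inner ℝ Θ Θ₀ → c ≤ σ * G j Θ := by
  obtain ⟨j, hj⟩ := h.exists_ne Θ₀ hΘ₀
  have hpos : 0 < |G j Θ₀| := abs_pos.2 hj
  obtain ⟨r, hr, hr'⟩ := Metric.continuousWithinAt_iff.1 (h.continuousOn j Θ₀ hΘ₀) (|G j Θ₀| / 2)
    (by positivity)
  -- For unit vectors `‖Θ - Θ₀‖² = 2 - 2⟨Θ, Θ₀⟩`, so a cap of height `r²/2` lies in the ball of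
  -- radius `r`.
  have hcap : ∀ Θ ∈ dirs n κ₀, 1 - min 1 (r ^ 2 / 2) < inner ℝ Θ Θ₀ →
      |G j Θ - G j Θ₀| < |G j Θ₀| / 2 := by
    intro Θ hΘ hin
    refine hr' hΘ ?_
    rw [dist_eq_norm]
    refine lt_of_pow_lt_pow_left₀ 2 hr.le ?_
    rw [norm_sub_sq_real, hΘ.1, hΘ₀.1]
    have := min_le_right 1 (r ^ 2 / 2)
    linarith
  rcases lt_or_gt_of_ne hj with hlt | hgt
  · refine ⟨j, -1, |G j Θ₀| / 2, min 1 (r ^ 2 / 2), Or.inr rfl, by positivity, by positivity,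
      min_le_left _ _, fun Θ hΘ hin => ?_⟩
    have := abs_lt.1 (hcap Θ hΘ hin)
    rw [abs_of_neg hlt] at this ⊢
    linarith
  · refine ⟨j, 1, |G j Θ₀| / 2, min 1 (r ^ 2 / 2), Or.inl rfl, by positivity, by positivity,
      min_le_left _ _, fun Θ hΘ hin => ?_⟩
    have := abs_lt.1 (hcap Θ hΘ hin)
    rw [abs_of_pos hgt] at this ⊢
    linarith

theorem hasDerivAt_line (h : IsDispersive κ κ₀ C p D G) (X : Rn n) (j : Fin n) (t : ℝ)
    (ht : 0 < size κ₀ (X + t • unitVec j)) :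
    HasDerivAt (fun t : ℝ => p (X + t • unitVec j)) (D j (X + t • unitVec j)) t := by
  have h1 := h.hasDerivAt j (X + t • unitVec j) ht
  have h2 : HasDerivAt (fun u : ℝ => u - t) 1 t := (hasDerivAt_id t).sub_const t
  have h3 := HasDerivAt.scomp (h := fun u : ℝ => u - t)
    (g₁ := fun u : ℝ => p (X + t • unitVec j + u • unitVec j)) t (by simpa using h1) h2
  simp only [one_smul] at h3
  refine h3.congr_of_eventuallyEq (Filter.Eventually.of_forall fun u => ?_)
  simp only [Function.comp]
  congr 1
  module

/-- The truncated inner product with a direction. -/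
def capFun (κ₀ μ : ℝ) (Θ : Ext n) (X : Rn n) : ℝ :=
  max 0 ((size κ₀ X)⁻¹ * inner ℝ (lift κ₀ X) Θ - (1 - μ / 2))

theorem capFun_eq (κ₀ μ : ℝ) (Θ : Ext n) (X : Rn n) :
    capFun κ₀ μ Θ X = max 0 (inner ℝ (dir κ₀ X) Θ - (1 - μ / 2)) := by
  rw [capFun, dir, real_inner_smul_left]

theorem measurable_capFun (κ₀ μ : ℝ) (Θ : Ext n) : Measurable (capFun κ₀ μ Θ) := by
  have h1 : Measurable fun X : Rn n => inner ℝ (lift κ₀ X) Θ :=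
    ((continuous_lift κ₀).inner continuous_const).measurable
  have h2 := (continuous_size (n := n) κ₀).measurable
  unfold capFun
  fun_prop

theorem abs_capFun_sub_le {κ₀ μ : ℝ} {Θ : Ext n} (hΘ : ‖Θ‖ = 1) {X X' : Rn n}
    (h : 0 < size κ₀ X) (h' : 0 < size κ₀ X') :
    |capFun κ₀ μ Θ X' - capFun κ₀ μ Θ X| ≤ 2 * (‖X' - X‖ / size κ₀ X) := by
  rw [capFun_eq, capFun_eq]
  refine (abs_max_sub_max_le_max _ _ _ _).trans ?_
  rw [sub_self, abs_zero, sub_sub_sub_cancel_right, ← inner_sub_left]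
  refine max_le (by positivity) ?_
  calc _ ≤ ‖dir κ₀ X' - dir κ₀ X‖ * ‖Θ‖ := abs_real_inner_le_norm _ _
    _ ≤ _ := by rw [hΘ, mul_one]; exact norm_dir_sub_le h h'

-- Finitely many half-height caps cover the compact set of directions. The truncated inner products
-- with their centres, divided by their sum, form the partition. On the full cap one coordinate
-- derivative has a fixed sign, and the gap between the half cap and the full cap keeps the support
-- of each piece well inside the interval of monotonicity.
set_option maxHeartbeats 1000000 in
theorem exists_isAdapted (h : IsDispersive κ κ₀ C p D G) (hκ : 0 ≤ κ) (hC : 0 ≤ C) {γ : ℝ}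
    (hγ : 0 < γ) (hγ1 : γ ≤ 1) (hγκ : κ = 0 ∨ γ ≤ κ) :
    ∃ (N : ℕ) (j : Fin N → Fin n) (σ : Fin N → ℝ) (χ : Fin N → Rn n → ℝ) (c C' δ : ℝ),
      0 < c ∧ 0 ≤ C' ∧ 0 < δ ∧ δ ≤ 1 / 4 ∧ IsAdapted κ κ₀ c C' δ γ p j σ χ := by
  choose! j₀ σ₀ c₀ μ₀ hσ₀ hc₀ hμ₀ hμ₀1 hcap using fun Θ₀ (hΘ₀ : Θ₀ ∈ dirs n κ₀) =>
    h.exists_cap hΘ₀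
  obtain ⟨T, hTsub, hT⟩ := (isCompact_dirs (n := n) κ₀).elim_nhds_subcover
    (fun Θ₀ => {Θ | 1 - μ₀ Θ₀ / 2 < inner ℝ Θ Θ₀}) (fun Θ₀ hΘ₀ => by
      refine (isOpen_lt continuous_const (continuous_id.inner continuous_const)).mem_nhds ?_
      simp only [Set.mem_ofPred_eq, id, real_inner_self_eq_norm_sq, hΘ₀.1]
      linarith [hμ₀ Θ₀ hΘ₀])
  set e := T.equivFin.symm with he
  set N := T.card with hN
  set Θ : Fin N → Ext n := fun i => (e i : Ext n) with hΘdef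
  have hΘ : ∀ i, Θ i ∈ dirs n κ₀ := fun i => hTsub _ (e i).2
  have hΘ1 : ∀ i, ‖Θ i‖ = 1 := fun i => (hΘ i).1
  -- The normalising sum, as a function of direction: positive on a compact set, hence bounded below
  -- by some `w₀ > 0`, which makes the quotients Lipschitz.
  set W : Ext n → ℝ := fun Z => ∑ i, max 0 (inner ℝ Z (Θ i) - (1 - μ₀ (Θ i) / 2)) with hW
  have hWc : Continuous W := by
    refine continuous_finsetSum _ fun i _ => ?_
    exact continuous_const.max ((continuous_id.inner continuous_const).sub continuous_const)
  have hWpos : ∀ Z ∈ dirs n κ₀, 0 < W Z := by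
    intro Z hZ
    have := hT hZ
    simp only [Set.mem_iUnion, Set.mem_ofPred_eq] at this
    obtain ⟨Θ₀, hΘ₀, hlt⟩ := this
    refine Finset.sum_pos' (fun i _ => le_max_left _ _) ⟨e.symm ⟨Θ₀, hΘ₀⟩, Finset.mem_univ _, ?_⟩
    refine lt_max_of_lt_right ?_
    simp only [hΘdef, Equiv.apply_symm_apply]
    linarith
  obtain ⟨w₀, hw₀, hWle⟩ : ∃ w₀ > 0, ∀ Z ∈ dirs n κ₀, w₀ ≤ W Z :=
    (isCompact_dirs κ₀).exists_forall_le' hWc.continuousOn hWpos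
  -- the constants
  obtain ⟨c, hc, hcle⟩ : ∃ c > 0, ∀ i : Fin N, c ≤ c₀ (Θ i) := by
    rcases isEmpty_or_nonempty (Fin N) with hE | hE
    · exact ⟨1, one_pos, fun i => hE.elim i⟩
    · obtain ⟨i, hi⟩ := Finite.exists_min fun i : Fin N => c₀ (Θ i)
      exact ⟨c₀ (Θ i), hc₀ _ (hΘ i), hi⟩
  obtain ⟨μ, hμ, hμle⟩ : ∃ μ > 0, ∀ i : Fin N, μ ≤ μ₀ (Θ i) := by
    rcases isEmpty_or_nonempty (Fin N) with hE | hE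
    · exact ⟨1, one_pos, fun i => hE.elim i⟩
    · obtain ⟨i, hi⟩ := Finite.exists_min fun i : Fin N => μ₀ (Θ i)
      exact ⟨μ₀ (Θ i), hμ₀ _ (hΘ i), hi⟩
  set wt : Fin N → Rn n → ℝ := fun i => capFun κ₀ (μ₀ (Θ i)) (Θ i) with hwt
  set S : Rn n → ℝ := fun X => ∑ i, wt i X with hS
  have hSW : ∀ X, S X = W (dir κ₀ X) := fun X => by simp only [hS, hW, hwt, capFun_eq]
  have hS0 : ∀ X, 0 < size κ₀ X → w₀ ≤ S X := fun X hX => by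
    rw [hSW]; exact hWle _ (dir_mem h.nonneg hX)
  have hwt0 : ∀ i X, 0 ≤ wt i X := fun i X => le_max_left _ _
  have hwtS : ∀ i X, wt i X ≤ S X := fun i X =>
    Finset.single_le_sum (fun i _ => hwt0 i X) (Finset.mem_univ i)
  set χ : Fin N → Rn n → ℝ := fun i X => wt i X / S X with hχ
  have hSnn : ∀ X, 0 ≤ S X := fun X => Finset.sum_nonneg fun i _ => hwt0 i X
  have hχ0 : ∀ i X, 0 ≤ χ i X := fun i X => div_nonneg (hwt0 i X) (hSnn X)
  have hχ1 : ∀ i X, χ i X ≤ 1 := fun i X => div_le_one_of_le₀ (hwtS i X) (hSnn X)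
  have hχlip : ∀ i X X', 0 < size κ₀ X → 0 < size κ₀ X' →
      |χ i X' - χ i X| ≤ 2 * (1 + N) / w₀ * (‖X' - X‖ / size κ₀ X) := by
    intro i X X' hX hX'
    set d := ‖X' - X‖ / size κ₀ X with hd
    have hd0 : 0 ≤ d := by positivity
    have h1 : |wt i X' - wt i X| ≤ 2 * d := abs_capFun_sub_le (hΘ1 i) hX hX'
    have h2 : |S X - S X'| ≤ N * (2 * d) := by
      rw [abs_sub_comm]
      simp only [hS, ← Finset.sum_sub_distrib]
      refine (Finset.abs_sum_le_sum_abs _ _).trans ?_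
      refine (Finset.sum_le_sum fun i _ => abs_capFun_sub_le (hΘ1 i) hX hX').trans ?_
      simp [hd]
    have hSX := hS0 X hX
    have hSX' := hS0 X' hX'
    have hSp : 0 < S X := by linarith
    have hSp' : 0 < S X' := by linarith
    have e1 : χ i X' - χ i X = (wt i X' - wt i X) / S X + χ i X' * ((S X - S X') / S X) := by
      simp only [hχ]
      field_simp
      ring
    rw [e1]
    refine (abs_add_le _ _).trans ?_
    rw [abs_mul, abs_div (wt i X' - wt i X), abs_div (S X - S X'), abs_of_pos hSp, abs_of_nonneg (hχ0 i X')]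
    calc _ ≤ 2 * d / w₀ + 1 * (N * (2 * d) / w₀) := by
          gcongr
          exact hχ1 i X'
      _ = _ := by ring
  set Cχ := 2 * (1 + (N : ℝ)) / w₀ with hCχ
  have hCχ0 : 0 ≤ Cχ := by positivity
  -- The terms account for the derivative of the symbol, for the variation of `χ` against `‖X‖^κ ≤
  -- (5/4)^κ size^κ`, and for the variation of `‖X‖^κ` itself.
  set C' := C + Cχ * (5 / 4) ^ κ + (κ * 2 ^ κ + 1) with hC'
  -- A displacement of at most `δ * size` changes the direction by at most `2 * (μ / 4) = μ / 2`,
  -- which fits in the gap between the half cap and the full cap.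
  set δ := min (1 / 4) (μ / 4) with hδ
  have hCC' : C ≤ C' := by
    rw [hC']
    have : 0 ≤ Cχ * (5 / 4) ^ κ + (κ * 2 ^ κ + 1) := by positivity
    linarith
  refine ⟨N, fun i => j₀ (Θ i) (hΘ i), fun i => σ₀ (Θ i), χ, c, C', δ, hc, hC.trans hCC', by positivity,
    min_le_left _ _, ?_, hχ0, hχ1, fun i => hσ₀ _ (hΘ i), ?_, ?_⟩
  · intro i
    exact (measurable_capFun _ _ _).div
      (Finset.measurable_sum _ fun i _ => measurable_capFun _ _ _)
  · intro X hX
    have h1 : S X ≠ 0 := by linarith [hS0 X hX]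
    simp only [hχ, ← Finset.sum_div]
    exact div_self h1
  intro i X hX
  set v := unitVec (j₀ (Θ i) (hΘ i)) with hv
  set σ := σ₀ (Θ i) with hσ
  have hσabs : |σ| = 1 := by
    rcases hσ₀ _ (hΘ i) with h1 | h1 <;> simp [hσ, h1]
  have hμi := hμ₀ _ (hΘ i)
  have hμi1 := hμ₀1 _ (hΘ i)
  have hsub : ∀ t t' : ℝ, ‖(X + t • v) - (X + t' • v)‖ = |t - t'| :=
    fun t t' => norm_add_smul_sub X _ t t'
  have hamp : ∀ t : ℝ, |χ i (X + t • v) * ‖X + t • v‖ ^ κ| ≤ size κ₀ (X + t • v) ^ κ := by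
    intro t
    rw [abs_mul, abs_of_nonneg (hχ0 _ _), abs_of_nonneg (by positivity)]
    calc _ ≤ 1 * size κ₀ (X + t • v) ^ κ := by
          gcongr
          · exact hχ1 _ _
          · exact norm_le_size _ _
      _ = _ := one_mul _
  refine ⟨fun t => σ * D (j₀ (Θ i) (hΘ i)) (X + t • v),
    -- The points whose direction lies in the full cap, written without division so that convexity
    -- is visible.
    {t | (1 - μ₀ (Θ i)) * size κ₀ (X + t • v) < inner ℝ (lift κ₀ (X + t • v)) (Θ i)},
    hX, fun t t' => ?_, ordConnected_cap _ _ _ _ (by linarith), fun t _ => ?_, fun t ht => ?_,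
    fun t₀ _ t _ ht => ?_, hamp, fun t ht t' ht' => ?_, fun t₀ t ht => ?_, ?_, ?_⟩
  · rw [← hsub t t']
    exact abs_size_sub_le κ₀ _ _
  · exact (h.hasDerivAt_line X _ t (hX t)).const_mul σ
  · rw [h.eq_angular _ _ (hX t)]
    have h1 : c ≤ σ * G (j₀ (Θ i) (hΘ i)) (dir κ₀ (X + t • v)) := by
      refine (hcle i).trans (hcap _ (hΘ i) _ (dir_mem h.nonneg (hX t)) ?_)
      rw [dir, real_inner_smul_left, ← div_eq_inv_mul, lt_div_iff₀ (hX t)]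
      exact ht
    calc _ ≤ σ * G (j₀ (Θ i) (hΘ i)) (dir κ₀ (X + t • v)) * size κ₀ (X + t • v) ^ κ :=
          mul_le_mul_of_nonneg_right h1 (Real.rpow_nonneg (hX t).le _)
      _ = _ := by ring
  · have h1 := h.deriv_lipschitz (j₀ (Θ i) (hΘ i)) (X + t₀ • v) (hX t₀) (t - t₀) ht
    have h2 : X + t₀ • v + (t - t₀) • v = X + t • v := by module
    rw [h2] at h1
    rw [← mul_sub, abs_mul, hσabs, one_mul]
    refine h1.trans ?_
    have := Real.rpow_nonneg (hX t₀).le (κ - 1)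
    gcongr
  · have h1 : 0 < wt i (X + t • v) := by
      refine lt_of_le_of_ne (hwt0 _ _) fun h0 => ht ?_
      simp [hχ, ← h0]
    have h2 : 1 - μ₀ (Θ i) / 2 < inner ℝ (dir κ₀ (X + t • v)) (Θ i) := by
      simp only [hwt, capFun_eq] at h1
      rcases lt_max_iff.1 h1 with h3 | h3
      · exact absurd h3 (lt_irrefl _)
      · linarith
    have h3 : |t' - t| ≤ δ * size κ₀ (X + t • v) := by
      rw [abs_le]; constructor <;> linarith [ht'.1, ht'.2]
    have h4 := norm_dir_sub_le (hX t) (hX t')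
    rw [hsub] at h4
    have h5 : |t' - t| / size κ₀ (X + t • v) ≤ μ / 4 := by
      rw [div_le_iff₀ (hX t)]
      exact h3.trans (mul_le_mul_of_nonneg_right (min_le_right _ _) (hX t).le)
    have h6 := abs_real_inner_le_norm (dir κ₀ (X + t' • v) - dir κ₀ (X + t • v)) (Θ i)
    rw [hΘ1, mul_one, inner_sub_left] at h6
    have h7 := (abs_le.1 (h6.trans h4)).1
    have h8 := hμle i
    rw [Set.mem_ofPred_eq, ← lt_div_iff₀ (hX t'), div_eq_inv_mul, ← real_inner_smul_left]
    change _ < inner ℝ (dir κ₀ (X + t' • v)) (Θ i)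
    linarith
  · set s := size κ₀ (X + t₀ • v) with hs
    have hs0 : 0 < s := hX t₀
    have hu : |t - t₀| / s ≤ 1 / 4 := by rw [div_le_iff₀ hs0]; linarith
    have hu0 : 0 ≤ |t - t₀| / s := by positivity
    have hsz : size κ₀ (X + t • v) ≤ 5 / 4 * s := by
      have := (abs_le.1 (abs_size_sub_le κ₀ (X + t • v) (X + t₀ • v))).2
      rw [hsub] at this
      linarith
    have hχd := hχlip i _ _ (hX t₀) (hX t)
    rw [hsub] at hχd
    have hγu : |t - t₀| / s ≤ (|t - t₀| / s) ^ γ := by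
      have := Real.rpow_le_rpow_of_exponent_ge_of_imp hu0 (by linarith) hγ1
        (fun _ h => absurd h one_ne_zero)
      simpa using this
    have hnt : ‖X + t • v‖ ≤ 5 / 4 * s := (norm_le_size κ₀ _).trans hsz
    have hnt₀ : ‖X + t₀ • v‖ ≤ s := norm_le_size κ₀ _
    have hpow := abs_rpow_sub_rpow_le hκ hγ hγ1 hγκ (u := ‖X + t • v‖ / s) (v := ‖X + t₀ • v‖ / s)
      (by positivity) (by positivity) (by rw [div_le_iff₀ hs0]; linarith)
      (by rw [div_le_iff₀ hs0]; linarith) (by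
        rw [← sub_div, abs_div, abs_of_pos hs0]
        have := abs_norm_sub_norm_le (X + t • v) (X + t₀ • v)
        rw [hsub] at this
        calc _ ≤ |t - t₀| / s := by gcongr
          _ ≤ 1 := by linarith)
    have hdist : |‖X + t • v‖ / s - ‖X + t₀ • v‖ / s| ≤ |t - t₀| / s := by
      rw [← sub_div, abs_div, abs_of_pos hs0]
      have := abs_norm_sub_norm_le (X + t • v) (X + t₀ • v)
      rw [hsub] at this
      gcongr
    have hpow' : |‖X + t • v‖ ^ κ - ‖X + t₀ • v‖ ^ κ|
        ≤ (κ * 2 ^ κ + 1) * s ^ κ * (|t - t₀| / s) ^ γ := by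
      rw [Real.div_rpow (norm_nonneg _) hs0.le, Real.div_rpow (norm_nonneg _) hs0.le, ← sub_div,
        abs_div, abs_of_pos (Real.rpow_pos_of_pos hs0 κ),
        div_le_iff₀ (Real.rpow_pos_of_pos hs0 κ)] at hpow
      refine hpow.trans ?_
      have : |‖X + t • v‖ / s - ‖X + t₀ • v‖ / s| ^ γ ≤ (|t - t₀| / s) ^ γ :=
        Real.rpow_le_rpow (abs_nonneg _) hdist hγ.le
      calc _ ≤ (κ * 2 ^ κ + 1) * (|t - t₀| / s) ^ γ * s ^ κ := by gcongr
        _ = _ := by ring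
    have e1 : χ i (X + t • v) * ‖X + t • v‖ ^ κ - χ i (X + t₀ • v) * ‖X + t₀ • v‖ ^ κ
        = (χ i (X + t • v) - χ i (X + t₀ • v)) * ‖X + t • v‖ ^ κ
          + χ i (X + t₀ • v) * (‖X + t • v‖ ^ κ - ‖X + t₀ • v‖ ^ κ) := by ring
    rw [e1]
    refine (abs_add_le _ _).trans ?_
    rw [abs_mul, abs_mul, abs_of_nonneg (hχ0 _ _), abs_of_nonneg (by positivity :
      0 ≤ ‖X + t • v‖ ^ κ)]
    have hnt' : ‖X + t • v‖ ^ κ ≤ (5 / 4) ^ κ * s ^ κ := by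
      rw [← Real.mul_rpow (by norm_num) hs0.le]
      exact Real.rpow_le_rpow (norm_nonneg _) hnt hκ
    have hsκ : 0 ≤ s ^ κ * (|t - t₀| / s) ^ γ := by positivity
    calc _ ≤ (Cχ * (|t - t₀| / s) ^ γ) * ((5 / 4) ^ κ * s ^ κ)
          + 1 * ((κ * 2 ^ κ + 1) * s ^ κ * (|t - t₀| / s) ^ γ) := by
          gcongr
          · exact hχd.trans (by gcongr)
          · exact hχ1 _ _
      _ = (Cχ * (5 / 4) ^ κ + (κ * 2 ^ κ + 1)) * (s ^ κ * (|t - t₀| / s) ^ γ) := by ring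
      _ ≤ C' * (s ^ κ * (|t - t₀| / s) ^ γ) := by
          gcongr
          rw [hC']; linarith
      _ = _ := by ring
  · have h1 : Measurable fun t : ℝ => X + t • v := by fun_prop
    exact (h.measurable.comp h1).const_mul σ
  · have h1 : Measurable fun t : ℝ => X + t • v := by fun_prop
    have h2 : Measurable (χ i) := (measurable_capFun _ _ _).div
      (Finset.measurable_sum _ fun i _ => measurable_capFun _ _ _)
    exact (h2.comp h1).mul (h1.norm.pow_const κ)

end IsDispersive

end Partition

/-! ### Homogeneous symbols, condition (H), and rescaling -/

section Symbols

variable {n : ℕ}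

/-- The exponent may have either sign; adding the two possible constants avoids a case distinction
later. -/
theorem rpow_le_of_comparable (e : ℝ) {P Q : ℝ} (hP : 0 < P) (h1 : P / 2 ≤ Q) (h2 : Q ≤ 2 * P) :
    Q ^ e ≤ (2 ^ e + (1 / 2) ^ e) * P ^ e := by
  have hQ : 0 < Q := by linarith
  have a1 : (0 : ℝ) < 2 ^ e := by positivity
  have a2 : (0 : ℝ) < (1 / 2) ^ e := by positivity
  have a3 : 0 < P ^ e := by positivity
  rw [add_mul]
  rcases le_total 0 e with he | he
  · have := Real.rpow_le_rpow hQ.le h2 he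
    rw [Real.mul_rpow (by norm_num) hP.le] at this
    nlinarith [mul_pos a2 a3]
  · have := Real.rpow_le_rpow_of_nonpos (by positivity) h1 he
    rw [div_eq_inv_mul, ← one_div, Real.mul_rpow (by norm_num) hP.le] at this
    nlinarith [mul_pos a1 a3]

/-- On the segment the size changes by at most a quarter, so it remains positive and comparable to
its value at `X`, and the mean value inequality applies with one constant. -/
theorem deriv_lipschitz_of_bound {κ κ₀ C : ℝ} (hC : 0 ≤ C) {D D₂ : Rn n → ℝ} (j : Fin n)
    (hD : ∀ X, 0 < size κ₀ X → HasDerivAt (fun t : ℝ => D (X + t • unitVec j)) (D₂ X) 0)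
    (hD₂ : ∀ X, 0 < size κ₀ X → |D₂ X| ≤ C * size κ₀ X ^ (κ - 1)) (X : Rn n)
    (hX : 0 < size κ₀ X) (t : ℝ) (ht : |t| ≤ size κ₀ X / 4) :
    |D (X + t • unitVec j) - D X| ≤
      C * (2 ^ (κ - 1) + (1 / 2) ^ (κ - 1)) * size κ₀ X ^ (κ - 1) * |t| := by
  have hs : ∀ u ∈ Set.uIcc 0 t, |size κ₀ (X + u • unitVec j) - size κ₀ X| ≤ size κ₀ X / 4 := by
    intro u hu
    refine (abs_size_sub_le _ _ _).trans ?_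
    rw [add_sub_cancel_left, norm_smul, norm_unitVec, mul_one, Real.norm_eq_abs]
    have h0 := Set.abs_sub_left_of_mem_uIcc hu
    simp only [sub_zero] at h0
    exact h0.trans ht
  have hd : ∀ u ∈ Set.uIcc 0 t, HasDerivWithinAt (fun t : ℝ => D (X + t • unitVec j))
      (D₂ (X + u • unitVec j)) (Set.uIcc 0 t) u := by
    intro u hu
    have hp : 0 < size κ₀ (X + u • unitVec j) := by linarith [(abs_le.1 (hs u hu)).1]
    have h1 := hD _ hp
    have h2 : HasDerivAt (fun w : ℝ => w - u) 1 u := (hasDerivAt_id u).sub_const u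
    have h3 := HasDerivAt.scomp (h := fun w : ℝ => w - u)
      (g₁ := fun w : ℝ => D (X + u • unitVec j + w • unitVec j)) u (by simpa using h1) h2
    simp only [one_smul] at h3
    refine (h3.congr_of_eventuallyEq (Filter.Eventually.of_forall fun w => ?_)).hasDerivWithinAt
    simp only [Function.comp]
    congr 1
    module
  have := Convex.norm_image_sub_le_of_norm_hasDerivWithin_le hd
    (C := C * (2 ^ (κ - 1) + (1 / 2) ^ (κ - 1)) * size κ₀ X ^ (κ - 1)) (fun u hu => by
      have h1 := abs_le.1 (hs u hu)
      rw [Real.norm_eq_abs]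
      refine (hD₂ _ (by linarith)).trans ?_
      rw [mul_assoc]
      gcongr
      exact rpow_le_of_comparable _ hX (by linarith) (by linarith))
    (convex_uIcc 0 t) Set.left_mem_uIcc Set.right_mem_uIcc
  simpa using this

theorem hasDerivAt_line_of_differentiableAt {f : Rn n → ℝ} {X : Rn n} (hf : DifferentiableAt ℝ f X)
    (v : Rn n) : HasDerivAt (fun t : ℝ => f (X + t • v)) (fderiv ℝ f X v) 0 := by
  have h1 : HasDerivAt (fun t : ℝ => X + t • v) v 0 := by
    simpa using ((hasDerivAt_id (0 : ℝ)).smul_const v).const_add X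
  exact HasFDerivAt.comp_hasDerivAt (f := fun t : ℝ => X + t • v) (0 : ℝ)
    (by simpa using hf.hasFDerivAt) h1

theorem exists_fderiv_unitVec_ne {f : Rn n → ℝ} {X : Rn n} (h : ∇ f X ≠ 0) :
    ∃ j : Fin n, fderiv ℝ f X (unitVec j) ≠ 0 := by
  by_contra! hcon
  refine h ?_
  have h0 : fderiv ℝ f X = 0 := by
    refine ContinuousLinearMap.coe_injective
      ((EuclideanSpace.basisFun (Fin n) ℝ).toBasis.ext fun j => ?_)
    simpa using hcon j
  rw [gradient, h0, map_zero]

namespace IsPrincipalSymbol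

variable {μ : ℝ} {f : Rn n → ℝ}

theorem contDiffAt (h : IsPrincipalSymbol μ f) {X : Rn n} (hX : X ≠ 0) : ContDiffAt ℝ ∞ f X :=
  h.smooth.contDiffAt (isOpen_compl_singleton.mem_nhds hX)

theorem differentiableAt (h : IsPrincipalSymbol μ f) {X : Rn n} (hX : X ≠ 0) :
    DifferentiableAt ℝ f X := (h.contDiffAt hX).differentiableAt (by simp)

/-- Differentiate `f (c • X) = c ^ μ * f X` in `X` and cancel one factor `c`. Applied twice, this
gives the homogeneity of second derivatives. -/
theorem fderiv_apply (h : IsPrincipalSymbol μ f) (v : Rn n) :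
    IsPrincipalSymbol (μ - 1) (fun X => fderiv ℝ f X v) where
  smooth := by
    have := h.smooth.fderiv_of_isOpen isOpen_compl_singleton (m := ∞) (by simp)
    exact this.clm_apply contDiffOn_const
  homogeneous c hc X hX := by
    have hcX : c • X ≠ 0 := smul_ne_zero hc.ne' hX
    have h1 : HasFDerivAt (fun Y => f (c • Y)) ((fderiv ℝ f (c • X)).comp
        (c • ContinuousLinearMap.id ℝ (Rn n))) X :=
      (h.differentiableAt hcX).hasFDerivAt.comp X ((hasFDerivAt_id X).const_smul c)
    have h2 : HasFDerivAt (fun Y => f (c • Y)) (c ^ μ • fderiv ℝ f X) X := by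
      refine ((h.differentiableAt hX).hasFDerivAt.const_mul (c ^ μ)).congr_of_eventuallyEq ?_
      filter_upwards [isOpen_compl_singleton.mem_nhds hX] with Y hY
      exact h.homogeneous c hc Y hY
    have h3 := congrArg (fun L : Rn n →L[ℝ] ℝ => L v) (h1.unique h2)
    simp only [ContinuousLinearMap.comp_apply, _root_.smul_apply,
      ContinuousLinearMap.id_apply, map_smul, smul_eq_mul] at h3
    rw [Real.rpow_sub hc, Real.rpow_one]
    field_simp
    linarith

theorem continuousAt (h : IsPrincipalSymbol μ f) {X : Rn n} (hX : X ≠ 0) : ContinuousAt f X :=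
  (h.differentiableAt hX).continuousAt

/-- Homogeneity reduces the bound to the unit sphere, which is compact. -/
theorem exists_bound (h : IsPrincipalSymbol μ f) :
    ∃ C, 0 ≤ C ∧ ∀ X, X ≠ 0 → |f X| ≤ C * ‖X‖ ^ μ := by
  obtain ⟨C, hC⟩ := (isCompact_sphere (0 : Rn n) 1).exists_bound_of_continuousOn (f := f)
    (fun X hX => (h.continuousAt (by
      rintro rfl; simp at hX)).continuousWithinAt)
  refine ⟨max C 0, le_max_right _ _, fun X hX => ?_⟩
  have hn : 0 < ‖X‖ := norm_pos_iff.2 hX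
  have h1 := h.homogeneous ‖X‖ hn (‖X‖⁻¹ • X) (smul_ne_zero (inv_ne_zero hn.ne') hX)
  rw [smul_smul, mul_inv_cancel₀ hn.ne', one_smul] at h1
  have h2 := hC (‖X‖⁻¹ • X) (by
    rw [mem_sphere_zero_iff_norm, norm_smul, norm_inv, norm_norm, inv_mul_cancel₀ hn.ne'])
  rw [h1, abs_mul, abs_of_nonneg (by positivity), mul_comm]
  gcongr
  exact h2.trans (le_max_left _ _)

theorem measurable (h : IsPrincipalSymbol μ f) {a : Rn n → ℝ} (ha : ∀ ξ, ξ ≠ 0 → a ξ = f ξ) :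
    Measurable a := by
  refine measurable_of_continuousOn_compl_singleton 0 fun X hX => ?_
  refine ContinuousWithinAt.congr (h.continuousAt hX).continuousWithinAt (fun Y hY => ha Y hY)
    (ha X hX)

end IsPrincipalSymbol

theorem dirs_zero_snd_ne {Θ : Ext n} (h : ‖Θ‖ = 1) (h0 : Θ.fst = 0) : Θ.snd ≠ 0 := by
  intro h1
  have := WithLp.prod_norm_sq_eq_of_L2 Θ
  rw [h0, h1, h] at this
  simp at this

theorem dir_fst (κ₀ : ℝ) (X : Rn n) : (dir κ₀ X).fst = (size κ₀ X)⁻¹ * κ₀ := rfl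

theorem dir_snd (κ₀ : ℝ) (X : Rn n) : (dir κ₀ X).snd = (size κ₀ X)⁻¹ • X := rfl

/-- With `κ₀ = 0` the size is `‖X‖`, and homogeneity of degree `m - 1` expresses each partial
derivative exactly by its values on the unit sphere. Its second derivatives are homogeneous of
degree `m - 2`. -/
theorem DispersiveH.exists_isDispersive {m : ℝ} {a am : Rn n → ℝ} (ham : IsPrincipalSymbol m am)
    (ha : DispersiveH a am) : ∃ C D G, 0 ≤ C ∧ IsDispersive (m - 1) 0 C a D G := by
  have hD := fun j : Fin n => ham.fderiv_apply (unitVec j)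
  have hD₂ := fun j : Fin n => (hD j).fderiv_apply (unitVec j)
  choose C hC0 hC using fun j => (hD₂ j).exists_bound
  have hCs : ∀ j, C j ≤ ∑ i, C i := fun j =>
    Finset.single_le_sum (fun i _ => hC0 i) (Finset.mem_univ j)
  have hCs0 : 0 ≤ ∑ i, C i := Finset.sum_nonneg fun i _ => hC0 i
  have hne : ∀ {X : Rn n}, 0 < size 0 X → X ≠ 0 := fun {X} h => by
    rw [size_zero] at h; exact norm_pos_iff.1 h
  refine ⟨(∑ i, C i) * (2 ^ (m - 1 - 1) + (1 / 2) ^ (m - 1 - 1)),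
    fun j X => fderiv ℝ am X (unitVec j),
    fun j Θ => fderiv ℝ am Θ.snd (unitVec j), by positivity, le_rfl, ham.measurable ha.eq_principal,
    fun j X hX => ?_, fun j X hX => ?_, fun j Θ hΘ => ?_, fun Θ hΘ => ?_, fun j => ?_⟩
  · refine (hasDerivAt_line_of_differentiableAt (ham.differentiableAt (hne hX))
      (unitVec j)).congr_of_eventuallyEq ?_
    have h1 : ContinuousAt (fun t : ℝ => X + t • unitVec j) 0 := by fun_prop
    have h2 := h1.eventually (isOpen_compl_singleton.mem_nhds (by simpa using hne hX) :
      ({0}ᶜ : Set (Rn n)) ∈ nhds (X + (0 : ℝ) • unitVec j))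
    filter_upwards [h2] with t ht
    exact ha.eq_principal _ ht
  · have hn : 0 < ‖X‖ := norm_pos_iff.2 (hne hX)
    have h1 := (hD j).homogeneous ‖X‖ hn (‖X‖⁻¹ • X)
      (smul_ne_zero (inv_ne_zero hn.ne') (hne hX))
    rw [smul_smul, mul_inv_cancel₀ hn.ne', one_smul] at h1
    simp only [dir_snd, size_zero]
    exact h1
  · have h1 := (hD j).continuousAt (dirs_zero_snd_ne hΘ.1 (hΘ.2.2 rfl))
    have h2 : ContinuousAt (fun Θ : Ext n => Θ.snd) Θ := by fun_prop
    exact (ContinuousAt.comp (g := fun X => fderiv ℝ am X (unitVec j)) h1 h2).continuousWithinAt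
  · exact exists_fderiv_unitVec_ne (ha.gradient_principal_ne _ (dirs_zero_snd_ne hΘ.1 (hΘ.2.2 rfl)))
  · refine deriv_lipschitz_of_bound (κ := m - 1) (κ₀ := 0) hCs0
      (D := fun X => fderiv ℝ am X (unitVec j)) j (D₂ := fun X =>
      fderiv ℝ (fun X => fderiv ℝ am X (unitVec j)) X (unitVec j)) (fun X hX => ?_) fun X hX => ?_
    · exact hasDerivAt_line_of_differentiableAt ((hD j).differentiableAt (hne hX)) _
    · rw [size_zero]
      refine (hC j X (hne hX)).trans ?_
      gcongr
      exact hCs j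

theorem size_smul {κ₀ r : ℝ} (hr : 0 < r) (X : Rn n) :
    size κ₀ (r • X) = r * size (κ₀ / r) X := by
  refine (sq_eq_sq₀ (size_nonneg _ _) (mul_nonneg hr.le (size_nonneg _ _))).1 ?_
  rw [mul_pow, size_sq, size_sq, norm_smul, Real.norm_eq_abs, abs_of_pos hr]
  field_simp

theorem dir_smul {κ₀ r : ℝ} (hr : 0 < r) (X : Rn n) : dir κ₀ (r • X) = dir (κ₀ / r) X := by
  have h : lift κ₀ (r • X) = r • lift (κ₀ / r) X := by
    change WithLp.toLp 2 (κ₀, r • X) = WithLp.toLp 2 (r • (κ₀ / r, X))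
    rw [Prod.smul_mk, smul_eq_mul, mul_div_cancel₀ _ hr.ne']
  rw [dir, dir, h, size_smul hr, smul_smul, mul_inv]
  congr 1
  field_simp

theorem dirs_div {κ₀ r : ℝ} (hr : 0 < r) : dirs n (κ₀ / r) = dirs n κ₀ := by
  simp [dirs, hr.ne']

/-- Needed with `r = 2π`, to pass to the normalisation of `𝓕`. The lift parameter becomes `κ₀ / r`,
which is zero only if `κ₀` is, so the set of directions does not change. -/
theorem IsDispersive.comp_smul {κ κ₀ C : ℝ} {p : Rn n → ℝ} {D : Fin n → Rn n → ℝ}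
    {G : Fin n → Ext n → ℝ} (h : IsDispersive κ κ₀ C p D G) {r : ℝ} (hr : 0 < r) :
    IsDispersive κ (κ₀ / r) (C * r ^ (κ - 1) * r * r) (fun ξ => p (r • ξ))
      (fun j ξ => r * D j (r • ξ)) (fun j Θ => r * r ^ κ * G j Θ) := by
  have hpos : ∀ {X : Rn n}, 0 < size (κ₀ / r) X → 0 < size κ₀ (r • X) := fun {X} hX => by
    rw [size_smul hr]; positivity
  refine ⟨by have := h.nonneg; positivity, h.measurable.comp (by fun_prop), fun j X hX => ?_,
    fun j X hX => ?_, fun j => ?_, fun Θ hΘ => ?_, fun j X hX t ht => ?_⟩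
  · have h1 := h.hasDerivAt j _ (hpos hX)
    have h2 : HasDerivAt (fun t : ℝ => r * t) r 0 := by
      simpa using (hasDerivAt_id (0 : ℝ)).const_mul r
    have h3 := HasDerivAt.scomp (h := fun t : ℝ => r * t)
      (g₁ := fun w : ℝ => p (r • X + w • unitVec j)) (0 : ℝ) (by simpa using h1) h2
    refine h3.congr_of_eventuallyEq (Filter.Eventually.of_forall fun u => ?_)
    simp only [Function.comp, smul_add, smul_smul]
  · rw [h.eq_angular j _ (hpos hX), size_smul hr, dir_smul hr, Real.mul_rpow hr.le hX.le]
    ring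
  · rw [dirs_div hr]
    exact (h.continuousOn j).const_mul _ 
  · rw [dirs_div hr] at hΘ
    obtain ⟨j, hj⟩ := h.exists_ne Θ hΘ
    exact ⟨j, mul_ne_zero (by positivity) hj⟩
  · have h1 := h.deriv_lipschitz j _ (hpos hX) (r * t) (by
      rw [size_smul hr, abs_mul, abs_of_pos hr, mul_div_assoc]
      gcongr)
    rw [size_smul hr, Real.mul_rpow hr.le hX.le, abs_mul, abs_of_pos hr] at h1
    rw [← mul_sub, abs_mul, abs_of_pos hr, smul_add, smul_smul]
    calc _ ≤ r * _ := mul_le_mul_of_nonneg_left h1 hr.le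
      _ = _ := by ring

end Symbols

/-! ### Condition (L): the symbol up to infinity -/

section SymbolL

variable {n : ℕ} {m : ℝ} {a am : Rn n → ℝ}

namespace DispersiveL

theorem contDiffAt_sub (ham : IsPrincipalSymbol m am) (ha : DispersiveL m a am) {X : Rn n}
    (hX : X ≠ 0) : ContDiffAt ℝ ∞ (fun Y => a Y - am Y) X :=
  ha.smooth.contDiffAt.sub (ham.contDiffAt hX)

theorem fderiv_sub_apply (ham : IsPrincipalSymbol m am) (ha : DispersiveL m a am) {X : Rn n}
    (hX : X ≠ 0) (v : Rn n) :
    fderiv ℝ (fun Y => a Y - am Y) X v = fderiv ℝ a X v - fderiv ℝ am X v := by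
  have h1 : DifferentiableAt ℝ a X := ha.smooth.contDiffAt.differentiableAt (by simp)
  rw [fderiv_fun_sub h1 (ham.differentiableAt hX)]
  rfl

theorem exists_deriv_bound (ham : IsPrincipalSymbol m am) (ha : DispersiveL m a am) (j : Fin n) :
    ∃ C, 0 ≤ C ∧ ∀ X, 1 ≤ ‖X‖ →
      |fderiv ℝ a X (unitVec j) - fderiv ℝ am X (unitVec j)| ≤ C * ‖X‖ ^ (m - 1 - 1) := by
  obtain ⟨C, hC⟩ := ha.lower_order 1 (fun _ => j)
  refine ⟨max C 0, le_max_right _ _, fun X hX => ?_⟩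
  have hX0 : X ≠ 0 := by rintro rfl; simp at hX; linarith
  have h1 := hC X hX
  rw [partialDeriv, iteratedFDeriv_one_apply, fderiv_sub_apply ham ha hX0, Nat.cast_one] at h1
  refine h1.trans ?_
  gcongr
  exact le_max_left _ _

theorem exists_deriv₂_bound (ham : IsPrincipalSymbol m am) (ha : DispersiveL m a am) (j : Fin n) :
    ∃ C, 0 ≤ C ∧ ∀ X, 1 ≤ ‖X‖ →
      |fderiv ℝ (fun Y => fderiv ℝ a Y (unitVec j)) X (unitVec j) -
        fderiv ℝ (fun Y => fderiv ℝ am Y (unitVec j)) X (unitVec j)| ≤ C * ‖X‖ ^ (m - 1 - 2) := by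
  obtain ⟨C, hC⟩ := ha.lower_order 2 (fun _ => j)
  refine ⟨max C 0, le_max_right _ _, fun X hX => ?_⟩
  have hX0 : X ≠ 0 := by rintro rfl; simp at hX; linarith
  have h1 := hC X hX
  rw [partialDeriv, iteratedFDeriv_two_apply] at h1
  have hd : DifferentiableAt ℝ (fderiv ℝ (fun Y => a Y - am Y)) X :=
    ((contDiffAt_sub ham ha hX0).fderiv_right (m := 1) (by norm_cast)).differentiableAt (by simp)
  have h2 : fderiv ℝ (fderiv ℝ (fun Y => a Y - am Y)) X (unitVec j) (unitVec j)
      = fderiv ℝ (fun Y => fderiv ℝ (fun Y => a Y - am Y) Y (unitVec j)) X (unitVec j) := by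
    rw [fderiv_clm_apply hd (differentiableAt_const _)]
    simp
  have hda : DifferentiableAt ℝ (fun Y => fderiv ℝ a Y (unitVec j)) X := by
    have : DifferentiableAt ℝ (fderiv ℝ a) X :=
      (ha.smooth.contDiffAt.fderiv_right (m := 1) (by norm_cast)).differentiableAt (by simp)
    exact this.clm_apply (differentiableAt_const _)
  have hdm := (ham.fderiv_apply (unitVec j)).differentiableAt hX0
  have h3 : fderiv ℝ (fun Y => fderiv ℝ (fun Y => a Y - am Y) Y (unitVec j)) X
      = fderiv ℝ (fun Y => fderiv ℝ a Y (unitVec j) - fderiv ℝ am Y (unitVec j)) X := by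
    refine Filter.EventuallyEq.fderiv_eq ?_
    filter_upwards [isOpen_compl_singleton.mem_nhds hX0] with Y hY
    exact fderiv_sub_apply ham ha hY _
  rw [h2, h3, fderiv_fun_sub hda hdm] at h1
  refine h1.trans ?_
  push_cast
  gcongr
  exact le_max_left _ _

/-- The derivative `∂ⱼ a` extended to all directions, by `∂ⱼ am` at infinity. -/
def angular (m : ℝ) (a am : Rn n → ℝ) (j : Fin n) (Θ : Ext n) : ℝ :=
  if 0 < Θ.fst then Θ.fst ^ (m - 1) * fderiv ℝ a (Θ.fst⁻¹ • Θ.snd) (unitVec j)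
  else fderiv ℝ am Θ.snd (unitVec j)

theorem norm_sq_add {Θ : Ext n} (h : ‖Θ‖ = 1) : Θ.fst ^ 2 + ‖Θ.snd‖ ^ 2 = 1 := by
  have := WithLp.prod_norm_sq_eq_of_L2 Θ
  rw [h, Real.norm_eq_abs, sq_abs] at this
  linarith

/-- The equator is the only delicate place. Put `τ = Θ.fst > 0`. By homogeneity `∂ⱼam (Θ.snd) =
τ^(m-1) ∂ⱼam (τ⁻¹ Θ.snd)`, and the lower order bound gives a difference of order `τ^(m-1) *
(τ⁻¹)^(m-2) = τ`, which tends to zero. -/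
theorem continuousOn_angular (ham : IsPrincipalSymbol m am) (ha : DispersiveL m a am)
    (j : Fin n) : ContinuousOn (angular m a am j) (dirs n 1) := by
  have hD := ham.fderiv_apply (unitVec j)
  have hca : Continuous fun X => fderiv ℝ a X (unitVec j) :=
    (ha.smooth.continuous_fderiv (by simp)).clm_apply continuous_const
  have hf : Continuous fun Θ : Ext n => Θ.fst := by fun_prop
  have hs : Continuous fun Θ : Ext n => Θ.snd := by fun_prop
  intro Θ₀ hΘ₀
  rcases hΘ₀.2.1.eq_or_lt with h0 | h0
  swap
  · have h1 : ContinuousAt (fun Θ : Ext n =>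
        Θ.fst ^ (m - 1) * fderiv ℝ a (Θ.fst⁻¹ • Θ.snd) (unitVec j)) Θ₀ := by
      refine ContinuousAt.mul (hf.continuousAt.rpow_const (Or.inl h0.ne')) ?_
      exact hca.continuousAt.comp ((hf.continuousAt.inv₀ h0.ne').smul hs.continuousAt)
    refine (h1.congr ?_).continuousWithinAt
    filter_upwards [(isOpen_lt continuous_const hf).mem_nhds h0] with Θ hΘ
    rw [angular, if_pos hΘ]
  obtain ⟨C, hC0, hC⟩ := exists_deriv_bound ham ha j
  set K := (2 : ℝ) ^ (m - 1 - 1) + (1 / 2) ^ (m - 1 - 1) with hK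
  have hclose : ∀ Θ ∈ dirs n 1, Θ.fst < 1 / 2 →
      |angular m a am j Θ - fderiv ℝ am Θ.snd (unitVec j)| ≤ C * K * Θ.fst := by
    intro Θ hΘ hlt
    have hsq := norm_sq_add hΘ.1
    rcases hΘ.2.1.eq_or_lt with hz | hz
    · rw [angular, if_neg (by rw [← hz]; exact lt_irrefl _), ← hz]
      simp
    have hn1 : 1 / 2 ≤ ‖Θ.snd‖ := by nlinarith [norm_nonneg Θ.snd]
    have hn2 : ‖Θ.snd‖ ≤ 2 := by nlinarith [norm_nonneg Θ.snd]
    have hn0 : Θ.snd ≠ 0 := norm_pos_iff.1 (by linarith)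
    have hpos : 0 < Θ.fst ^ (m - 1) := Real.rpow_pos_of_pos hz _
    have hnorm : ‖Θ.fst⁻¹ • Θ.snd‖ = Θ.fst⁻¹ * ‖Θ.snd‖ := by
      rw [norm_smul, norm_inv, Real.norm_eq_abs, abs_of_pos hz]
    have hhom : fderiv ℝ am Θ.snd (unitVec j)
        = Θ.fst ^ (m - 1) * fderiv ℝ am (Θ.fst⁻¹ • Θ.snd) (unitVec j) := by
      have := hD.homogeneous Θ.fst hz (Θ.fst⁻¹ • Θ.snd) (smul_ne_zero (inv_ne_zero hz.ne') hn0)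
      rwa [smul_smul, mul_inv_cancel₀ hz.ne', one_smul] at this
    rw [angular, if_pos hz, hhom, ← mul_sub, abs_mul, abs_of_pos hpos]
    have h1 := hC (Θ.fst⁻¹ • Θ.snd) (by
      rw [hnorm, inv_mul_eq_div, le_div_iff₀ hz]; linarith)
    have h2 := rpow_le_of_comparable (m - 1 - 1) one_pos (Q := ‖Θ.snd‖) (by linarith) (by linarith)
    rw [Real.one_rpow, mul_one] at h2
    rw [hnorm, Real.mul_rpow (inv_nonneg.2 hz.le) (norm_nonneg _), Real.inv_rpow hz.le,
      Real.rpow_sub hz, Real.rpow_one] at h1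
    calc _ ≤ Θ.fst ^ (m - 1) * (C * ((Θ.fst ^ (m - 1) / Θ.fst)⁻¹ * K)) := by
          refine mul_le_mul_of_nonneg_left (h1.trans ?_) hpos.le
          gcongr
      _ = C * K * Θ.fst := by field_simp
  have hn0 : Θ₀.snd ≠ 0 := dirs_zero_snd_ne hΘ₀.1 h0.symm
  have h1 : ContinuousAt (fun Θ : Ext n => fderiv ℝ am Θ.snd (unitVec j)) Θ₀ :=
    ContinuousAt.comp (g := fun X => fderiv ℝ am X (unitVec j)) (hD.continuousAt hn0)
      hs.continuousAt
  have h2 : Filter.Tendsto (fun Θ : Ext n => angular m a am j Θ - fderiv ℝ am Θ.snd (unitVec j))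
      (nhdsWithin Θ₀ (dirs n 1)) (nhds 0) := by
    have hb : Filter.Tendsto (fun Θ : Ext n => C * K * Θ.fst) (nhdsWithin Θ₀ (dirs n 1))
        (nhds 0) := by
      have : Continuous fun Θ : Ext n => C * K * Θ.fst := continuous_const.mul hf
      have h3 := this.continuousWithinAt (s := dirs n 1) (x := Θ₀)
      rw [ContinuousWithinAt, ← h0, mul_zero] at h3
      exact h3
    refine squeeze_zero_norm' ?_ hb
    have hlt : ∀ᶠ Θ in nhdsWithin Θ₀ (dirs n 1), Θ.fst < 1 / 2 :=
      mem_nhdsWithin_of_mem_nhds ((isOpen_lt hf continuous_const).mem_nhds (by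
        change Θ₀.fst < 1 / 2
        rw [← h0]; norm_num))
    filter_upwards [hlt, self_mem_nhdsWithin] with Θ hΘ hΘ'
    exact hclose Θ hΘ' hΘ
  have h3 := h2.add (h1.continuousWithinAt (s := dirs n 1)).tendsto
  rw [zero_add] at h3
  have h4 : angular m a am j Θ₀ = fderiv ℝ am Θ₀.snd (unitVec j) := by
    rw [angular, if_neg (by rw [← h0]; exact lt_irrefl _)]
  rw [ContinuousWithinAt, h4]
  refine h3.congr fun Θ => ?_
  ring

/-- With `κ₀ = 1` the size is at least `1`. A direction off the equator is that of the finite point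
`Θ.fst⁻¹ • Θ.snd`, where `∇a ≠ 0`; on the equator `∇am ≠ 0` is used. Second derivatives are bounded
by compactness on the unit ball and by `am` plus the lower order term outside. -/
theorem exists_isDispersive (ham : IsPrincipalSymbol m am) (ha : DispersiveL m a am) :
    ∃ C D G, 0 ≤ C ∧ IsDispersive (m - 1) 1 C a D G := by
  have hsize1 : ∀ X : Rn n, 1 ≤ size 1 X := fun X => by simpa using le_size 1 X
  have hda : ∀ j X, DifferentiableAt ℝ (fun Y => fderiv ℝ a Y (unitVec j)) X := fun j X => by
    have : DifferentiableAt ℝ (fderiv ℝ a) X :=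
      (ha.smooth.contDiffAt.fderiv_right (m := 1) (by norm_cast)).differentiableAt (by simp)
    exact this.clm_apply (differentiableAt_const _)
  set D₂ : Fin n → Rn n → ℝ := fun j X =>
    fderiv ℝ (fun Y => fderiv ℝ a Y (unitVec j)) X (unitVec j) with hD₂
  have hD₂c : ∀ j, Continuous (D₂ j) := by
    intro j
    have h1 : ContDiff ℝ 1 fun Y => fderiv ℝ a Y (unitVec j) :=
      (ha.smooth.fderiv_right (m := 1) (by norm_cast)).clm_apply contDiff_const
    exact (h1.continuous_fderiv (by simp)).clm_apply continuous_const
  set K := (2 : ℝ) ^ (m - 1 - 1) + (1 / 2) ^ (m - 1 - 1) with hK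
  have hK0 : 0 ≤ K := by positivity
  have hD₂b : ∀ j, ∃ C, 0 ≤ C ∧ ∀ X, |D₂ j X| ≤ C * size 1 X ^ (m - 1 - 1) := by
    intro j
    obtain ⟨C₁, hC₁0, hC₁⟩ := exists_deriv₂_bound ham ha j
    obtain ⟨C₂, hC₂0, hC₂⟩ := ((ham.fderiv_apply (unitVec j)).fderiv_apply (unitVec j)).exists_bound
    obtain ⟨M, hM⟩ := (isCompact_closedBall (0 : Rn n) 1).exists_bound_of_continuousOn
      (hD₂c j).continuousOn
    refine ⟨(C₁ + C₂ + max M 0) * K, by positivity, fun X => ?_⟩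
    have hs := hsize1 X
    have hsq := size_sq 1 X
    have hs' := norm_le_size 1 X
    rw [mul_assoc]
    rcases le_total 1 ‖X‖ with h1 | h1
    · have hX0 : X ≠ 0 := norm_pos_iff.1 (by linarith)
      have hcmp : ‖X‖ ^ (m - 1 - 1) ≤ K * size 1 X ^ (m - 1 - 1) :=
        rpow_le_of_comparable _ (by linarith) (by nlinarith) (by linarith)
      have h2 := hC₁ X h1
      have h3 := hC₂ X hX0
      -- The lower order term decays one power better than is needed.
      have h4 : ‖X‖ ^ (m - 1 - 2) ≤ ‖X‖ ^ (m - 1 - 1) :=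
        Real.rpow_le_rpow_of_exponent_le h1 (by linarith)
      calc |D₂ j X| ≤ C₁ * ‖X‖ ^ (m - 1 - 2) + C₂ * ‖X‖ ^ (m - 1 - 1) := by
            refine le_trans ?_ (add_le_add h2 h3)
            rw [hD₂]
            refine le_trans (le_of_eq ?_) (abs_add_le _ _)
            simp
        _ ≤ C₁ * (K * size 1 X ^ (m - 1 - 1)) + C₂ * (K * size 1 X ^ (m - 1 - 1)) := by
            gcongr
            exact h4.trans hcmp
        _ = (C₁ + C₂ + 0) * (K * size 1 X ^ (m - 1 - 1)) := by ring
        _ ≤ _ := by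
            gcongr
            exact le_max_right _ _
    · have hX2 : ‖X‖ ^ 2 ≤ 1 := pow_le_one₀ (norm_nonneg _) h1
      have hcmp : (1 : ℝ) ^ (m - 1 - 1) ≤ K * size 1 X ^ (m - 1 - 1) :=
        rpow_le_of_comparable _ (by linarith) (by nlinarith) (by linarith)
      rw [Real.one_rpow] at hcmp
      have h2 := hM X (by simpa using h1)
      calc |D₂ j X| ≤ (0 + 0 + max M 0) * 1 := by
            rw [zero_add, zero_add, mul_one]; exact h2.trans (le_max_left _ _)
        _ ≤ _ := by gcongr
  choose C hC0 hC using hD₂b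
  have hCs : ∀ j, C j ≤ ∑ i, C i := fun j =>
    Finset.single_le_sum (fun i _ => hC0 i) (Finset.mem_univ j)
  have hCs0 : 0 ≤ ∑ i, C i := Finset.sum_nonneg fun i _ => hC0 i
  refine ⟨(∑ i, C i) * K, fun j X => fderiv ℝ a X (unitVec j), angular m a am, by positivity,
    zero_le_one, ha.smooth.continuous.measurable, fun j X hX => ?_, fun j X hX => ?_,
    continuousOn_angular ham ha, fun Θ hΘ => ?_, fun j => ?_⟩
  · exact hasDerivAt_line_of_differentiableAt (ha.smooth.contDiffAt.differentiableAt (by simp)) _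
  · rw [angular, dir_fst, dir_snd, mul_one, if_pos (inv_pos.2 hX), inv_inv, smul_smul,
      mul_inv_cancel₀ hX.ne', one_smul, Real.inv_rpow hX.le, ← mul_assoc,
      mul_inv_cancel₀ (Real.rpow_pos_of_pos hX _).ne', one_mul]
  · by_cases h0 : 0 < Θ.fst
    · obtain ⟨j, hj⟩ := exists_fderiv_unitVec_ne (ha.gradient_ne (Θ.fst⁻¹ • Θ.snd))
      refine ⟨j, ?_⟩
      rw [angular, if_pos h0]
      exact mul_ne_zero (Real.rpow_pos_of_pos h0 _).ne' hj
    · have h1 : Θ.fst = 0 := le_antisymm (not_lt.1 h0) hΘ.2.1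
      obtain ⟨j, hj⟩ := exists_fderiv_unitVec_ne
        (ha.gradient_principal_ne _ (dirs_zero_snd_ne hΘ.1 h1))
      refine ⟨j, ?_⟩
      rwa [angular, if_neg h0]
  · exact deriv_lipschitz_of_bound (κ := m - 1) (κ₀ := 1) hCs0
      (D := fun X => fderiv ℝ a X (unitVec j)) j (D₂ := D₂ j)
      (fun X _ => hasDerivAt_line_of_differentiableAt (hda j X) _)
      (fun X hX => (hC j X).trans (by gcongr; exact hCs j))

end DispersiveL

end SymbolL

/-! ### Splitting off one coordinate and the partial Fourier transform -/

section Splitting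

variable {k : ℕ}

/-- The splitting `ℝ × ℝᵏ ≃ ℝᵏ⁺¹` which singles out the `j`-th coordinate. -/
def insEquiv (j : Fin (k + 1)) : ℝ × Rn k ≃ᵐ Rn (k + 1) :=
  ((MeasurableEquiv.refl ℝ).prodCongr (MeasurableEquiv.toLp 2 (Fin k → ℝ)).symm).trans
    ((MeasurableEquiv.piFinSuccAbove (fun _ => ℝ) j).symm.trans
      (MeasurableEquiv.toLp 2 (Fin (k + 1) → ℝ)))

theorem measurePreserving_insEquiv (j : Fin (k + 1)) :
    MeasurePreserving (insEquiv j) volume volume := by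
  have h1 : MeasurePreserving ((MeasurableEquiv.refl ℝ).prodCongr
      (MeasurableEquiv.toLp 2 (Fin k → ℝ)).symm) volume volume :=
    (MeasurePreserving.id (volume : Measure ℝ)).prod
      (EuclideanSpace.volume_preserving_symm_measurableEquiv_toLp (Fin k))
  have h2 : MeasurePreserving (MeasurableEquiv.piFinSuccAbove (fun _ => ℝ) j).symm volume volume :=
    (volume_preserving_piFinSuccAbove (fun _ : Fin (k + 1) => ℝ) j).symm _
  have h3 : MeasurePreserving (MeasurableEquiv.toLp 2 (Fin (k + 1) → ℝ)) volume volume :=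
    (EuclideanSpace.volume_preserving_symm_measurableEquiv_toLp (Fin (k + 1))).symm _
  exact h3.comp (h2.comp h1)

theorem insEquiv_ofLp (j : Fin (k + 1)) (x : ℝ) (x' : Rn k) :
    (insEquiv j (x, x')).ofLp = j.insertNth (α := fun _ => ℝ) x x'.ofLp := rfl

theorem insEquiv_eq_add (j : Fin (k + 1)) (x : ℝ) (x' : Rn k) :
    insEquiv j (x, x') = insEquiv j (0, x') + x • unitVec j := by
  ext i
  rw [PiLp.add_apply, PiLp.smul_apply, insEquiv_ofLp, insEquiv_ofLp]
  rcases Fin.eq_self_or_eq_succAbove j i with h | ⟨i', h⟩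
  · subst h; simp [unitVec]
  · subst h; simp [unitVec, Fin.succAbove_ne]

theorem inner_insEquiv (j : Fin (k + 1)) (x ξ : ℝ) (x' ξ' : Rn k) :
    inner ℝ (insEquiv j (x, x')) (insEquiv j (ξ, ξ')) = x * ξ + inner ℝ x' ξ' := by
  rw [PiLp.inner_apply, PiLp.inner_apply, Fin.sum_univ_succAbove _ j]
  simp only [insEquiv_ofLp, Fin.insertNth_apply_same, Fin.insertNth_apply_succAbove]
  simp [mul_comm]

theorem norm_sq_insEquiv (j : Fin (k + 1)) (x : ℝ) (x' : Rn k) :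
    ‖insEquiv j (x, x')‖ ^ 2 = x ^ 2 + ‖x'‖ ^ 2 := by
  rw [← real_inner_self_eq_norm_sq, inner_insEquiv, real_inner_self_eq_norm_sq]
  ring

/-- The weighted norm `‖⟨x⟩^s h‖²`. -/
def wsq {n : ℕ} (s : ℝ) (h : Rn n → ℂ) : ℝ≥0∞ :=
  ∫⁻ x, ENNReal.ofReal ((1 + ‖x‖ ^ 2) ^ s) * ‖h x‖ₑ ^ 2

/-- The Fourier transform in all variables but the `j`-th one. -/
def partialFourier (j : Fin (k + 1)) (h : Rn (k + 1) → ℂ) (p : ℝ × Rn k) : ℂ :=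
  𝓕 (fun x' => h (insEquiv j (p.1, x'))) p.2

theorem measurable_partialFourier (j : Fin (k + 1)) {h : Rn (k + 1) → ℂ} (hm : Measurable h) :
    Measurable (partialFourier j h) := by
  have h1 : Measurable fun q : (ℝ × Rn k) × Rn k =>
      Real.fourierChar (-inner ℝ q.2 q.1.2) • h (insEquiv j (q.1.1, q.2)) := by
    have h2 : Measurable fun q : (ℝ × Rn k) × Rn k => h (insEquiv j (q.1.1, q.2)) :=
      hm.comp ((insEquiv j).measurable.comp (by fun_prop))
    have h3 : Continuous fun q : (ℝ × Rn k) × Rn k =>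
        ((Real.fourierChar (-inner ℝ q.2 q.1.2) : Circle) : ℂ) := by
      have : Continuous fun q : (ℝ × Rn k) × Rn k => -inner ℝ q.2 q.1.2 := by fun_prop
      exact continuous_subtype_val.comp (Real.continuous_fourierChar.comp this)
    exact h3.measurable.mul h2
  have := h1.stronglyMeasurable.integral_prod_right' (ν := (volume : Measure (Rn k)))
  exact this.measurable

/-- Fubini. On a line in the `j`-th direction `𝓕 h` is a one-dimensional transform, so decay of
`partialFourier` in `x` becomes regularity in `ξ`. -/
theorem fourier_insEquiv (j : Fin (k + 1)) {h : Rn (k + 1) → ℂ} (hi : Integrable h) (ξ : ℝ)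
    (ξ' : Rn k) :
    𝓕 h (insEquiv j (ξ, ξ')) = ∫ x, Real.fourierChar (-(x * ξ)) • partialFourier j h (x, ξ') := by
  rw [Real.fourier_eq, ← (measurePreserving_insEquiv j).integral_comp' (g := fun v =>
    Real.fourierChar (-inner ℝ v (insEquiv j (ξ, ξ'))) • h v)]
  have hint : Integrable (fun q : ℝ × Rn k =>
      Real.fourierChar (-inner ℝ (insEquiv j q) (insEquiv j (ξ, ξ'))) • h (insEquiv j q)) := by
    have := (Real.fourierIntegral_convergent_iff (insEquiv j (ξ, ξ'))).2 hi
    exact (measurePreserving_insEquiv j).integrable_comp_emb (insEquiv j).measurableEmbedding |>.2 this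
  rw [Measure.volume_eq_prod, integral_prod _ (by rwa [← Measure.volume_eq_prod])]
  refine integral_congr_ae (ae_of_all _ fun x => ?_)
  simp only [partialFourier]
  rw [Real.fourier_eq, Circle.smul_def, ← integral_smul]
  refine integral_congr_ae (ae_of_all _ fun x' => ?_)
  simp only [inner_insEquiv, neg_add, AddChar.map_add_eq_mul, mul_smul, Circle.smul_def]

theorem lintegral_insEquiv (j : Fin (k + 1)) {f : Rn (k + 1) → ℝ≥0∞} (hf : Measurable f) :
    ∫⁻ v, f v = ∫⁻ x' : Rn k, ∫⁻ x : ℝ, f (insEquiv j (x, x')) := by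
  rw [← (measurePreserving_insEquiv j).lintegral_comp_emb (insEquiv j).measurableEmbedding,
    Measure.volume_eq_prod]
  exact lintegral_prod_symm _ (hf.comp (insEquiv j).measurable).aemeasurable

/-- The mixed norm controlling the restriction of `𝓕 h` to lines in the `j`-th direction. -/
def traceNorm (s : ℝ) (j : Fin (k + 1)) (h : Rn (k + 1) → ℂ) (ξ' : Rn k) : ℝ≥0∞ :=
  ∫⁻ x : ℝ, ENNReal.ofReal ((1 + x ^ 2) ^ s) * ‖partialFourier j h (x, ξ')‖ₑ ^ 2

/-- Plancherel in the transversal variables for almost every `x`, followed by `1 + x² ≤ 1 + ‖v‖²`.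
-/
theorem lintegral_traceNorm_le {s : ℝ} (hs : 0 ≤ s) (j : Fin (k + 1)) {h : Rn (k + 1) → ℂ}
    (hm : Measurable h) (hi : Integrable h) (h2 : MemLp h 2) :
    ∫⁻ ξ', traceNorm s j h ξ' ≤ wsq s h := by
  have hmp := measurable_partialFourier j hm
  have hi' : Integrable (fun q : ℝ × Rn k => h (insEquiv j q)) (volume.prod volume) := by
    rw [← Measure.volume_eq_prod]
    exact (measurePreserving_insEquiv j).integrable_comp_emb (insEquiv j).measurableEmbedding |>.2 hi
  have hfin : ∫⁻ x, ∫⁻ x' : Rn k, ‖h (insEquiv j (x, x'))‖ₑ ^ 2 ≠ ⊤ := by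
    rw [← lintegral_prod (fun q : ℝ × Rn k => ‖h (insEquiv j q)‖ₑ ^ 2)
      ((hm.comp (insEquiv j).measurable).enorm.pow_const 2).aemeasurable,
      ← Measure.volume_eq_prod,
      (measurePreserving_insEquiv j).lintegral_comp_emb (insEquiv j).measurableEmbedding
        (fun v => ‖h v‖ₑ ^ 2), lintegral_enorm_sq_eq]
    exact ENNReal.pow_ne_top h2.eLpNorm_ne_top
  have hsl : ∀ x, Measurable fun x' : Rn k => h (insEquiv j (x, x')) := fun x =>
    hm.comp ((insEquiv j).measurable.comp (by fun_prop))
  calc ∫⁻ ξ', traceNorm s j h ξ'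
      = ∫⁻ x : ℝ, ∫⁻ ξ' : Rn k, ENNReal.ofReal ((1 + x ^ 2) ^ s) *
          ‖partialFourier j h (x, ξ')‖ₑ ^ 2 := by
        unfold traceNorm
        rw [lintegral_lintegral_swap]
        have h3 : Measurable fun q : Rn k × ℝ => ENNReal.ofReal ((1 + q.2 ^ 2) ^ s) *
          ‖partialFourier j h (q.2, q.1)‖ₑ ^ 2 := by
          have : Measurable fun q : Rn k × ℝ => partialFourier j h (q.2, q.1) :=
            hmp.comp measurable_swap
          fun_prop
        exact h3.aemeasurable
    _ = ∫⁻ x : ℝ, ∫⁻ x' : Rn k, ENNReal.ofReal ((1 + x ^ 2) ^ s) *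
          ‖h (insEquiv j (x, x'))‖ₑ ^ 2 := by
        refine lintegral_congr_ae ?_
        have hae := ae_lt_top' (by
          exact (Measurable.lintegral_prod_right' (f := fun q : ℝ × Rn k =>
            ‖h (insEquiv j q)‖ₑ ^ 2)
            ((hm.comp (insEquiv j).measurable).enorm.pow_const 2)).aemeasurable) hfin
        filter_upwards [hi'.prod_right_ae, hae] with x hx hx2
        have hx3 : MemLp (fun x' : Rn k => h (insEquiv j (x, x'))) 2 := by
          refine ⟨(hsl x).aestronglyMeasurable, ?_⟩
          rw [lintegral_enorm_sq_eq] at hx2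
          exact lt_top_iff_ne_top.2 fun h0 => by rw [h0] at hx2; simp at hx2
        have := lintegral_fourier_sq hx hx3
        rw [lintegral_const_mul _ ((hsl x).enorm.pow_const 2), lintegral_const_mul, ← this]
        · rfl
        · exact (hmp.comp (by fun_prop : Measurable fun ξ' : Rn k => (x, ξ'))).enorm.pow_const 2
    _ ≤ ∫⁻ x : ℝ, ∫⁻ x' : Rn k, ENNReal.ofReal ((1 + ‖insEquiv j (x, x')‖ ^ 2) ^ s) *
          ‖h (insEquiv j (x, x'))‖ₑ ^ 2 := by
        refine lintegral_mono fun x => lintegral_mono fun x' => ?_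
        simp only []
        refine mul_le_mul' (ENNReal.ofReal_le_ofReal (Real.rpow_le_rpow (by positivity) ?_ hs)) le_rfl
        rw [norm_sq_insEquiv]
        nlinarith [sq_nonneg ‖x'‖]
    _ = wsq s h := by
        have hmeas : Measurable fun v : Rn (k + 1) => ENNReal.ofReal ((1 + ‖v‖ ^ 2) ^ s) *
          ‖h v‖ₑ ^ 2 := by fun_prop
        rw [wsq, lintegral_insEquiv j hmeas, lintegral_lintegral_swap]
        exact (hmeas.comp ((insEquiv j).measurable)).aemeasurable

end Splitting

/-! ### Boundedness and Hölder continuity of the Fourier transform on lines -/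

section Trace

/-- The Cauchy-Schwarz inequality for lower integrals. -/
theorem lintegral_mul_sq_le {α : Type*} [MeasurableSpace α] {μ : Measure α} {f g : α → ℝ≥0∞}
    (hf : AEMeasurable f μ) (hg : AEMeasurable g μ) :
    (∫⁻ x, f x * g x ∂μ) ^ 2 ≤ (∫⁻ x, f x ^ 2 ∂μ) * ∫⁻ x, g x ^ 2 ∂μ := by
  have h := ENNReal.lintegral_mul_le_Lp_mul_Lq μ Real.HolderConjugate.two_two hf hg
  simp only [Pi.mul_apply, ENNReal.rpow_two] at h
  calc _ ≤ ((∫⁻ x, f x ^ 2 ∂μ) ^ (1 / 2 : ℝ) * (∫⁻ x, g x ^ 2 ∂μ) ^ (1 / 2 : ℝ)) ^ 2 := by gcongr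
    _ = _ := by
      rw [← ENNReal.mul_rpow_of_nonneg _ _ (by norm_num), ← ENNReal.rpow_two, ← ENNReal.rpow_mul]
      norm_num

theorem norm_fourierChar_sub_le (a b : ℝ) :
    ‖(Real.fourierChar a : ℂ) - Real.fourierChar b‖ ≤ 2 * Real.pi * |a - b| := by
  have h : (Real.fourierChar a : ℂ) - Real.fourierChar b
      = Real.fourierChar b * (Complex.exp (Complex.I * ((2 * Real.pi * (a - b) : ℝ) : ℂ)) - 1) := by
    rw [Real.fourierChar_apply, Real.fourierChar_apply, mul_sub, mul_one, ← Complex.exp_add]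
    congr 2
    push_cast
    ring
  rw [h, norm_mul, Circle.norm_coe, one_mul]
  refine Real.norm_exp_I_mul_ofReal_sub_one_le.trans (le_of_eq ?_)
  rw [Real.norm_eq_abs, abs_mul, abs_of_pos Real.two_pi_pos]

/-- The Lipschitz bound serves for `|a - b| ≤ 1`, the trivial bound `2` otherwise. -/
theorem norm_fourierChar_sub_le_rpow {γ : ℝ} (hγ : 0 ≤ γ) (hγ1 : γ ≤ 1) (a b : ℝ) :
    ‖(Real.fourierChar a : ℂ) - Real.fourierChar b‖ ≤ 2 * Real.pi * |a - b| ^ γ := by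
  rcases le_total |a - b| 1 with h | h
  · refine (norm_fourierChar_sub_le a b).trans ?_
    have := Real.rpow_le_rpow_of_exponent_ge_of_imp (abs_nonneg (a - b)) h hγ1
      (fun _ h => absurd h one_ne_zero)
    rw [Real.rpow_one] at this
    gcongr
  · have h1 : (1 : ℝ) ≤ |a - b| ^ γ := Real.one_le_rpow h hγ
    have h2 := norm_sub_le (Real.fourierChar a : ℂ) (Real.fourierChar b)
    rw [Circle.norm_coe, Circle.norm_coe] at h2
    nlinarith [Real.pi_gt_three]

variable {k : ℕ}

/-- A majorant of `𝓕 h` and of its Hölder seminorm on lines in the `j`-th direction. -/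
def traceMaj (γ : ℝ) (j : Fin (k + 1)) (h : Rn (k + 1) → ℂ) (ξ' : Rn k) : ℝ≥0∞ :=
  ∫⁻ x : ℝ, ENNReal.ofReal ((1 + x ^ 2) ^ (γ / 2)) * ‖partialFourier j h (x, ξ')‖ₑ

theorem measurable_traceMaj (γ : ℝ) (j : Fin (k + 1)) {h : Rn (k + 1) → ℂ} (hm : Measurable h) :
    Measurable (traceMaj γ j h) := by
  have hmp := measurable_partialFourier j hm
  have h3 : Measurable fun q : Rn k × ℝ => ENNReal.ofReal ((1 + q.2 ^ 2) ^ (γ / 2)) *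
      ‖partialFourier j h (q.2, q.1)‖ₑ := by
    have : Measurable fun q : Rn k × ℝ => partialFourier j h (q.2, q.1) :=
      hmp.comp measurable_swap
    fun_prop
  exact h3.lintegral_prod_right'

theorem lintegral_one_add_sq_rpow_lt_top {e : ℝ} (he : e < -(1 / 2)) :
    ∫⁻ x : ℝ, ENNReal.ofReal ((1 + x ^ 2) ^ e) < ⊤ := by
  have h := integrable_rpow_neg_one_add_norm_sq (E := ℝ) (μ := volume) (r := -2 * e)
    (by simp; linarith)
  have h2 := h.lintegral_lt_top
  refine lt_of_eq_of_lt (lintegral_congr fun x => ?_) h2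
  rw [Real.norm_eq_abs, sq_abs]
  congr 2
  ring

/-- Cauchy–Schwarz in `x`, writing the weight `⟨x⟩^γ` as `⟨x⟩^(γ-s) ⟨x⟩^s`. The first factor on the
right is finite when `γ < s - 1/2`. -/
theorem lintegral_traceMaj_sq_le {s γ : ℝ} (hs : 0 ≤ s) (j : Fin (k + 1))
    {h : Rn (k + 1) → ℂ} (hm : Measurable h) (hi : Integrable h) (h2 : MemLp h 2) :
    ∫⁻ ξ', traceMaj γ j h ξ' ^ 2 ≤
      (∫⁻ x : ℝ, ENNReal.ofReal ((1 + x ^ 2) ^ (γ - s))) * wsq s h := by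
  have hmp := measurable_partialFourier j hm
  set c := ∫⁻ x : ℝ, ENNReal.ofReal ((1 + x ^ 2) ^ (γ - s)) with hc
  have hpt : ∀ ξ', traceMaj γ j h ξ' ^ 2 ≤ c * traceNorm s j h ξ' := by
    intro ξ'
    have hpm : Measurable fun x : ℝ => partialFourier j h (x, ξ') := hmp.comp (by fun_prop)
    have hcs := lintegral_mul_sq_le (μ := (volume : Measure ℝ))
      (f := fun x => ENNReal.ofReal ((1 + x ^ 2) ^ (γ / 2 - s / 2)))
      (g := fun x => ENNReal.ofReal ((1 + x ^ 2) ^ (s / 2)) * ‖partialFourier j h (x, ξ')‖ₑ)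
      (by fun_prop) (by fun_prop)
    refine le_of_eq_of_le ?_ (hcs.trans (le_of_eq ?_))
    · rw [traceMaj]
      congr 1
      refine lintegral_congr fun x => ?_
      have hx : (0 : ℝ) < 1 + x ^ 2 := by positivity
      rw [← mul_assoc, ← ENNReal.ofReal_mul (by positivity), ← Real.rpow_add hx]
      congr 3
      ring
    · rw [hc, traceNorm]
      congr 1
      · refine lintegral_congr fun x => ?_
        have hx : (0 : ℝ) < 1 + x ^ 2 := by positivity
        rw [← ENNReal.ofReal_pow (by positivity), ← Real.rpow_natCast, ← Real.rpow_mul hx.le]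
        congr 2
        push_cast
        ring
      · refine lintegral_congr fun x => ?_
        have hx : (0 : ℝ) < 1 + x ^ 2 := by positivity
        rw [mul_pow, ← ENNReal.ofReal_pow (by positivity), ← Real.rpow_natCast,
          ← Real.rpow_mul hx.le]
        congr 3
        push_cast
        ring
  calc _ ≤ ∫⁻ ξ', c * traceNorm s j h ξ' := lintegral_mono hpt
    _ = c * ∫⁻ ξ', traceNorm s j h ξ' := by
      refine lintegral_const_mul _ ?_
      have h3 : Measurable fun q : Rn k × ℝ => ENNReal.ofReal ((1 + q.2 ^ 2) ^ s) *
          ‖partialFourier j h (q.2, q.1)‖ₑ ^ 2 := by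
        have : Measurable fun q : Rn k × ℝ => partialFourier j h (q.2, q.1) :=
          hmp.comp measurable_swap
        fun_prop
      exact h3.lintegral_prod_right'
    _ ≤ _ := by gcongr; exact lintegral_traceNorm_le hs j hm hi h2

/-- The difference of the two characters at `x` is at most `2π |x|^γ |ξ - η|^γ`, and `|x|^γ ≤ (1 +
x²)^(γ/2)` is the weight in `traceMaj`. The factor `2π` is superfluous in the first bound and kept
for uniformity. -/
theorem trace_bounds {γ : ℝ} (hγ : 0 ≤ γ) (hγ1 : γ ≤ 1) (j : Fin (k + 1)) {h : Rn (k + 1) → ℂ}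
    (hm : Measurable h) (hi : Integrable h) {ξ' : Rn k} (hfin : traceMaj γ j h ξ' ≠ ⊤) :
    (∀ ξ : ℝ, ‖𝓕 h (insEquiv j (ξ, ξ'))‖ ≤ 2 * Real.pi * (traceMaj γ j h ξ').toReal) ∧
    ∀ ξ η : ℝ, ‖𝓕 h (insEquiv j (ξ, ξ')) - 𝓕 h (insEquiv j (η, ξ'))‖ ≤
      2 * Real.pi * (traceMaj γ j h ξ').toReal * |ξ - η| ^ γ := by
  have hpm : Measurable fun x : ℝ => partialFourier j h (x, ξ') :=
    (measurable_partialFourier j hm).comp (by fun_prop)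
  have hle : ∫⁻ x : ℝ, ‖partialFourier j h (x, ξ')‖ₑ ≤ traceMaj γ j h ξ' := by
    refine lintegral_mono fun x => ?_
    refine le_mul_of_one_le_left' ?_
    rw [← ENNReal.ofReal_one]
    exact ENNReal.ofReal_le_ofReal (Real.one_le_rpow (by nlinarith [sq_nonneg x]) (by linarith))
  have hpi : Integrable fun x : ℝ => partialFourier j h (x, ξ') :=
    ⟨hpm.aestronglyMeasurable, lt_of_le_of_lt hle (lt_top_iff_ne_top.2 hfin)⟩
  have htr : ∀ {z : ℂ} {r : ℝ}, 0 ≤ r → ‖z‖ₑ ≤ ENNReal.ofReal r * traceMaj γ j h ξ' →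
      ‖z‖ ≤ r * (traceMaj γ j h ξ').toReal := by
    intro z r hr hz
    have := ENNReal.toReal_mono (ENNReal.mul_ne_top ENNReal.ofReal_ne_top hfin) hz
    rwa [toReal_enorm, ENNReal.toReal_mul, ENNReal.toReal_ofReal hr] at this
  have hint : ∀ ξ : ℝ, Integrable fun x : ℝ =>
      (Real.fourierChar (-(x * ξ)) : ℂ) * partialFourier j h (x, ξ') := by
    intro ξ
    refine hpi.bdd_mul (c := 1) ?_ (ae_of_all _ fun x => by rw [Circle.norm_coe])
    have : Continuous fun x : ℝ => -(x * ξ) := by fun_prop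
    exact (continuous_subtype_val.comp
      (Real.continuous_fourierChar.comp this)).aestronglyMeasurable
  refine ⟨fun ξ => ?_, fun ξ η => ?_⟩
  · refine htr (by positivity) ?_
    rw [fourier_insEquiv j hi]
    refine (enorm_integral_le_lintegral_enorm _).trans ?_
    have : ∀ x : ℝ, ‖Real.fourierChar (-(x * ξ)) • partialFourier j h (x, ξ')‖ₑ
        = ‖partialFourier j h (x, ξ')‖ₑ := fun x => by
      rw [← ofReal_norm, Circle.norm_smul, ofReal_norm]
    simp_rw [this]
    refine hle.trans (le_mul_of_one_le_left' ?_)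
    rw [← ENNReal.ofReal_one]
    exact ENNReal.ofReal_le_ofReal (by nlinarith [Real.pi_gt_three])
  · rw [mul_right_comm]
    refine htr (by positivity) ?_
    rw [fourier_insEquiv j hi, fourier_insEquiv j hi]
    simp only [Circle.smul_def, smul_eq_mul]
    rw [← integral_sub (hint ξ) (hint η)]
    refine (enorm_integral_le_lintegral_enorm _).trans ?_
    rw [traceMaj, ← lintegral_const_mul _ (by fun_prop)]
    refine lintegral_mono fun x => ?_
    rw [← sub_mul, enorm_mul, ← mul_assoc, ← ENNReal.ofReal_mul (by positivity)]
    refine mul_le_mul' ?_ le_rfl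
    rw [← ofReal_norm]
    refine ENNReal.ofReal_le_ofReal ((norm_fourierChar_sub_le_rpow hγ hγ1 _ _).trans ?_)
    have e : |-(x * ξ) - -(x * η)| = |ξ - η| * |x| := by
      rw [← abs_mul, ← abs_neg]; congr 1; ring
    rw [e, Real.mul_rpow (abs_nonneg _) (abs_nonneg _), ← mul_assoc]
    gcongr
    have h3 : |x| ^ γ = (x ^ 2) ^ (γ / 2) := by
      rw [← sq_abs, ← Real.rpow_natCast, ← Real.rpow_mul (abs_nonneg _)]
      congr 1
      push_cast
      ring
    rw [h3]
    exact Real.rpow_le_rpow (sq_nonneg _) (by linarith) (by linarith)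

end Trace

/-! ### A Hardy type inequality for the Fourier transform -/

section Hardy

variable {n : ℕ} {s : ℝ}

/-- Scaling to the unit ball. The singularity is integrable because `2 s < 2 ≤ n`. -/
theorem setLIntegral_norm_rpow_ball (hn : 2 ≤ n) (hs1 : s < 1) {R : ℝ} (hR : 0 < R) :
    ∫⁻ x in Metric.ball (0 : Rn n) R, ENNReal.ofReal (‖x‖ ^ (-(2 * s))) =
      ENNReal.ofReal (R ^ ((n : ℝ) - 2 * s) *
        ∫ x in Metric.ball (0 : Rn n) 1, ‖x‖ ^ (-(2 * s))) := by
  have hn2 : (2 : ℝ) ≤ n := by exact_mod_cast hn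
  have hI : IntegrableOn (fun x : Rn n => ‖x‖ ^ (-(2 * s))) (Metric.ball 0 R) := by
    refine integrableOn_ball_of_norm_le_rpow (C := 1) (α := 2 * s) (by simp; omega)
      (by rw [finrank_euclideanSpace_fin]; linarith) (ae_of_all _ fun x => ?_) ?_
    · rw [one_mul, Real.norm_eq_abs, abs_of_nonneg (by positivity)]
    · exact (measurable_norm.pow_const _).aestronglyMeasurable
  rw [← ofReal_integral_eq_lintegral_ofReal hI (ae_of_all _ fun x => by positivity)]
  congr 1
  have h := Measure.setIntegral_comp_smul_of_pos (volume : Measure (Rn n))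
    (fun x : Rn n => ‖x‖ ^ (-(2 * s))) (Metric.ball 0 1) hR
  rw [_root_.smul_ball hR.ne', smul_zero, mul_one, Real.norm_eq_abs, abs_of_pos hR,
    finrank_euclideanSpace_fin, smul_eq_mul] at h
  have h2 : ∀ x : Rn n, ‖R • x‖ ^ (-(2 * s)) = R ^ (-(2 * s)) * ‖x‖ ^ (-(2 * s)) := fun x => by
    rw [norm_smul, Real.norm_eq_abs, abs_of_pos hR, Real.mul_rpow hR.le (norm_nonneg _)]
  simp_rw [h2] at h
  rw [integral_const_mul] at h
  have hRn : R ^ n ≠ 0 := by positivity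
  rw [eq_inv_mul_iff_mul_eq₀ hRn] at h
  rw [← h, ← mul_assoc, sub_eq_add_neg, Real.rpow_add hR, Real.rpow_natCast]

theorem one_add_sq_mul_rpow_le (hs : 0 ≤ s) {x : Rn n} (hx : x ≠ 0) :
    ‖x‖ ^ (2 * s) ≤ (1 + ‖x‖ ^ 2) ^ s := by
  have hn : 0 < ‖x‖ := norm_pos_iff.2 hx
  rw [Real.rpow_mul hn.le, Real.rpow_two]
  exact Real.rpow_le_rpow (by positivity) (by linarith) hs

theorem sq_lintegral_ball_le (hs : 0 ≤ s) (hn : 2 ≤ n) {h : Rn n → ℂ} (hm : Measurable h) {R : ℝ} :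
    (∫⁻ x in Metric.ball (0 : Rn n) R, ‖h x‖ₑ) ^ 2 ≤
      (∫⁻ x in Metric.ball (0 : Rn n) R, ENNReal.ofReal (‖x‖ ^ (-(2 * s)))) * wsq s h := by
  have : Nontrivial (Rn n) := by
    have : Nonempty (Fin n) := ⟨⟨0, by omega⟩⟩
    infer_instance
  have hae : ∀ᵐ x : Rn n, x ≠ 0 := by simp [ae_iff]
  have h1 := lintegral_mul_sq_le (μ := (volume : Measure (Rn n)).restrict (Metric.ball 0 R))
    (f := fun x => ENNReal.ofReal (‖x‖ ^ (-s)))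
    (g := fun x => ENNReal.ofReal (‖x‖ ^ s) * ‖h x‖ₑ) (by fun_prop) (by fun_prop)
  refine le_of_eq_of_le ?_ (h1.trans ?_)
  · congr 1
    refine lintegral_congr_ae (ae_restrict_of_ae ?_)
    filter_upwards [hae] with x hx
    have hx' : 0 < ‖x‖ := norm_pos_iff.2 hx
    rw [← mul_assoc, ← ENNReal.ofReal_mul (by positivity), ← Real.rpow_add hx', neg_add_cancel,
      Real.rpow_zero, ENNReal.ofReal_one, one_mul]
  · refine mul_le_mul' (le_of_eq (lintegral_congr fun x => ?_)) ?_
    · rw [← ENNReal.ofReal_pow (by positivity), ← Real.rpow_natCast,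
        ← Real.rpow_mul (norm_nonneg _)]
      congr 2
      push_cast
      ring
    · refine (setLIntegral_le_lintegral _ _).trans (lintegral_mono_ae ?_)
      filter_upwards [hae] with x hx
      rw [mul_pow]
      refine mul_le_mul' ?_ le_rfl
      rw [← ENNReal.ofReal_pow (by positivity), ← Real.rpow_natCast,
        ← Real.rpow_mul (norm_nonneg _), mul_comm s]
      exact ENNReal.ofReal_le_ofReal (by exact_mod_cast one_add_sq_mul_rpow_le hs hx)

theorem enorm_add_sq_le (z w : ℂ) : ‖z + w‖ₑ ^ 2 ≤ 2 * ‖z‖ₑ ^ 2 + 2 * ‖w‖ₑ ^ 2 := by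
  rw [← ofReal_norm, ← ofReal_norm, ← ofReal_norm, ← ENNReal.ofReal_pow (norm_nonneg _),
    ← ENNReal.ofReal_pow (norm_nonneg _), ← ENNReal.ofReal_pow (norm_nonneg _),
    show (2 : ℝ≥0∞) = ENNReal.ofReal 2 by simp, ← ENNReal.ofReal_mul (by norm_num),
    ← ENNReal.ofReal_mul (by norm_num), ← ENNReal.ofReal_add (by positivity) (by positivity)]
  refine ENNReal.ofReal_le_ofReal ?_
  have := norm_add_le z w
  nlinarith [norm_nonneg (z + w), norm_nonneg z, norm_nonneg w, sq_nonneg (‖z‖ - ‖w‖)]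

/-- The mass of `𝓕 h` in small balls, for `h` in a weighted space. -/
theorem exists_lintegral_ball_fourier_le (hn : 2 ≤ n) (hs : 0 < s) (hs1 : s < 1) :
    ∃ C : ℝ≥0, ∀ (h : Rn n → ℂ), Measurable h → Integrable h → MemLp h 2 → ∀ r : ℝ, 0 < r →
      ∫⁻ ξ in Metric.ball (0 : Rn n) r, ‖𝓕 h ξ‖ₑ ^ 2 ≤
        C * ENNReal.ofReal (r ^ (2 * s)) * wsq s h := by
  set c₀ := ∫ x in Metric.ball (0 : Rn n) 1, ‖x‖ ^ (-(2 * s)) with hc₀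
  set v := volume (Metric.ball (0 : Rn n) 1) with hv
  have hvfin : v ≠ ⊤ := measure_ball_lt_top.ne
  have : Nontrivial (Rn n) := by
    have : Nonempty (Fin n) := ⟨⟨0, by omega⟩⟩
    infer_instance
  refine ⟨2 * v.toNNReal * c₀.toNNReal + 2, fun h hm hi h2 r hr => ?_⟩
  -- Split `h` at the dual radius. The inner part has a bounded transform, and `r^n * (r⁻¹)^(n-2s) =
  -- r^(2s)`; for the outer part Plancherel is enough, since the weight is at least `r^(-2s)` there.
  set B := Metric.ball (0 : Rn n) r⁻¹ with hB
  have hBm : MeasurableSet B := measurableSet_ball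
  set h₁ := B.indicator h with hh₁
  set h₂ := Bᶜ.indicator h with hh₂
  have hadd : h = h₁ + h₂ := (Set.indicator_self_add_compl B h).symm
  have hi₁ : Integrable h₁ := hi.indicator hBm
  have hi₂ : Integrable h₂ := hi.indicator hBm.compl
  have hF : ∀ ξ, 𝓕 h ξ = 𝓕 h₁ ξ + 𝓕 h₂ ξ := by
    intro ξ
    have := VectorFourier.fourierIntegral_add (μ := (volume : Measure (Rn n)))
      (L := innerₗ (Rn n)) Real.continuous_fourierChar continuous_inner hi₁ hi₂
    rw [hadd]
    exact congrFun this ξ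
  have e1 : ∫⁻ ξ in Metric.ball (0 : Rn n) r, ‖𝓕 h₁ ξ‖ₑ ^ 2 ≤
      v * ENNReal.ofReal c₀ * ENNReal.ofReal (r ^ (2 * s)) * wsq s h := by
    have hb : ∀ ξ, ‖𝓕 h₁ ξ‖ₑ ^ 2 ≤ (∫⁻ x in B, ‖h x‖ₑ) ^ 2 := by
      intro ξ
      gcongr
      rw [Real.fourier_eq]
      refine (enorm_integral_le_lintegral_enorm _).trans (le_of_eq ?_)
      rw [← lintegral_indicator hBm]
      refine lintegral_congr fun x => ?_
      rw [← ofReal_norm, Circle.norm_smul, ofReal_norm]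
      by_cases hx : x ∈ B <;> simp [hh₁, hx]
    calc _ ≤ ∫⁻ ξ in Metric.ball (0 : Rn n) r, (∫⁻ x in B, ‖h x‖ₑ) ^ 2 :=
          lintegral_mono fun ξ => hb ξ
      _ = (∫⁻ x in B, ‖h x‖ₑ) ^ 2 * (ENNReal.ofReal (r ^ n) * v) := by
          rw [setLIntegral_const, Measure.addHaar_ball _ _ hr.le, finrank_euclideanSpace_fin]
      _ ≤ (ENNReal.ofReal (r⁻¹ ^ ((n : ℝ) - 2 * s) * c₀) * wsq s h) *
            (ENNReal.ofReal (r ^ n) * v) := by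
          gcongr
          rw [← setLIntegral_norm_rpow_ball hn hs1 (inv_pos.2 hr)]
          exact sq_lintegral_ball_le hs.le hn hm
      _ = v * (ENNReal.ofReal (r⁻¹ ^ ((n : ℝ) - 2 * s) * c₀) * ENNReal.ofReal (r ^ n)) *
            wsq s h := by ring
      _ = _ := by
          rw [mul_assoc v (ENNReal.ofReal c₀), ← ENNReal.ofReal_mul' (by positivity),
            ← ENNReal.ofReal_mul' (by positivity)]
          congr 3
          rw [Real.inv_rpow hr.le, ← Real.rpow_natCast r n, Real.rpow_sub hr]
          have := (Real.rpow_pos_of_pos hr (n : ℝ)).ne'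
          have := (Real.rpow_pos_of_pos hr (2 * s)).ne'
          field_simp
  have e2 : ∫⁻ ξ in Metric.ball (0 : Rn n) r, ‖𝓕 h₂ ξ‖ₑ ^ 2 ≤
      ENNReal.ofReal (r ^ (2 * s)) * wsq s h := by
    refine (setLIntegral_le_lintegral _ _).trans ?_
    rw [lintegral_fourier_sq hi₂ (h2.indicator hBm.compl), wsq,
      ← lintegral_const_mul _ (by fun_prop)]
    refine lintegral_mono fun x => ?_
    by_cases hx : x ∈ B
    · simp [hh₂, hx]
    · rw [hh₂, Set.indicator_of_mem (by simpa using hx), ← mul_assoc]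
      refine le_mul_of_one_le_left' ?_
      have hxr : r⁻¹ ≤ ‖x‖ := by simpa [hB] using hx
      have hx0 : x ≠ 0 := norm_pos_iff.1 ((inv_pos.2 hr).trans_le hxr)
      rw [← ENNReal.ofReal_mul (by positivity), ← ENNReal.ofReal_one]
      refine ENNReal.ofReal_le_ofReal ?_
      calc (1 : ℝ) = r ^ (2 * s) * r⁻¹ ^ (2 * s) := by
            rw [← Real.mul_rpow hr.le (inv_nonneg.2 hr.le), mul_inv_cancel₀ hr.ne', Real.one_rpow]
        _ ≤ r ^ (2 * s) * (1 + ‖x‖ ^ 2) ^ s := by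
            gcongr
            refine le_trans ?_ (one_add_sq_mul_rpow_le hs.le hx0)
            exact Real.rpow_le_rpow (by positivity) hxr (by positivity)
  have hmF : Measurable fun ξ => ‖𝓕 h₁ ξ‖ₑ ^ 2 :=
    (continuous_fourier_of_integrable hi₁).measurable.enorm.pow_const 2
  calc _ ≤ ∫⁻ ξ in Metric.ball (0 : Rn n) r, (2 * ‖𝓕 h₁ ξ‖ₑ ^ 2 + 2 * ‖𝓕 h₂ ξ‖ₑ ^ 2) := by
        refine lintegral_mono fun ξ => ?_
        rw [hF]
        exact enorm_add_sq_le _ _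
    _ = 2 * (∫⁻ ξ in Metric.ball (0 : Rn n) r, ‖𝓕 h₁ ξ‖ₑ ^ 2) +
          2 * ∫⁻ ξ in Metric.ball (0 : Rn n) r, ‖𝓕 h₂ ξ‖ₑ ^ 2 := by
        rw [lintegral_add_left (hmF.const_mul 2), lintegral_const_mul _ hmF, lintegral_const_mul]
        exact (continuous_fourier_of_integrable hi₂).measurable.enorm.pow_const 2
    _ ≤ 2 * (v * ENNReal.ofReal c₀ * ENNReal.ofReal (r ^ (2 * s)) * wsq s h) +
          2 * (ENNReal.ofReal (r ^ (2 * s)) * wsq s h) := by gcongr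
    _ = _ := by
        push_cast
        rw [ENNReal.coe_toNNReal hvfin]
        change _ = (2 * v * ENNReal.ofReal c₀ + 2) * ENNReal.ofReal (r ^ (2 * s)) * wsq s h
        ring

/-- A dyadic majorant: for `2^{-(l+1)} < ‖ξ‖ ≤ 2^{-l}` the term with index `l` suffices. The radius
carries an extra factor `2` because the balls are open. -/
theorem ofReal_inv_min_le {ξ : Rn n} (hξ : ξ ≠ 0) :
    ENNReal.ofReal (1 / min 1 ‖ξ‖) ≤ 1 + ∑' l : ℕ, ENNReal.ofReal (2 ^ (l + 1)) *
      (Metric.ball (0 : Rn n) (2 * (1 / 2) ^ l)).indicator 1 ξ := by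
  have hn : 0 < ‖ξ‖ := norm_pos_iff.2 hξ
  rcases le_or_gt 1 ‖ξ‖ with h1 | h1
  · rw [min_eq_left h1]
    simp
  · rw [min_eq_right h1.le]
    obtain ⟨l, hl1, hl2⟩ := exists_nat_pow_near_of_lt_one hn h1.le (by norm_num : (0 : ℝ) < 1 / 2)
      (by norm_num)
    have hmem : ξ ∈ Metric.ball (0 : Rn n) (2 * (1 / 2) ^ l) := by
      rw [mem_ball_zero_iff]
      have : (0 : ℝ) < (1 / 2) ^ l := by positivity
      linarith
    refine le_trans ?_ (le_trans (ENNReal.le_tsum l) le_add_self)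
    rw [Set.indicator_of_mem hmem, Pi.one_apply, mul_one]
    refine ENNReal.ofReal_le_ofReal ?_
    rw [div_le_iff₀ hn]
    calc (1 : ℝ) = 2 ^ (l + 1) * (1 / 2) ^ (l + 1) := by rw [← mul_pow]; norm_num
      _ ≤ _ := by gcongr

/-- A Hardy type inequality. -/
theorem exists_hardy (hn : 2 ≤ n) (hs : 1 / 2 < s) (hs1 : s < 1) :
    ∃ C : ℝ≥0, ∀ (h : Rn n → ℂ), Measurable h → Integrable h → MemLp h 2 →
      ∫⁻ ξ, ENNReal.ofReal (1 / min 1 ‖ξ‖) * ‖𝓕 h ξ‖ₑ ^ 2 ≤ C * wsq s h := by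
  obtain ⟨C, hC⟩ := exists_lintegral_ball_fourier_le hn (by linarith : 0 < s) hs1
  have : Nontrivial (Rn n) := by
    have : Nonempty (Fin n) := ⟨⟨0, by omega⟩⟩
    infer_instance
  -- The ratio of the dyadic series: `2` from the weight `1/‖ξ‖` and `2^{-2s}` from the mass of the
  -- ball. It is less than `1` precisely because `s > 1/2`.
  set θ : ℝ := 2 * (1 / 2) ^ (2 * s) with hθ
  have hθ0 : 0 < θ := by positivity
  have hθ1 : θ < 1 := by
    have : (1 / 2 : ℝ) ^ (2 * s) < (1 / 2) ^ (1 : ℝ) :=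
      Real.rpow_lt_rpow_of_exponent_gt (by norm_num) (by norm_num) (by linarith)
    rw [Real.rpow_one] at this
    linarith
  set K : ℝ≥0∞ := ∑' l : ℕ, ENNReal.ofReal θ ^ l with hK
  have hKfin : K ≠ ⊤ := by
    rw [hK, ENNReal.tsum_geometric]
    refine ENNReal.inv_ne_top.2 (tsub_pos_of_lt ?_).ne'
    rw [← ENNReal.ofReal_one]
    exact (ENNReal.ofReal_lt_ofReal_iff one_pos).2 hθ1
  set e : ℝ≥0∞ := ENNReal.ofReal (2 * 2 ^ (2 * s)) with he
  have hefin : e ≠ ⊤ := ENNReal.ofReal_ne_top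
  refine ⟨1 + C * e.toNNReal * K.toNNReal, fun h hm hi h2 => ?_⟩
  have hae : ∀ᵐ ξ : Rn n, ξ ≠ 0 := by simp [ae_iff]
  have hF : Measurable fun ξ => ‖𝓕 h ξ‖ₑ ^ 2 :=
    (continuous_fourier_of_integrable hi).measurable.enorm.pow_const 2
  have hw : ∫⁻ ξ, ‖𝓕 h ξ‖ₑ ^ 2 ≤ wsq s h := by
    rw [lintegral_fourier_sq hi h2, wsq]
    refine lintegral_mono fun x => le_mul_of_one_le_left' ?_
    rw [← ENNReal.ofReal_one]
    exact ENNReal.ofReal_le_ofReal (Real.one_le_rpow (by nlinarith [sq_nonneg ‖x‖]) (by linarith))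
  have hterm : ∀ l : ℕ, ∫⁻ ξ, (ENNReal.ofReal (2 ^ (l + 1)) *
      (Metric.ball (0 : Rn n) (2 * (1 / 2) ^ l)).indicator 1 ξ) * ‖𝓕 h ξ‖ₑ ^ 2
      ≤ ENNReal.ofReal θ ^ l * (C * e * wsq s h) := by
    intro l
    have hr : (0 : ℝ) < 2 * (1 / 2) ^ l := by positivity
    calc _ = ENNReal.ofReal (2 ^ (l + 1)) *
          ∫⁻ ξ in Metric.ball (0 : Rn n) (2 * (1 / 2) ^ l), ‖𝓕 h ξ‖ₑ ^ 2 := by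
          rw [← lintegral_indicator measurableSet_ball, ← lintegral_const_mul _
            (hF.indicator measurableSet_ball)]
          refine lintegral_congr fun ξ => ?_
          by_cases hξ : ξ ∈ Metric.ball (0 : Rn n) (2 * (1 / 2) ^ l)
          · rw [Set.indicator_of_mem hξ, Set.indicator_of_mem hξ, Pi.one_apply, mul_one]
          · rw [Set.indicator_of_notMem hξ, Set.indicator_of_notMem hξ, mul_zero, zero_mul]
      _ ≤ ENNReal.ofReal (2 ^ (l + 1)) *
          (C * ENNReal.ofReal ((2 * (1 / 2) ^ l) ^ (2 * s)) * wsq s h) := by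
          gcongr
          exact hC h hm hi h2 _ hr
      _ = (ENNReal.ofReal (2 ^ (l + 1)) * ENNReal.ofReal ((2 * (1 / 2) ^ l) ^ (2 * s))) *
          (C * wsq s h) := by ring
      _ = (ENNReal.ofReal θ ^ l * e) * (C * wsq s h) := by
          congr 1
          rw [← ENNReal.ofReal_pow hθ0.le, ← ENNReal.ofReal_mul (by positivity),
            he, ← ENNReal.ofReal_mul (by positivity), hθ,
            Real.mul_rpow (by norm_num) (by positivity), mul_pow, ← Real.rpow_natCast (1 / 2) l,
            ← Real.rpow_natCast ((1 / 2) ^ (2 * s)) l, ← Real.rpow_mul (by norm_num),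
            ← Real.rpow_mul (by norm_num), mul_comm (l : ℝ)]
          congr 1
          ring
      _ = _ := by ring
  calc _ ≤ ∫⁻ ξ, (‖𝓕 h ξ‖ₑ ^ 2 + ∑' l : ℕ, (ENNReal.ofReal (2 ^ (l + 1)) *
        (Metric.ball (0 : Rn n) (2 * (1 / 2) ^ l)).indicator 1 ξ) * ‖𝓕 h ξ‖ₑ ^ 2) := by
        refine lintegral_mono_ae ?_
        filter_upwards [hae] with ξ hξ
        rw [ENNReal.tsum_mul_right]
        nth_rw 2 [← one_mul (‖𝓕 h ξ‖ₑ ^ 2)]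
        rw [← add_mul]
        gcongr
        exact ofReal_inv_min_le hξ
    _ = (∫⁻ ξ, ‖𝓕 h ξ‖ₑ ^ 2) + ∑' l : ℕ, ∫⁻ ξ, (ENNReal.ofReal (2 ^ (l + 1)) *
        (Metric.ball (0 : Rn n) (2 * (1 / 2) ^ l)).indicator 1 ξ) * ‖𝓕 h ξ‖ₑ ^ 2 := by
        rw [lintegral_add_left hF, lintegral_tsum]
        intro l
        exact (((measurable_one.indicator measurableSet_ball).const_mul _).mul hF).aemeasurable
    _ ≤ wsq s h + ∑' l : ℕ, ENNReal.ofReal θ ^ l * (C * e * wsq s h) :=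
        add_le_add hw (ENNReal.tsum_le_tsum hterm)
    _ = _ := by
        rw [ENNReal.tsum_mul_right]
        push_cast
        rw [ENNReal.coe_toNNReal hefin, ENNReal.coe_toNNReal hKfin]
        ring

end Hardy

/-! ### The sesquilinear form on a single line -/

section Bilinear

variable {k : ℕ} {κ κ₀ C s γ : ℝ}

theorem enorm_le_of_sq_le {x c y : ℝ≥0∞} (h : x ^ 2 ≤ c ^ 2 * y) : x ≤ c * y ^ (1 / 2 : ℝ) := by
  have h1 := ENNReal.rpow_le_rpow h (by norm_num : (0 : ℝ) ≤ 1 / 2)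
  rw [ENNReal.mul_rpow_of_nonneg _ _ (by norm_num), ← ENNReal.rpow_two, ← ENNReal.rpow_two,
    ← ENNReal.rpow_mul, ← ENNReal.rpow_mul] at h1
  norm_num at h1
  simpa using h1

theorem size_insEquiv_pos (j : Fin (k + 1)) {ξ' : Rn k} (h : ξ' ≠ 0) (η : ℝ) :
    0 < size κ₀ (insEquiv j (η, ξ')) := by
  refine lt_of_lt_of_le ?_ (norm_le_size κ₀ _)
  have h1 := norm_sq_insEquiv j η ξ'
  have h2 : 0 < ‖ξ'‖ := norm_pos_iff.2 h
  have h3 := norm_nonneg (insEquiv j (η, ξ'))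
  nlinarith [sq_nonneg η, mul_pos h2 h2]

/-- The one-dimensional estimate on a line in the `j`-th direction. -/
theorem enorm_line_integral_le (j : Fin (k + 1)) {c δ σ lam ε : ℝ} {p χ : Rn (k + 1) → ℝ}
    (hσ : σ = 1 ∨ σ = -1) (hc : 0 < c) (hκ : 0 ≤ κ) (hC : 0 ≤ C) (hδ : 0 < δ) (hδ' : δ ≤ 1 / 4)
    (hγ : 0 < γ) (hγ1 : γ ≤ 1) (hε : ε ≠ 0) {h g : Rn (k + 1) → ℂ} (hm : Measurable h)
    (hi : Integrable h) (gm : Measurable g) (gi : Integrable g) {ξ' : Rn k}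
    (hline : ∃ b' J, IsLineSymbol κ c C δ γ
      (fun t => size κ₀ (insEquiv j (0, ξ') + t • unitVec j))
      (fun t => σ * p (insEquiv j (0, ξ') + t • unitVec j)) b'
      (fun t => χ (insEquiv j (0, ξ') + t • unitVec j) *
        ‖insEquiv j (0, ξ') + t • unitVec j‖ ^ κ) J)
    (hh : traceMaj γ j h ξ' ≠ ⊤) (hg : traceMaj γ j g ξ' ≠ ⊤) :
    ‖∫ η : ℝ, ((χ (insEquiv j (η, ξ')) * ‖insEquiv j (η, ξ')‖ ^ κ : ℝ) : ℂ) *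
        (𝓕 h (insEquiv j (η, ξ')) * (starRingEnd ℂ) (𝓕 g (insEquiv j (η, ξ')))) /
        (((p (insEquiv j (η, ξ')) - lam : ℝ) : ℂ) - Complex.I * ε)‖ₑ ≤
      ENNReal.ofReal (1 / (c * (3 / 4) ^ κ * (3 / 16 * δ)) +
        ((C + 1) / (c * (3 / 4) ^ κ) + C / (c * (3 / 4) ^ κ * c)) * (2 / γ) + Real.pi / c) *
      (ENNReal.ofReal (2 * (2 * Real.pi) ^ 2) * (traceMaj γ j h ξ' * traceMaj γ j g ξ') +
        ∫⁻ η : ℝ, ENNReal.ofReal (1 / min 1 (size κ₀ (insEquiv j (η, ξ')))) *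
          (‖𝓕 h (insEquiv j (η, ξ'))‖ₑ * ‖𝓕 g (insEquiv j (η, ξ'))‖ₑ)) := by
  obtain ⟨b', J, hL⟩ := hline
  have hins : ∀ t : ℝ, insEquiv j (0, ξ') + t • unitVec j = insEquiv j (t, ξ') := fun t =>
    (insEquiv_eq_add j t ξ').symm
  simp only [hins] at hL
  set K := 1 / (c * (3 / 4) ^ κ * (3 / 16 * δ)) +
        ((C + 1) / (c * (3 / 4) ^ κ) + C / (c * (3 / 4) ^ κ * c)) * (2 / γ) + Real.pi / c with hK
  have hK0 : 0 < K := by have := Real.pi_pos; positivity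
  obtain ⟨h1, h2⟩ := trace_bounds hγ.le hγ1 j hm hi hh
  obtain ⟨g1, g2⟩ := trace_bounds hγ.le hγ1 j gm gi hg
  set Th := traceMaj γ j h ξ'
  set Tg := traceMaj γ j g ξ'
  set F : ℝ → ℂ := fun η => 𝓕 h (insEquiv j (η, ξ')) * (starRingEnd ℂ) (𝓕 g (insEquiv j (η, ξ')))
    with hF
  have hπ := Real.pi_pos
  -- The factor `2` comes from the two terms in the Hölder estimate of a product.
  set A := 2 * (2 * Real.pi) ^ 2 * (Th.toReal * Tg.toReal) with hA
  have hT0 : 0 ≤ Th.toReal * Tg.toReal := by positivity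
  have hFA : ∀ η, ‖F η‖ ≤ A := by
    intro η
    rw [hF]
    simp only [norm_mul, RCLike.norm_conj]
    calc _ ≤ (2 * Real.pi * Th.toReal) * (2 * Real.pi * Tg.toReal) := by
          gcongr
          · exact h1 η
          · exact g1 η
      _ ≤ A := by rw [hA]; nlinarith [mul_nonneg (sq_nonneg (2 * Real.pi)) hT0]
  have hFH : ∀ η η', ‖F η - F η'‖ ≤ A * |η - η'| ^ γ := by
    intro η η'
    have e : F η - F η' = (𝓕 h (insEquiv j (η, ξ')) - 𝓕 h (insEquiv j (η', ξ'))) *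
          (starRingEnd ℂ) (𝓕 g (insEquiv j (η, ξ'))) + 𝓕 h (insEquiv j (η', ξ')) *
          (starRingEnd ℂ) (𝓕 g (insEquiv j (η, ξ')) - 𝓕 g (insEquiv j (η', ξ'))) := by
      rw [hF, map_sub]; ring
    rw [e]
    refine (norm_add_le _ _).trans ?_
    rw [norm_mul, norm_mul, RCLike.norm_conj, RCLike.norm_conj]
    calc _ ≤ (2 * Real.pi * Th.toReal * |η - η'| ^ γ) * (2 * Real.pi * Tg.toReal) +
          (2 * Real.pi * Th.toReal) * (2 * Real.pi * Tg.toReal * |η - η'| ^ γ) := by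
          gcongr
          · exact h2 η η'
          · exact g1 η
          · exact h1 η'
          · exact g2 η η'
      _ = _ := by rw [hA]; ring
  have hinsm : Measurable fun η : ℝ => insEquiv j (η, ξ') :=
    (insEquiv j).measurable.comp (by fun_prop)
  have hFh : Measurable fun η : ℝ => 𝓕 h (insEquiv j (η, ξ')) :=
    (continuous_fourier_of_integrable hi).measurable.comp hinsm
  have hFg : Measurable fun η : ℝ => 𝓕 g (insEquiv j (η, ξ')) :=
    (continuous_fourier_of_integrable gi).measurable.comp hinsm
  have hFm : Measurable F := hFh.mul (Complex.continuous_conj.measurable.comp hFg)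
  have hPm : Measurable fun η : ℝ => size κ₀ (insEquiv j (η, ξ')) :=
    (continuous_size κ₀).measurable.comp hinsm
  have hpos : ∀ η : ℝ, 0 < min 1 (size κ₀ (insEquiv j (η, ξ'))) := fun η =>
    lt_min one_pos (hL.size_pos η)
  have hlint : ∫⁻ η : ℝ, ENNReal.ofReal (1 / min 1 (size κ₀ (insEquiv j (η, ξ')))) *
      (‖𝓕 h (insEquiv j (η, ξ'))‖ₑ * ‖𝓕 g (insEquiv j (η, ξ'))‖ₑ)
      = ∫⁻ η : ℝ, ENNReal.ofReal (‖F η‖ / min 1 (size κ₀ (insEquiv j (η, ξ')))) := by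
    refine lintegral_congr fun η => ?_
    rw [← ofReal_norm, ← ofReal_norm, ← ENNReal.ofReal_mul (norm_nonneg _),
      ← ENNReal.ofReal_mul (by have := hpos η; positivity)]
    congr 1
    rw [hF]
    simp only [norm_mul, RCLike.norm_conj]
    ring
  rw [hlint]
  -- If this integral diverges the right-hand side is infinite, since `K > 0`.
  by_cases hfin : ∫⁻ η : ℝ, ENNReal.ofReal (‖F η‖ / min 1 (size κ₀ (insEquiv j (η, ξ')))) = ⊤
  · rw [hfin, add_top, ENNReal.mul_top (by simpa using hK0)]
    exact le_top
  have hFi : Integrable fun η => ‖F η‖ / min 1 (size κ₀ (insEquiv j (η, ξ'))) := by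
    refine ⟨(hFm.norm.div (measurable_const.min hPm)).aestronglyMeasurable, ?_⟩
    rw [hasFiniteIntegral_iff_ofReal (ae_of_all _ fun η => div_nonneg (norm_nonneg _) (hpos η).le)]
    exact lt_top_iff_ne_top.2 hfin
  have hσε : σ * ε ≠ 0 := by rcases hσ with rfl | rfl <;> simpa using hε
  have key := hL.norm_integral_le hc hκ hC hδ hδ' hγ hγ1 (σ * lam) hσε hFA hFH hFm hFi
  have hσn : ‖(σ : ℂ)‖ = 1 := by rcases hσ with rfl | rfl <;> simp
  have hσ2 : (σ : ℂ) * σ = 1 := by rcases hσ with rfl | rfl <;> simp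
  have hσ0 : (σ : ℂ) ≠ 0 := fun h0 => by rw [h0] at hσn; simp at hσn
  -- A decreasing symbol is made increasing by multiplying the denominator by `σ = -1`. This also
  -- changes the signs of `lam` and `ε`, which is harmless as the line estimate allows either sign
  -- of both.
  have hint : ∫ η : ℝ, ((χ (insEquiv j (η, ξ')) * ‖insEquiv j (η, ξ')‖ ^ κ : ℝ) : ℂ) * F η /
        (((p (insEquiv j (η, ξ')) - lam : ℝ) : ℂ) - Complex.I * ε)
      = σ * ∫ η : ℝ, ((χ (insEquiv j (η, ξ')) * ‖insEquiv j (η, ξ')‖ ^ κ : ℝ) : ℂ) * F η /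
        (((σ * p (insEquiv j (η, ξ')) - σ * lam : ℝ) : ℂ) - Complex.I * ((σ * ε : ℝ) : ℂ)) := by
    rw [← integral_const_mul]
    refine integral_congr_ae (ae_of_all _ fun η => ?_)
    have e : (((σ * p (insEquiv j (η, ξ')) - σ * lam : ℝ) : ℂ) - Complex.I * ((σ * ε : ℝ) : ℂ))
        = σ * (((p (insEquiv j (η, ξ')) - lam : ℝ) : ℂ) - Complex.I * ε) := by
      push_cast; ring
    simp only [e]
    rw [← mul_div_assoc, mul_div_mul_left _ _ hσ0]
  rw [hint, ← ofReal_norm, norm_mul, hσn, one_mul]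
  refine (ENNReal.ofReal_le_ofReal key).trans ?_
  rw [ENNReal.ofReal_mul hK0.le, ENNReal.ofReal_add (by positivity)
    (integral_nonneg fun η => div_nonneg (norm_nonneg _) (hpos η).le),
    ofReal_integral_eq_lintegral_ofReal hFi
      (ae_of_all _ fun η => div_nonneg (norm_nonneg _) (hpos η).le), hA,
    ENNReal.ofReal_mul (by positivity), ENNReal.ofReal_mul ENNReal.toReal_nonneg,
    ENNReal.ofReal_toReal hh, ENNReal.ofReal_toReal hg]

end Bilinear

/-! ### Integration over parallel lines and summation over the partition -/

section BilinearGlobal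

variable {k : ℕ} {κ κ₀ C s γ : ℝ}

theorem enorm_integral_insEquiv_le (j : Fin (k + 1)) (F : Rn (k + 1) → ℂ) :
    ‖∫ ξ, F ξ‖ₑ ≤ ∫⁻ ξ', ‖∫ η : ℝ, F (insEquiv j (η, ξ'))‖ₑ := by
  by_cases hF : Integrable F
  · have hF' : Integrable (fun q : ℝ × Rn k => F (insEquiv j q)) (volume.prod volume) := by
      rw [← Measure.volume_eq_prod]
      exact (measurePreserving_insEquiv j).integrable_comp_emb
        (insEquiv j).measurableEmbedding |>.2 hF
    rw [← (measurePreserving_insEquiv j).integral_comp' (g := F), Measure.volume_eq_prod,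
      integral_prod_symm _ hF']
    exact enorm_integral_le_lintegral_enorm _
  · rw [integral_undef hF]; simp

theorem lintegral_mul_mul_le {α : Type*} [MeasurableSpace α] {μ : Measure α} {w f g : α → ℝ≥0∞}
    (hw : AEMeasurable w μ) (hf : AEMeasurable f μ) (hg : AEMeasurable g μ) :
    (∫⁻ x, w x * (f x * g x) ∂μ) ^ 2 ≤ (∫⁻ x, w x * f x ^ 2 ∂μ) * ∫⁻ x, w x * g x ^ 2 ∂μ := by
  have h0 : ∀ x, w x = (w x ^ (1 / 2 : ℝ)) ^ 2 := fun x => by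
    rw [← ENNReal.rpow_two, ← ENNReal.rpow_mul]; norm_num
  have h := lintegral_mul_sq_le ((hw.pow_const (1 / 2 : ℝ)).mul hf)
    ((hw.pow_const (1 / 2 : ℝ)).mul hg)
  simp only [Pi.mul_apply, mul_pow, ← h0] at h
  refine le_trans (le_of_eq ?_) h
  congr 1
  refine lintegral_congr fun x => ?_
  conv_lhs => rw [h0 x]
  ring

theorem lintegral_traceMaj_mul_le {s γ : ℝ} (hs : 0 ≤ s) (j : Fin (k + 1))
    {h g : Rn (k + 1) → ℂ} (hm : Measurable h) (hi : Integrable h) (h2 : MemLp h 2)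
    (gm : Measurable g) (gi : Integrable g) (g2 : MemLp g 2) :
    ∫⁻ ξ', traceMaj γ j h ξ' * traceMaj γ j g ξ' ≤
      (∫⁻ x : ℝ, ENNReal.ofReal ((1 + x ^ 2) ^ (γ - s))) *
        (wsq s h * wsq s g) ^ (1 / 2 : ℝ) := by
  refine enorm_le_of_sq_le ((lintegral_mul_sq_le (measurable_traceMaj γ j hm).aemeasurable
    (measurable_traceMaj γ j gm).aemeasurable).trans ?_)
  refine (mul_le_mul' (lintegral_traceMaj_sq_le hs j hm hi h2)
    (lintegral_traceMaj_sq_le hs j gm gi g2)).trans (le_of_eq ?_)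
  ring

theorem ae_traceMaj_ne_top (hs : 0 ≤ s) (hγ : γ - s < -(1 / 2)) (j : Fin (k + 1))
    {h : Rn (k + 1) → ℂ} (hm : Measurable h) (hi : Integrable h) (h2 : MemLp h 2)
    (hw : wsq s h ≠ ⊤) : ∀ᵐ ξ', traceMaj γ j h ξ' ≠ ⊤ := by
  have h1 : ∫⁻ ξ', traceMaj γ j h ξ' ^ 2 ≠ ⊤ :=
    ne_top_of_le_ne_top (ENNReal.mul_ne_top (lintegral_one_add_sq_rpow_lt_top hγ).ne hw)
      (lintegral_traceMaj_sq_le hs j hm hi h2)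
  filter_upwards [ae_lt_top ((measurable_traceMaj γ j hm).pow_const 2) h1] with ξ' hξ' h0
  rw [h0] at hξ'
  simp at hξ'

/-- The bilinear form of the weighted resolvent is bounded uniformly in the spectral parameter. -/
theorem IsDispersive.exists_bilinear {p : Rn (k + 2) → ℝ} {D : Fin (k + 2) → Rn (k + 2) → ℝ}
    {G : Fin (k + 2) → Ext (k + 2) → ℝ} (hp : IsDispersive κ κ₀ C p D G) (hκ : 0 ≤ κ)
    (hC : 0 ≤ C) (hs : 1 / 2 < s) (hs1 : s < 1) :
    ∃ K : ℝ≥0, ∀ h g : Rn (k + 2) → ℂ, Measurable h → Integrable h → MemLp h 2 →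
      wsq s h ≠ ⊤ → Measurable g → Integrable g → MemLp g 2 → wsq s g ≠ ⊤ →
      ∀ lam ε : ℝ, ε ≠ 0 →
      ‖∫ ξ, ((‖ξ‖ ^ κ : ℝ) : ℂ) * (𝓕 h ξ * (starRingEnd ℂ) (𝓕 g ξ)) /
        (((p ξ - lam : ℝ) : ℂ) - Complex.I * ε)‖ₑ ≤ K * (wsq s h * wsq s g) ^ (1 / 2 : ℝ) := by
  -- The Hölder exponent must lie below `s - 1/2` for the traces, and not exceed `κ` (unless `κ =
  -- 0`) for the amplitude `‖ξ‖^κ`.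
  obtain ⟨γ, hγ0, hγ1, hγs, hγκ⟩ : ∃ γ : ℝ, 0 < γ ∧ γ ≤ 1 ∧ γ - s < -(1 / 2) ∧
      (κ = 0 ∨ γ ≤ κ) := by
    rcases hκ.eq_or_lt with h0 | h0
    · exact ⟨(s - 1 / 2) / 2, by linarith, by linarith, by linarith, Or.inl h0.symm⟩
    · exact ⟨min κ ((s - 1 / 2) / 2), lt_min h0 (by linarith),
        (min_le_right _ _).trans (by linarith),
        by have := min_le_right κ ((s - 1 / 2) / 2); linarith, Or.inr (min_le_left _ _)⟩
  obtain ⟨N, j, σ, χ, c, C', δ, hc, hC', hδ, hδ', hA⟩ :=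
    hp.exists_isAdapted hκ hC hγ0 hγ1 hγκ
  obtain ⟨CH, hH⟩ := exists_hardy (n := k + 2) (by omega) hs hs1
  have hs0 : 0 ≤ s := by linarith
  set K₀ : ℝ≥0∞ := ENNReal.ofReal (1 / (c * (3 / 4) ^ κ * (3 / 16 * δ)) +
        ((C' + 1) / (c * (3 / 4) ^ κ) + C' / (c * (3 / 4) ^ κ * c)) * (2 / γ) + Real.pi / c) with hK₀
  set A : ℝ≥0∞ := ∫⁻ x : ℝ, ENNReal.ofReal ((1 + x ^ 2) ^ (γ - s)) with hAdef
  have hAtop : A ≠ ⊤ := (lintegral_one_add_sq_rpow_lt_top hγs).ne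
  set K₁ : ℝ≥0∞ := N * (K₀ * (ENNReal.ofReal (2 * (2 * Real.pi) ^ 2) * A + CH)) with hK₁
  have hK₁top : K₁ ≠ ⊤ := by
    refine ENNReal.mul_ne_top (ENNReal.natCast_ne_top _) (ENNReal.mul_ne_top ENNReal.ofReal_ne_top
      (ENNReal.add_ne_top.2 ⟨ENNReal.mul_ne_top ENNReal.ofReal_ne_top hAtop,
        ENNReal.coe_ne_top⟩))
  refine ⟨K₁.toNNReal, fun h g hm hi h2 hw gm gi g2 gw lam ε hε => ?_⟩
  rw [ENNReal.coe_toNNReal hK₁top]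
  set F : Rn (k + 2) → ℂ := fun ξ => ((‖ξ‖ ^ κ : ℝ) : ℂ) *
    (𝓕 h ξ * (starRingEnd ℂ) (𝓕 g ξ)) / (((p ξ - lam : ℝ) : ℂ) - Complex.I * ε) with hF
  by_cases hFi : Integrable F
  swap
  · rw [integral_undef hFi]; simp
  set W := (wsq s h * wsq s g) ^ (1 / 2 : ℝ) with hW
  have hFh : Measurable (𝓕 h) := (continuous_fourier_of_integrable hi).measurable
  have hFg : Measurable (𝓕 g) := (continuous_fourier_of_integrable gi).measurable
  have hHmeas : Measurable fun ξ : Rn (k + 2) => ENNReal.ofReal (1 / min 1 (size κ₀ ξ)) *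
      (‖𝓕 h ξ‖ₑ * ‖𝓕 g ξ‖ₑ) := by
    have := (continuous_size (n := k + 2) κ₀).measurable
    fun_prop
  have hHardy : ∫⁻ ξ : Rn (k + 2), ENNReal.ofReal (1 / min 1 (size κ₀ ξ)) *
      (‖𝓕 h ξ‖ₑ * ‖𝓕 g ξ‖ₑ) ≤ CH * W := by
    have h1 : ∫⁻ ξ : Rn (k + 2), ENNReal.ofReal (1 / min 1 (size κ₀ ξ)) *
        (‖𝓕 h ξ‖ₑ * ‖𝓕 g ξ‖ₑ) ≤ ∫⁻ ξ : Rn (k + 2), ENNReal.ofReal (1 / min 1 ‖ξ‖) *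
        (‖𝓕 h ξ‖ₑ * ‖𝓕 g ξ‖ₑ) := by
      refine lintegral_mono_ae ?_
      filter_upwards [Measure.ae_ne volume (0 : Rn (k + 2))] with ξ hξ
      have h0 : 0 < ‖ξ‖ := norm_pos_iff.2 hξ
      have := norm_le_size κ₀ ξ
      gcongr
    refine h1.trans (enorm_le_of_sq_le ((lintegral_mul_mul_le (by fun_prop)
      hFh.enorm.aemeasurable hFg.enorm.aemeasurable).trans ?_))
    refine (mul_le_mul' (hH h hm hi h2) (hH g gm gi g2)).trans (le_of_eq ?_)
    ring
  have hpiece : ∀ i, ‖∫ ξ, (χ i ξ : ℂ) * F ξ‖ₑ ≤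
      K₀ * (ENNReal.ofReal (2 * (2 * Real.pi) ^ 2) * A + CH) * W := by
    intro i
    refine (enorm_integral_insEquiv_le (j i) _).trans ?_
    have hb : ∀ᵐ ξ' : Rn (k + 1), ‖∫ η : ℝ, (χ i (insEquiv (j i) (η, ξ')) : ℂ) *
        F (insEquiv (j i) (η, ξ'))‖ₑ ≤ K₀ * (ENNReal.ofReal (2 * (2 * Real.pi) ^ 2) *
        (traceMaj γ (j i) h ξ' * traceMaj γ (j i) g ξ') +
        ∫⁻ η : ℝ, ENNReal.ofReal (1 / min 1 (size κ₀ (insEquiv (j i) (η, ξ')))) *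
          (‖𝓕 h (insEquiv (j i) (η, ξ'))‖ₑ * ‖𝓕 g (insEquiv (j i) (η, ξ'))‖ₑ)) := by
      -- Almost every line misses the origin, as the transversal space has positive dimension, and
      -- has finite trace majorants.
      filter_upwards [Measure.ae_ne volume (0 : Rn (k + 1)),
        ae_traceMaj_ne_top hs0 hγs (j i) hm hi h2 hw,
        ae_traceMaj_ne_top hs0 hγs (j i) gm gi g2 gw] with ξ' h0 hh hg
      have hline := hA.isLineSymbol i (insEquiv (j i) (0, ξ')) (fun t => by
        rw [← insEquiv_eq_add]; exact size_insEquiv_pos _ h0 t)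
      refine le_of_eq_of_le ?_ (enorm_line_integral_le (lam := lam) (j i) (hA.sign i) hc hκ hC' hδ
        hδ' hγ0 hγ1 hε hm hi gm gi hline hh hg)
      congr 1
      refine integral_congr_ae (ae_of_all _ fun η => ?_)
      simp only [hF]
      push_cast
      ring
    refine (lintegral_mono_ae hb).trans ?_
    have hK₀top : K₀ ≠ ⊤ := ENNReal.ofReal_ne_top
    have hTm : Measurable fun ξ' => ENNReal.ofReal (2 * (2 * Real.pi) ^ 2) *
        (traceMaj γ (j i) h ξ' * traceMaj γ (j i) g ξ') :=
      ((measurable_traceMaj γ (j i) hm).mul (measurable_traceMaj γ (j i) gm)).const_mul _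
    rw [lintegral_const_mul' _ _ hK₀top, lintegral_add_left hTm,
      lintegral_const_mul' _ _ ENNReal.ofReal_ne_top, ← lintegral_insEquiv (j i) hHmeas, mul_assoc,
      add_mul, mul_assoc (ENNReal.ofReal _) A W]
    gcongr
    exact lintegral_traceMaj_mul_le hs0 (j i) hm hi h2 gm gi g2
  have hsum : ∫ ξ, F ξ = ∑ i, ∫ ξ, (χ i ξ : ℂ) * F ξ := by
    rw [← integral_finsetSum]
    · refine integral_congr_ae ?_
      filter_upwards [Measure.ae_ne volume (0 : Rn (k + 2))] with ξ hξ
      rw [← Finset.sum_mul, ← Complex.ofReal_sum, hA.sum_eq_one ξ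
        ((norm_pos_iff.2 hξ).trans_le (norm_le_size _ _)), Complex.ofReal_one, one_mul]
    · intro i _
      refine hFi.bdd_mul (c := 1)
        (Complex.measurable_ofReal.comp (hA.measurable i)).aestronglyMeasurable (ae_of_all _ fun ξ => ?_)
      simp only [Complex.norm_real, Real.norm_eq_abs,
        abs_of_nonneg (hA.nonneg i ξ)]
      exact hA.le_one i ξ
  rw [hsum]
  refine (enorm_sum_le _ _).trans ?_
  refine (Finset.sum_le_sum fun i _ => hpiece i).trans ?_
  rw [Finset.sum_const, Finset.card_univ, Fintype.card_fin, nsmul_eq_mul, hK₁]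
  exact le_of_eq (by ring)

end BilinearGlobal

/-! ### From the sesquilinear form to the weighted resolvent estimate -/

section Resolvent

variable {V : Type*} [NormedAddCommGroup V] [InnerProductSpace ℝ V] [FiniteDimensional ℝ V]
  [MeasurableSpace V] [BorelSpace V]

theorem conj_fourier (g : V → ℂ) (ξ : V) :
    (starRingEnd ℂ) (𝓕 g ξ) = 𝓕⁻ (fun x => (starRingEnd ℂ) (g x)) ξ := by
  rw [Real.fourier_eq, Real.fourierInv_eq, ← integral_conj]
  refine integral_congr_ae (ae_of_all _ fun x => ?_)
  simp only [Circle.smul_def, smul_eq_mul, map_mul, ← Circle.coe_inv_eq_conj, AddChar.map_neg_eq_inv,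
    inv_inv]

theorem integral_mul_fourierInv {f g : V → ℂ} (hf : Integrable f) (hg : Integrable g) :
    ∫ x, f x * 𝓕⁻ g x = ∫ ξ, 𝓕⁻ f ξ * g ξ := by
  simp_rw [fourierInv_apply_eq]
  rw [← integral_neg_eq_self (fun x => f x * 𝓕 g (-x)) volume]
  simp only [neg_neg]
  rw [← integral_fourier_mul hf.comp_neg hg]
  refine integral_congr_ae (ae_of_all _ fun x => ?_)
  simp only
  congr 1
  rw [← fourierInv_apply_eq, Real.fourier_eq, Real.fourierInv_eq,
    ← integral_neg_eq_self _ volume]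
  simp

theorem continuous_fourierInv_of_integrable {f : V → ℂ} (hf : Integrable f) :
    Continuous (𝓕⁻ f) := by
  have h : 𝓕⁻ f = fun x => 𝓕 f (-x) := funext (fourierInv_apply_eq f)
  rw [h]
  exact (continuous_fourier_of_integrable hf).comp continuous_neg

theorem norm_fourierInv_le {f : V → ℂ} (x : V) : ‖𝓕⁻ f x‖ ≤ ∫ ξ, ‖f ξ‖ := by
  rw [fourierInv_apply_eq]; exact norm_fourier_le _

variable {n : ℕ} {s : ℝ}

/-- A bound for the sesquilinear form of `q (p - lam - iε)⁻¹` in weighted spaces, uniform in the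
spectral parameter. -/
def ResolventBound (q p : Rn n → ℝ) (s : ℝ) (K : ℝ≥0) : Prop :=
  ∀ h g : Rn n → ℂ, Measurable h → Integrable h → MemLp h 2 → wsq s h ≠ ⊤ →
    Measurable g → Integrable g → MemLp g 2 → wsq s g ≠ ⊤ → ∀ lam ε : ℝ, ε ≠ 0 →
      ‖∫ ξ, (q ξ : ℂ) * (𝓕 h ξ * (starRingEnd ℂ) (𝓕 g ξ)) /
        (((p ξ - lam : ℝ) : ℂ) - Complex.I * ε)‖ₑ ≤ K * (wsq s h * wsq s g) ^ (1 / 2 : ℝ)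

/-- Negating `p` amounts to negating `lam` and `ε`, and the bound covers both signs. This serves
negative times. -/
theorem ResolventBound.neg {q p : Rn n → ℝ} {K : ℝ≥0} (hb : ResolventBound q p s K) :
    ResolventBound q (fun ξ => - p ξ) s K := by
  intro h g hm hi h2 hw gm gi g2 gw lam ε hε
  refine le_of_eq_of_le ?_ (hb h g hm hi h2 hw gm gi g2 gw (-lam) (-ε) (neg_ne_zero.2 hε))
  rw [← enorm_neg, ← integral_neg]
  congr 1
  refine integral_congr_ae (ae_of_all _ fun ξ => ?_)
  have e : (((-p ξ - lam : ℝ) : ℂ) - Complex.I * ε)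
      = -(((p ξ - -lam : ℝ) : ℂ) - Complex.I * ((-ε : ℝ) : ℂ)) := by push_cast; ring
  simp only
  rw [e, div_neg, neg_neg]

theorem ofReal_weight_mul (a b : ℝ) (x : Rn n) :
    ENNReal.ofReal ((1 + ‖x‖ ^ 2) ^ a) * ENNReal.ofReal ((1 + ‖x‖ ^ 2) ^ b)
      = ENNReal.ofReal ((1 + ‖x‖ ^ 2) ^ (a + b)) := by
  rw [← ENNReal.ofReal_mul (by positivity), Real.rpow_add (by positivity)]

theorem measurable_weight (a : ℝ) : Measurable fun x : Rn n => (1 + ‖x‖ ^ 2) ^ a := by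
  fun_prop

theorem integrable_div_sub_I_mul {p : Rn n → ℝ} (hp : Measurable p) {Q : Rn n → ℂ}
    (hQ : Integrable Q) (lam : ℝ) {ε : ℝ} (hε : ε ≠ 0) :
    Integrable fun ξ => Q ξ / (((p ξ - lam : ℝ) : ℂ) - Complex.I * ε) := by
  have hden : Measurable fun ξ => (((p ξ - lam : ℝ) : ℂ) - Complex.I * ε)⁻¹ := by fun_prop
  have := hQ.bdd_mul (c := |ε|⁻¹) hden.aestronglyMeasurable (ae_of_all _ fun ξ => by
    rw [norm_inv]
    exact inv_anti₀ (abs_pos.2 hε) (IsLineSymbol.abs_le_norm_sub_I_mul' _ _))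
  refine this.congr (ae_of_all _ fun ξ => ?_)
  simp only
  rw [div_eq_inv_mul]

/-- The weighted resolvent estimate. -/
theorem ResolventBound.wsq_fourierInv_le {q p : Rn n → ℝ} {K : ℝ≥0}
    (hb : ResolventBound q p s K) (hp : Measurable p) (hs : 0 ≤ s) {h : Rn n → ℂ}
    (hm : Measurable h) (hi : Integrable h) (h2 : MemLp h 2) (hw : wsq s h ≠ ⊤)
    (hq : Integrable fun ξ => (q ξ : ℂ) * 𝓕 h ξ) (lam : ℝ) {ε : ℝ} (hε : ε ≠ 0) :
    wsq (-s) (𝓕⁻ fun ξ => (q ξ : ℂ) * 𝓕 h ξ / (((p ξ - lam : ℝ) : ℂ) - Complex.I * ε)) ≤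
      K ^ 2 * wsq s h := by
  set μ : Rn n → ℂ := fun ξ => (q ξ : ℂ) * 𝓕 h ξ / (((p ξ - lam : ℝ) : ℂ) - Complex.I * ε) with hμ
  have hμi : Integrable μ := integrable_div_sub_I_mul hp hq lam hε
  set w := 𝓕⁻ μ with hwdef
  have hwc : Continuous w := continuous_fourierInv_of_integrable hμi
  set M := ∫ ξ, ‖μ ξ‖ with hM
  have hwM : ∀ x, ‖w x‖ ≤ M := norm_fourierInv_le
  have hM0 : 0 ≤ M := integral_nonneg fun _ => norm_nonneg _
  have hball : ∀ R : ℕ, ∫⁻ x in Metric.ball (0 : Rn n) R,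
      ENNReal.ofReal ((1 + ‖x‖ ^ 2) ^ (-s)) * ‖w x‖ₑ ^ 2 ≤ K ^ 2 * wsq s h := by
    intro R
    set B := Metric.ball (0 : Rn n) R with hB
    have hBm : MeasurableSet B := measurableSet_ball
    -- The dual test function: both `wsq s g` and the form at `(h, g)` equal `I`, so the bound reads
    -- `I ≤ K (wsq s h * I)^(1/2)`. Truncation to a ball makes `I` finite, so that one factor can be
    -- cancelled.
    set g : Rn n → ℂ := B.indicator fun x => (((1 + ‖x‖ ^ 2) ^ (-s) : ℝ) : ℂ) * w x with hg
    have hw1 : ∀ x : Rn n, (1 + ‖x‖ ^ 2) ^ (-s) ≤ 1 := fun x =>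
      Real.rpow_le_one_of_one_le_of_nonpos (by nlinarith [sq_nonneg ‖x‖]) (by linarith)
    have hg0m : Measurable fun x : Rn n => (((1 + ‖x‖ ^ 2) ^ (-s) : ℝ) : ℂ) * w x := by
      have := hwc.measurable
      have := measurable_weight (n := n) (-s)
      fun_prop
    have hgm : Measurable g := hg0m.indicator hBm
    have hfin : IsFiniteMeasure (volume.restrict B) :=
      ⟨by rw [Measure.restrict_apply_univ]; exact measure_ball_lt_top⟩
    have hgp : ∀ p : ℝ≥0∞, MemLp g p := fun p => by
      rw [hg, memLp_indicator_iff_restrict hBm]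
      refine MemLp.of_bound hg0m.aestronglyMeasurable M (ae_of_all _ fun x => ?_)
      rw [norm_mul, Complex.norm_real, Real.norm_eq_abs, abs_of_nonneg (by positivity)]
      calc _ ≤ 1 * M := by
            gcongr
            · exact hw1 x
            · exact hwM x
        _ = M := one_mul _
    have gi : Integrable g := memLp_one_iff_integrable.1 (hgp 1)
    set I := ∫⁻ x in B, ENNReal.ofReal ((1 + ‖x‖ ^ 2) ^ (-s)) * ‖w x‖ₑ ^ 2 with hI
    have hItop : I ≠ ⊤ := by
      refine ne_top_of_le_ne_top (b := ∫⁻ x in B, ENNReal.ofReal (M ^ 2)) ?_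
        (lintegral_mono fun x => ?_)
      · rw [lintegral_const]
        exact ENNReal.mul_ne_top ENNReal.ofReal_ne_top (measure_ne_top _ _)
      · rw [← ofReal_norm, ← ENNReal.ofReal_pow (norm_nonneg _), ← ENNReal.ofReal_mul (by positivity)]
        refine ENNReal.ofReal_le_ofReal ?_
        calc _ ≤ 1 * M ^ 2 := by
              gcongr
              · exact hw1 x
              · exact hwM x
          _ = _ := one_mul _
    have hwg : wsq s g = I := by
      rw [wsq, hI, ← lintegral_indicator hBm]
      refine lintegral_congr fun x => ?_
      by_cases hx : x ∈ B
      · rw [Set.indicator_of_mem hx, hg, Set.indicator_of_mem hx, enorm_mul, mul_pow,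
          ← ofReal_norm (((1 + ‖x‖ ^ 2) ^ (-s) : ℝ) : ℂ), Complex.norm_real, Real.norm_eq_abs,
          abs_of_nonneg (by positivity), pow_two (ENNReal.ofReal _), ← mul_assoc, ← mul_assoc,
          ofReal_weight_mul, ofReal_weight_mul]
        congr 3
        ring
      · rw [Set.indicator_of_notMem hx, hg, Set.indicator_of_notMem hx]; simp
    have hint : ∫ ξ, (q ξ : ℂ) * (𝓕 h ξ * (starRingEnd ℂ) (𝓕 g ξ)) /
        (((p ξ - lam : ℝ) : ℂ) - Complex.I * ε) = ((I.toReal : ℝ) : ℂ) := by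
      have h1 := integral_mul_fourierInv (Complex.conjLIE.integrable_comp_iff.2 gi) hμi
      have h2 : ∫ ξ, (q ξ : ℂ) * (𝓕 h ξ * (starRingEnd ℂ) (𝓕 g ξ)) /
        (((p ξ - lam : ℝ) : ℂ) - Complex.I * ε) = ∫ ξ, 𝓕⁻ (fun x => Complex.conjLIE (g x)) ξ * μ ξ := by
        refine integral_congr_ae (ae_of_all _ fun ξ => ?_)
        simp only [Complex.conjLIE_apply]
        rw [← conj_fourier, hμ]
        ring
      rw [h2, ← h1, hI, ← integral_toReal, ← integral_complex_ofReal, ← integral_indicator hBm]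
      · refine integral_congr_ae (ae_of_all _ fun x => ?_)
        simp only [Complex.conjLIE_apply]
        by_cases hx : x ∈ B
        · rw [Set.indicator_of_mem hx, hg, Set.indicator_of_mem hx, map_mul, Complex.conj_ofReal,
            mul_assoc, Complex.conj_mul', ENNReal.toReal_mul, ENNReal.toReal_ofReal (by positivity),
            ENNReal.toReal_pow, toReal_enorm]
          push_cast
          ring
        · rw [Set.indicator_of_notMem hx, hg, Set.indicator_of_notMem hx]; simp
      · have := hwc.measurable
        have := measurable_weight (n := n) (-s)
        fun_prop
      · exact ae_of_all _ fun x => ENNReal.mul_lt_top ENNReal.ofReal_lt_top (by simp)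
    have key := hb h g hm hi h2 hw hgm gi (hgp 2) (by rw [hwg]; exact hItop) lam ε hε
    rw [hint, hwg, ← ofReal_norm, Complex.norm_real, Real.norm_eq_abs,
      abs_of_nonneg ENNReal.toReal_nonneg, ENNReal.ofReal_toReal hItop] at key
    rcases eq_or_ne I 0 with h0 | h0
    · rw [h0]; simp
    · have key2 : I * I ≤ (K ^ 2 * wsq s h) * I := by
        calc I * I = I ^ 2 := (sq I).symm
          _ ≤ (K * (wsq s h * I) ^ (1 / 2 : ℝ)) ^ 2 := by gcongr
          _ = _ := by
            rw [mul_pow, ← ENNReal.rpow_two ((wsq s h * I) ^ (1 / 2 : ℝ)), ← ENNReal.rpow_mul]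
            norm_num
            ring
      exact (ENNReal.mul_le_mul_iff_left h0 hItop).1 key2
  have hU : (⋃ R : ℕ, Metric.ball (0 : Rn n) R) = Set.univ := Metric.iUnion_ball_nat 0
  rw [wsq, ← setLIntegral_univ, ← hU, setLIntegral_iUnion_of_directed]
  · exact iSup_le hball
  · exact Monotone.directed_le fun a b hab => Metric.ball_subset_ball (by exact_mod_cast hab)

end Resolvent

/-! ### Fourier transforms depending on parameters -/

section TimeFourier

variable {V : Type*} [NormedAddCommGroup V] [InnerProductSpace ℝ V] [FiniteDimensional ℝ V]
  [MeasurableSpace V] [BorelSpace V]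

theorem fourier_sum_mul {α : Type*} (I : Finset α) (c : α → ℂ) {f : α → V → ℂ}
    (hf : ∀ i ∈ I, Integrable (f i)) (ξ : V) :
    𝓕 (fun x => ∑ i ∈ I, c i * f i x) ξ = ∑ i ∈ I, c i * 𝓕 (f i) ξ := by
  simp_rw [Real.fourier_eq, ← integral_const_mul]
  rw [← integral_finsetSum]
  · refine integral_congr_ae (ae_of_all _ fun x => ?_)
    simp only [Circle.smul_def, smul_eq_mul, Finset.mul_sum]
    exact Finset.sum_congr rfl fun i _ => by ring
  · exact fun i hi => ((Real.fourierIntegral_convergent_iff ξ).2 (hf i hi)).const_mul _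

theorem fourierInv_sum_mul {α : Type*} (I : Finset α) (c : α → ℂ) {f : α → V → ℂ}
    (hf : ∀ i ∈ I, Integrable (f i)) (ξ : V) :
    𝓕⁻ (fun x => ∑ i ∈ I, c i * f i x) ξ = ∑ i ∈ I, c i * 𝓕⁻ (f i) ξ := by
  simp_rw [fourierInv_apply_eq]
  exact fourier_sum_mul I c hf _

variable {β : Type*} [MeasurableSpace β]

theorem measurable_fourier_param {F : β × V → ℂ} (hF : Measurable F) :
    Measurable fun q : β × V => 𝓕 (fun x => F (q.1, x)) q.2 := by
  have h1 : Measurable fun q : (β × V) × V =>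
      Real.fourierChar (-inner ℝ q.2 q.1.2) • F (q.1.1, q.2) := by
    have h2 : Measurable fun q : (β × V) × V => F (q.1.1, q.2) := hF.comp (by fun_prop)
    have h3 : Measurable fun q : (β × V) × V => (Real.fourierChar (-inner ℝ q.2 q.1.2) : ℂ) := by
      have h4 : Continuous fun q : V × V => (Real.fourierChar (-inner ℝ q.1 q.2) : ℂ) :=
        continuous_subtype_val.comp (Real.continuous_fourierChar.comp (by fun_prop))
      exact h4.measurable.comp (f := fun q : (β × V) × V => (q.2, q.1.2)) (by fun_prop)
    simp only [Circle.smul_def, smul_eq_mul]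
    exact h3.mul h2
  have h5 := (h1.stronglyMeasurable.integral_prod_right' (ν := (volume : Measure V))).measurable
  simpa only [Real.fourier_eq] using h5

theorem measurable_fourierInv_param {F : β × V → ℂ} (hF : Measurable F) :
    Measurable fun q : β × V => 𝓕⁻ (fun x => F (q.1, x)) q.2 := by
  simp_rw [fourierInv_apply_eq]
  exact (measurable_fourier_param hF).comp
    (f := fun q : β × V => (q.1, -q.2)) (by fun_prop)

/-- The Fourier transforms in time and the inverse Fourier transform in space commute. -/
theorem fourier_fourierInv_mul_comm {Q : V → ℂ} (hQ : Integrable Q) {Z : ℝ × V → ℂ}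
    (hZ : Measurable Z) {b : ℝ → ℝ} (hb : Integrable b) (hZb : ∀ t ξ, ‖Z (t, ξ)‖ ≤ b t)
    (x : V) (l : ℝ) :
    𝓕 (fun t => 𝓕⁻ (fun ξ => Q ξ * Z (t, ξ)) x) l
      = 𝓕⁻ (fun ξ => Q ξ * 𝓕 (fun t => Z (t, ξ)) l) x := by
  simp_rw [Real.fourierInv_eq, Real.fourier_eq]
  have hsw : ∫ t : ℝ, ∫ ξ : V, (Real.fourierChar (-inner ℝ t l) : ℂ) *
      ((Real.fourierChar (inner ℝ ξ x) : ℂ) * (Q ξ * Z (t, ξ)))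
      = ∫ ξ : V, ∫ t : ℝ, (Real.fourierChar (-inner ℝ t l) : ℂ) *
      ((Real.fourierChar (inner ℝ ξ x) : ℂ) * (Q ξ * Z (t, ξ))) := by
    refine integral_integral_swap ?_
    refine (hb.mul_prod hQ.norm).mono ?_ (ae_of_all _ fun q => ?_)
    · have hc1 : Continuous fun q : ℝ × V => (Real.fourierChar (-inner ℝ q.1 l) : ℂ) :=
        continuous_subtype_val.comp (Real.continuous_fourierChar.comp (by fun_prop))
      have hc2 : Continuous fun q : ℝ × V => (Real.fourierChar (inner ℝ q.2 x) : ℂ) :=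
        continuous_subtype_val.comp (Real.continuous_fourierChar.comp (by fun_prop))
      have h3 : AEStronglyMeasurable (fun q : ℝ × V => Q q.2) (volume.prod volume) :=
        hQ.aestronglyMeasurable.comp_snd
      exact hc1.aestronglyMeasurable.mul (hc2.aestronglyMeasurable.mul
        (h3.mul hZ.aestronglyMeasurable))
    · simp only [Function.uncurry, norm_mul, Circle.norm_coe, one_mul, Real.norm_eq_abs]
      rw [mul_comm, abs_of_nonneg (norm_nonneg (Q q.2))]
      exact mul_le_mul_of_nonneg_right ((hZb q.1 q.2).trans (le_abs_self _)) (norm_nonneg _)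
  simp only [Circle.smul_def, smul_eq_mul]
  refine (Eq.trans ?_ hsw).trans ?_
  · exact integral_congr_ae (ae_of_all _ fun t => (integral_const_mul _ _).symm)
  · refine integral_congr_ae (ae_of_all _ fun ξ => ?_)
    simp only
    rw [← mul_assoc, ← integral_const_mul]
    exact integral_congr_ae (ae_of_all _ fun t => by simp only; ring)

end TimeFourier

/-! ### The scalar Duhamel integral and its transform in time -/

section DuhamelFactor

open Complex in
/-- The symbol of `f ↦ ∫₀ᵗ e^{i(t-τ)θ} 1_A(τ) dτ`. -/
def duhamelFactor (A : Set ℝ) (θ t : ℝ) : ℂ :=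
  ∫ τ in (0 : ℝ)..t, A.indicator (fun _ => (1 : ℂ)) τ * exp (I * ((t - τ : ℝ) * θ))

theorem norm_exp_I_mul (x y : ℝ) : ‖Complex.exp (Complex.I * ((x : ℂ) * y))‖ = 1 := by
  rw [mul_comm, ← Complex.ofReal_mul, Complex.norm_exp_ofReal_mul_I]

variable {A : Set ℝ}

theorem integrable_indicator_one (hA : MeasurableSet A) (hA' : volume A ≠ ⊤) :
    Integrable (A.indicator fun _ => (1 : ℂ)) :=
  (integrable_indicator_iff hA).2 (integrableOn_const hA')

theorem norm_duhamelFactor_le (hA : MeasurableSet A) (hA' : volume A ≠ ⊤) (θ t : ℝ) :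
    ‖duhamelFactor A θ t‖ ≤ (volume A).toReal := by
  refine (intervalIntegral.norm_integral_le_integral_norm_uIoc).trans ?_
  have h1 : ∀ τ : ℝ, ‖A.indicator (fun _ => (1 : ℂ)) τ *
      Complex.exp (Complex.I * ((t - τ : ℝ) * θ))‖ = ‖A.indicator (fun _ => (1 : ℂ)) τ‖ := fun τ => by
    rw [norm_mul, norm_exp_I_mul, mul_one]
  simp_rw [h1]
  refine (setIntegral_le_integral (integrable_indicator_one hA hA').norm
    (ae_of_all _ fun _ => norm_nonneg _)).trans (le_of_eq ?_)
  simp_rw [norm_indicator_eq_indicator_norm]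
  rw [integral_indicator hA]
  simp [Measure.real]

theorem measurable_duhamelFactor (hA : MeasurableSet A) :
    Measurable fun q : ℝ × ℝ => duhamelFactor A q.1 q.2 := by
  have h0 : Measurable fun q : (ℝ × ℝ) × ℝ => A.indicator (fun _ => (1 : ℂ)) q.2 *
      Complex.exp (Complex.I * ((q.1.2 - q.2 : ℝ) * q.1.1)) := by
    have : Measurable (A.indicator fun _ => (1 : ℂ)) := measurable_const.indicator hA
    fun_prop
  have h1 : ∀ (B : Set ((ℝ × ℝ) × ℝ)), MeasurableSet B → Measurable fun q : ℝ × ℝ =>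
      ∫ τ : ℝ, B.indicator (fun q => A.indicator (fun _ => (1 : ℂ)) q.2 *
        Complex.exp (Complex.I * ((q.1.2 - q.2 : ℝ) * q.1.1))) (q, τ) := fun B hB =>
    ((h0.indicator hB).stronglyMeasurable.integral_prod_right' (ν := volume)).measurable
  have hB : MeasurableSet {q : (ℝ × ℝ) × ℝ | q.2 ∈ Set.Ioc 0 q.1.2} :=
    (measurableSet_lt measurable_const measurable_snd).inter
      (measurableSet_le measurable_snd (by fun_prop))
  have hB' : MeasurableSet {q : (ℝ × ℝ) × ℝ | q.2 ∈ Set.Ioc q.1.2 0} :=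
    (measurableSet_lt (by fun_prop) measurable_snd).inter
      (measurableSet_le measurable_snd measurable_const)
  -- The interval integral is a difference of integrals over `Ioc 0 t` and `Ioc t 0`; joint
  -- measurability is obtained by turning the moving endpoints into indicators.
  refine (congrArg Measurable (funext fun q => ?_)).mpr ((h1 _ hB).sub (h1 _ hB'))
  rw [duhamelFactor, intervalIntegral, ← integral_indicator measurableSet_Ioc,
    ← integral_indicator measurableSet_Ioc]
  rfl

/-- The damped characteristic function of `A ∩ (0, ∞)`. -/
def dampedIndicator (A : Set ℝ) (ε : ℝ) : ℝ → ℂ :=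
  (Set.Ioi (0 : ℝ)).indicator fun τ => A.indicator (fun _ => (1 : ℂ)) τ * Real.exp (-ε * τ)

theorem measurable_dampedIndicator (hA : MeasurableSet A) (ε : ℝ) :
    Measurable (dampedIndicator A ε) := by
  have : Measurable (A.indicator fun _ => (1 : ℂ)) := measurable_const.indicator hA
  exact Measurable.indicator (by fun_prop) measurableSet_Ioi

theorem norm_dampedIndicator_le {ε : ℝ} (hε : 0 < ε) (τ : ℝ) :
    ‖dampedIndicator A ε τ‖ ≤ ‖A.indicator (fun _ => (1 : ℂ)) τ‖ := by
  rw [dampedIndicator]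
  by_cases h : 0 < τ
  · rw [Set.indicator_of_mem (Set.mem_Ioi.2 h), norm_mul, Complex.norm_real, Real.norm_eq_abs,
      Real.abs_exp]
    refine mul_le_of_le_one_right (norm_nonneg _) (Real.exp_le_one_iff.2 ?_)
    nlinarith
  · rw [Set.indicator_of_notMem (by simpa using h), norm_zero]
    exact norm_nonneg _

theorem memLp_dampedIndicator (hA : MeasurableSet A) (hA' : volume A ≠ ⊤) {ε : ℝ} (hε : 0 < ε)
    (p : ℝ≥0∞) : MemLp (dampedIndicator A ε) p :=
  (memLp_indicator_const p hA (1 : ℂ) (Or.inr hA')).mono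
    (measurable_dampedIndicator hA ε).aestronglyMeasurable
    (ae_of_all _ (norm_dampedIndicator_le hε))

open Complex in
/-- The transform of `duhamelFactor` in time, after damping. -/
theorem fourier_damped_duhamelFactor (hA : MeasurableSet A) (hA' : volume A ≠ ⊤) {ε : ℝ}
    (hε : 0 < ε) (θ l : ℝ) :
    𝓕 ((Set.Ioi (0 : ℝ)).indicator fun t => (Real.exp (-ε * t) : ℂ) * duhamelFactor A θ t) l
      = 𝓕 (dampedIndicator A ε) l *
        (I / (((θ - 2 * Real.pi * l : ℝ) : ℂ) - I * ((-ε : ℝ) : ℂ))) := by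
  set E : ℝ → ℂ := (Set.Ioi (0 : ℝ)).indicator fun t : ℝ => exp ((-ε + I * θ) * t) with hE
  have hre : (-ε + I * θ : ℂ).re < 0 := by simpa using hε
  have hEi : Integrable E :=
    (integrable_indicator_iff measurableSet_Ioi).2 (integrableOn_exp_mul_complex_Ioi hre 0)
  have hψi : Integrable (dampedIndicator A ε) :=
    memLp_one_iff_integrable.1 (memLp_dampedIndicator hA hA' hε 1)
  -- Since `e^{-εt} = e^{-ε(t-τ)} e^{-ετ}`, the damped Duhamel integral is the convolution of the
  -- damped source with a decaying half-line exponential, whose transform is the resolvent factor.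
  have hconv : ((Set.Ioi (0 : ℝ)).indicator fun t => (Real.exp (-ε * t) : ℂ) * duhamelFactor A θ t)
      = convolution (dampedIndicator A ε) E (ContinuousLinearMap.mul ℂ ℂ) volume := by
    funext t
    rw [convolution]
    simp only [ContinuousLinearMap.mul_apply']
    by_cases ht : 0 < t
    · rw [Set.indicator_of_mem (Set.mem_Ioi.2 ht), duhamelFactor,
        intervalIntegral.integral_of_le ht.le, integral_Ioc_eq_integral_Ioo, ← integral_const_mul,
        ← integral_indicator measurableSet_Ioo]
      refine integral_congr_ae (ae_of_all _ fun τ => ?_)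
      simp only [dampedIndicator, hE, Set.indicator_apply (Set.Ioi (0 : ℝ)), Set.indicator_apply (Set.Ioo (0 : ℝ) t), Set.mem_Ioo, Set.mem_Ioi, sub_pos]
      by_cases h1 : 0 < τ <;> by_cases h2 : τ < t <;> simp only [h1, h2, and_self, and_true,
        and_false, if_true, if_false, mul_zero, zero_mul]
      have : exp ((-ε + I * θ) * ((t - τ : ℝ) : ℂ))
          = exp (-ε * t) * exp (ε * τ) * exp (I * ((t - τ : ℝ) * θ)) := by
        rw [← exp_add, ← exp_add]; congr 1; push_cast; ring
      have h3 : (exp (-ε * τ) : ℂ) * exp (ε * τ) = 1 := by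
        rw [← exp_add]; simp
      rw [this]
      push_cast
      linear_combination (-A.indicator (fun _ => (1 : ℂ)) τ * exp (-ε * t) *
        exp (I * ((t - τ) * θ))) * h3
    · rw [Set.indicator_of_notMem (by simpa using ht)]
      symm
      refine integral_eq_zero_of_ae (ae_of_all _ fun τ => ?_)
      simp only [dampedIndicator, hE, Set.indicator_apply, Set.mem_Ioi, sub_pos, Pi.zero_apply]
      by_cases h1 : 0 < τ
      · rw [if_neg (show ¬ τ < t by linarith), mul_zero]
      · rw [if_neg h1, zero_mul]
  rw [hconv, Real.fourier_mul_convolution_eq hψi hEi]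
  congr 1
  rw [Real.fourier_eq]
  have h1 : ∀ t : ℝ, Real.fourierChar (-inner ℝ t l) • E t = (Set.Ioi (0 : ℝ)).indicator
      (fun t : ℝ => exp ((-ε + I * (θ - 2 * Real.pi * l)) * t)) t := by
    intro t
    simp only [hE, Set.indicator_apply]
    split_ifs
    · rw [Circle.smul_def, smul_eq_mul, Real.fourierChar_apply, ← exp_add]
      congr 1
      simp only [RCLike.inner_apply, conj_trivial]
      push_cast; ring
    · simp
  simp_rw [h1]
  have hre2 : (-ε + I * (θ - 2 * Real.pi * l) : ℂ).re < 0 := by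
    simp [hε]
  rw [integral_indicator measurableSet_Ioi, integral_exp_mul_complex_Ioi hre2]
  simp only [ofReal_zero, mul_zero, exp_zero]
  have hne : (-ε + I * (θ - 2 * Real.pi * l) : ℂ) ≠ 0 := fun h0 => by
    rw [h0] at hre2; simp at hre2
  have hne2 : (((θ - 2 * Real.pi * l : ℝ) : ℂ) - I * ((-ε : ℝ) : ℂ)) ≠ 0 := by
    intro h0
    apply hne
    have : (-ε + I * (θ - 2 * Real.pi * l) : ℂ)
        = I * (((θ - 2 * Real.pi * l : ℝ) : ℂ) - I * ((-ε : ℝ) : ℂ)) := by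
      push_cast; ring_nf; rw [I_sq]; ring
    rw [this, h0, mul_zero]
  rw [div_eq_div_iff hne hne2]
  push_cast
  ring_nf
  rw [I_sq]
  ring

end DuhamelFactor

/-! ### The damped estimate for positive times -/

section HalfLine

variable {n : ℕ} {s : ℝ}

theorem fourierInv_const_mul (c : ℂ) (f : Rn n → ℂ) (x : Rn n) :
    𝓕⁻ (fun ξ => c * f ξ) x = c * 𝓕⁻ f x := by
  simp_rw [Real.fourierInv_eq, ← integral_const_mul, Circle.smul_def, smul_eq_mul]
  refine integral_congr_ae (ae_of_all _ fun ξ => ?_)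
  simp only
  ring

/-- `q(D)` applied to the Duhamel integral of `1_A ⊗ h`. -/
def duhamelField (q p : Rn n → ℝ) (A : Set ℝ) (h : Rn n → ℂ) (y : ℝ × Rn n) : ℂ :=
  𝓕⁻ (fun ξ => (q ξ : ℂ) * 𝓕 h ξ * duhamelFactor A (p ξ) y.1) y.2

theorem measurable_duhamelField {q p : Rn n → ℝ} (hq : Measurable q) (hp : Measurable p)
    {A : Set ℝ} (hA : MeasurableSet A) {h : Rn n → ℂ} (hi : Integrable h) :
    Measurable (duhamelField q p A h) := by
  have h1 : Measurable fun y : ℝ × Rn n => duhamelFactor A (p y.2) y.1 :=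
    (measurable_duhamelFactor hA).comp (f := fun y : ℝ × Rn n => (p y.2, y.1)) (by fun_prop)
  have h2 : Measurable (𝓕 h) := (continuous_fourier_of_integrable hi).measurable
  exact measurable_fourierInv_param
    (F := fun y : ℝ × Rn n => (q y.2 : ℂ) * 𝓕 h y.2 * duhamelFactor A (p y.2) y.1) (by fun_prop)

theorem memLp_damping {ε : ℝ} (hε : 0 < ε) :
    Integrable ((Set.Ioi (0 : ℝ)).indicator fun t => Real.exp (-ε * t)) ∧
      MemLp ((Set.Ioi (0 : ℝ)).indicator fun t => Real.exp (-ε * t)) 2 := by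
  have h1 : ∀ a : ℝ, 0 < a → Integrable ((Set.Ioi (0 : ℝ)).indicator fun t => Real.exp (-a * t)) :=
    fun a ha => (integrable_indicator_iff measurableSet_Ioi).2 (exp_neg_integrableOn_Ioi 0 ha)
  refine ⟨h1 ε hε, (memLp_two_iff_integrable_sq (h1 ε hε).aestronglyMeasurable).2 ?_⟩
  refine (h1 (2 * ε) (by positivity)).congr (ae_of_all _ fun t => ?_)
  by_cases ht : t ∈ Set.Ioi (0 : ℝ)
  · simp only [Set.indicator_of_mem ht]
    rw [sq, ← Real.exp_add]; ring_nf
  · simp only [Set.indicator_of_notMem ht]; simp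

/-- The damped `duhamelFactor`. -/
def dampedFactor (A : Set ℝ) (ε : ℝ) (p : Rn n → ℝ) (y : ℝ × Rn n) : ℂ :=
  (Set.Ioi (0 : ℝ)).indicator (fun t => (Real.exp (-ε * t) : ℂ) * duhamelFactor A (p y.2) t) y.1

theorem measurable_dampedFactor {A : Set ℝ} (hA : MeasurableSet A) (ε : ℝ) {p : Rn n → ℝ}
    (hp : Measurable p) : Measurable (dampedFactor A ε p) := by
  have h1 : Measurable fun y : ℝ × Rn n => duhamelFactor A (p y.2) y.1 :=
    (measurable_duhamelFactor hA).comp (f := fun y : ℝ × Rn n => (p y.2, y.1)) (by fun_prop)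
  have h2 : MeasurableSet {y : ℝ × Rn n | y.1 ∈ Set.Ioi (0 : ℝ)} :=
    measurable_fst measurableSet_Ioi
  exact Measurable.indicator (f := fun y : ℝ × Rn n => (Real.exp (-ε * y.1) : ℂ) *
    duhamelFactor A (p y.2) y.1) (by fun_prop) h2

theorem norm_dampedFactor_le {A : Set ℝ} (hA : MeasurableSet A) (hA' : volume A ≠ ⊤) (ε : ℝ)
    (p : Rn n → ℝ) (t : ℝ) (ξ : Rn n) : ‖dampedFactor A ε p (t, ξ)‖ ≤
      (volume A).toReal * (Set.Ioi (0 : ℝ)).indicator (fun t => Real.exp (-ε * t)) t := by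
  rw [dampedFactor]
  by_cases ht : t ∈ Set.Ioi (0 : ℝ)
  · simp only [Set.indicator_of_mem ht, norm_mul, Complex.norm_real, Real.norm_eq_abs, Real.abs_exp]
    rw [mul_comm]
    gcongr
    exact norm_duhamelFactor_le hA hA' _ _
  · simp [Set.indicator_of_notMem ht]

theorem fourierInv_dampedFactor {A : Set ℝ} (ε : ℝ) (p q : Rn n → ℝ) (h : Rn n → ℂ) (t : ℝ)
    (x : Rn n) :
    𝓕⁻ (fun ξ => (q ξ : ℂ) * 𝓕 h ξ * dampedFactor A ε p (t, ξ)) x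
      = (Set.Ioi (0 : ℝ)).indicator
        (fun t => (Real.exp (-ε * t) : ℂ) * duhamelField q p A h (t, x)) t := by
  by_cases ht : t ∈ Set.Ioi (0 : ℝ)
  · rw [Set.indicator_of_mem ht, duhamelField, ← fourierInv_const_mul]
    refine congrArg (fun F : Rn n → ℂ => 𝓕⁻ F x) (funext fun ξ => ?_)
    rw [dampedFactor, Set.indicator_of_mem ht]
    ring
  · rw [Set.indicator_of_notMem ht]
    simp only [dampedFactor, Set.indicator_of_notMem ht, mul_zero]
    simp [Real.fourierInv_eq]

theorem measurable_wsq_param {β : Type*} [MeasurableSpace β] {F : β × Rn n → ℂ}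
    (hF : Measurable F) (a : ℝ) : Measurable fun b => wsq a (fun x => F (b, x)) := by
  have := measurable_weight (n := n) a
  exact Measurable.lintegral_prod_right' (f := fun y : β × Rn n =>
    ENNReal.ofReal ((1 + ‖y.2‖ ^ 2) ^ a) * ‖F y‖ₑ ^ 2) (by fun_prop)

theorem lintegral_wsq_eq {F : ℝ × Rn n → ℂ} (hF : Measurable F) (a : ℝ) :
    ∫⁻ t, wsq a (fun x => F (t, x)) =
      ∫⁻ x, ENNReal.ofReal ((1 + ‖x‖ ^ 2) ^ a) * ∫⁻ t, ‖F (t, x)‖ₑ ^ 2 := by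
  have := measurable_weight (n := n) a
  simp only [wsq]
  rw [lintegral_lintegral_swap (by simp only [Function.uncurry_def]; fun_prop)]
  exact lintegral_congr fun x => lintegral_const_mul' _ _ ENNReal.ofReal_ne_top

theorem measurable_fourier_time {F : ℝ × Rn n → ℂ} (hF : Measurable F) :
    Measurable fun y : ℝ × Rn n => 𝓕 (fun t : ℝ => F (t, y.2)) y.1 := by
  have hm0 : Measurable fun y : Rn n × ℝ => 𝓕 (fun t : ℝ => F (t, y.1)) y.2 :=
    measurable_fourier_param (V := ℝ) (β := Rn n) (F := fun y : Rn n × ℝ => F (y.2, y.1))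
      (hF.comp measurable_swap)
  exact hm0.comp (f := fun y : ℝ × Rn n => (y.2, y.1)) measurable_swap

/-- Plancherel's identity in time. -/
theorem lintegral_wsq_fourier {F : ℝ × Rn n → ℂ} (hF : Measurable F)
    (hi : ∀ x, Integrable fun t => F (t, x)) (h2 : ∀ x, MemLp (fun t => F (t, x)) 2) (a : ℝ) :
    ∫⁻ l : ℝ, wsq a (fun x : Rn n => 𝓕 (fun t : ℝ => F (t, x)) l) =
      ∫⁻ t, wsq a (fun x => F (t, x)) := by
  have hm := measurable_fourier_time hF
  have h1 := lintegral_wsq_eq hm a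
  have h3 := lintegral_wsq_eq hF a
  rw [h3]
  refine h1.trans (lintegral_congr fun x => ?_)
  have h4 := lintegral_fourier_sq (hi x) (h2 x)
  exact congrArg (fun y => ENNReal.ofReal ((1 + ‖x‖ ^ 2) ^ a) * y) h4

/-- The weight has temperate growth, so multiplying by its square root stays in the Schwartz space,
and hence in `L²`. -/
theorem wsq_schwartz_ne_top (a : ℝ) (h : 𝓢(Rn n, ℂ)) : wsq a h ≠ ⊤ := by
  have h1 := (SchwartzMap.smulLeftCLM ℂ (fun x : Rn n => (1 + ‖x‖ ^ 2) ^ (a / 2)) h).memLp 2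
  have h2 := lintegral_enorm_sq_eq volume
    (SchwartzMap.smulLeftCLM ℂ (fun x : Rn n => (1 + ‖x‖ ^ 2) ^ (a / 2)) h)
  have h3 : wsq a h = ∫⁻ x, ‖(SchwartzMap.smulLeftCLM ℂ
      (fun x : Rn n => (1 + ‖x‖ ^ 2) ^ (a / 2)) h) x‖ₑ ^ 2 := by
    refine lintegral_congr fun x => ?_
    rw [SchwartzMap.smulLeftCLM_apply_apply
      (Function.hasTemperateGrowth_one_add_norm_sq_rpow (Rn n) (a / 2)), enorm_smul, mul_pow]
    congr 1
    rw [Real.enorm_eq_ofReal (by positivity), sq (ENNReal.ofReal _), ofReal_weight_mul, add_halves]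
  rw [h3, h2]
  exact ENNReal.pow_ne_top h1.eLpNorm_ne_top

variable {α : Type*}

/-- The Fourier transform in time of a damped solution is given by the resolvent. -/
theorem fourier_dampedField {q p : Rn n → ℝ} (hp : Measurable p) (I : Finset α) (c : α → ℂ)
    {A : α → Set ℝ} (hA : ∀ i, MeasurableSet (A i)) (hA' : ∀ i, volume (A i) ≠ ⊤)
    {h : α → Rn n → ℂ} (hi : ∀ i, Integrable (h i))
    (hQ : ∀ i, Integrable fun ξ => (q ξ : ℂ) * 𝓕 (h i) ξ)
    {ε : ℝ} (hε : 0 < ε) (x : Rn n) (hU : ∀ i, Integrable fun t => 𝓕⁻ (fun ξ => (q ξ : ℂ) *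
      𝓕 (h i) ξ * dampedFactor (A i) ε p (t, ξ)) x) (l : ℝ) :
    𝓕 (fun t => ∑ i ∈ I, c i * 𝓕⁻ (fun ξ => (q ξ : ℂ) * 𝓕 (h i) ξ *
      dampedFactor (A i) ε p (t, ξ)) x) l =
    Complex.I * 𝓕⁻ (fun ξ => (q ξ : ℂ) *
      𝓕 (fun x => ∑ i ∈ I, (c i * 𝓕 (dampedIndicator (A i) ε) l) * h i x) ξ /
        (((p ξ - 2 * Real.pi * l : ℝ) : ℂ) - Complex.I * ((-ε : ℝ) : ℂ))) x := by
  have hb := (memLp_damping hε).1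
  rw [fourier_sum_mul I c (f := fun i t => 𝓕⁻ (fun ξ => (q ξ : ℂ) * 𝓕 (h i) ξ *
      dampedFactor (A i) ε p (t, ξ)) x) fun i _ => hU i]
  have e1 : (fun ξ => (q ξ : ℂ) *
      𝓕 (fun x => ∑ i ∈ I, (c i * 𝓕 (dampedIndicator (A i) ε) l) * h i x) ξ /
        (((p ξ - 2 * Real.pi * l : ℝ) : ℂ) - Complex.I * ((-ε : ℝ) : ℂ))) =
      fun ξ => ∑ i ∈ I, (c i * 𝓕 (dampedIndicator (A i) ε) l) * ((q ξ : ℂ) * 𝓕 (h i) ξ /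
        (((p ξ - 2 * Real.pi * l : ℝ) : ℂ) - Complex.I * ((-ε : ℝ) : ℂ))) := by
    funext ξ
    rw [fourier_sum_mul I _ fun i _ => hi i, Finset.mul_sum, Finset.sum_div]
    exact Finset.sum_congr rfl fun i _ => by ring
  rw [e1, fourierInv_sum_mul I (fun i => c i * 𝓕 (dampedIndicator (A i) ε) l)
    (f := fun i ξ => (q ξ : ℂ) * 𝓕 (h i) ξ /
        (((p ξ - 2 * Real.pi * l : ℝ) : ℂ) - Complex.I * ((-ε : ℝ) : ℂ)))
    fun i _ => integrable_div_sub_I_mul hp (hQ i) _ (neg_ne_zero.2 hε.ne'), Finset.mul_sum]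
  refine Finset.sum_congr rfl fun i _ => ?_
  rw [fourier_fourierInv_mul_comm (Q := fun ξ => (q ξ : ℂ) * 𝓕 (h i) ξ) (hQ i)
    (measurable_dampedFactor (hA i) ε hp) (hb.const_mul (volume (A i)).toReal)
    (norm_dampedFactor_le (hA i) (hA' i) ε p) x l]
  have e2 : ∀ ξ, 𝓕 (fun t => dampedFactor (A i) ε p (t, ξ)) l = 𝓕 (dampedIndicator (A i) ε) l *
        (Complex.I / (((p ξ - 2 * Real.pi * l : ℝ) : ℂ) - Complex.I * ((-ε : ℝ) : ℂ))) := fun ξ =>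
    fourier_damped_duhamelFactor (hA i) (hA' i) hε (p ξ) l
  have e3 : 𝓕⁻ (fun ξ => (q ξ : ℂ) * 𝓕 (h i) ξ * 𝓕 (fun t => dampedFactor (A i) ε p (t, ξ)) l) x =
      (𝓕 (dampedIndicator (A i) ε) l * Complex.I) * 𝓕⁻ (fun ξ => (q ξ : ℂ) * 𝓕 (h i) ξ /
        (((p ξ - 2 * Real.pi * l : ℝ) : ℂ) - Complex.I * ((-ε : ℝ) : ℂ))) x := by
    rw [← fourierInv_const_mul]
    refine congrArg (fun F : Rn n → ℂ => 𝓕⁻ F x) (funext fun ξ => ?_)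
    rw [e2]
    ring
  rw [e3]
  ring

set_option maxHeartbeats 1000000 in
/-- The smoothing estimate on the half line, with damping. -/
theorem ResolventBound.lintegral_damped_le {q p : Rn n → ℝ} {K : ℝ≥0}
    (hb : ResolventBound q p s K) (hq : Measurable q) (hp : Measurable p) (hs : 0 ≤ s)
    (hqi : ∀ φ : 𝓢(Rn n, ℂ), Integrable fun ξ => (q ξ : ℂ) * φ ξ) (I : Finset α) (c : α → ℂ)
    {A : α → Set ℝ} (hA : ∀ i, MeasurableSet (A i)) (hA' : ∀ i, volume (A i) ≠ ⊤)
    (h : α → 𝓢(Rn n, ℂ)) {ε : ℝ} (hε : 0 < ε) :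
    ∫⁻ t in Set.Ioi 0, ENNReal.ofReal (Real.exp (-ε * t)) ^ 2 *
        wsq (-s) (fun x => ∑ i ∈ I, c i * duhamelField q p (A i) (h i) (t, x)) ≤
      K ^ 2 * ∫⁻ t in Set.Ioi 0,
        wsq s (fun x => ∑ i ∈ I, c i * ((A i).indicator (fun _ => (1 : ℂ)) t * h i x)) := by
  have hfc : ∀ i, (𝓕 (h i : Rn n → ℂ)) = (𝓕 (h i) : 𝓢(Rn n, ℂ)) := fun i =>
    (SchwartzMap.fourier_coe (h i)).symm
  have hQ : ∀ i, Integrable fun ξ => (q ξ : ℂ) * 𝓕 (h i : Rn n → ℂ) ξ := fun i => by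
    simp_rw [hfc]; exact hqi _
  set Z : α → ℝ × Rn n → ℂ := fun i => dampedFactor (A i) ε p with hZ
  set U : α → ℝ × Rn n → ℂ := fun i y =>
    𝓕⁻ (fun ξ => (q ξ : ℂ) * 𝓕 (h i : Rn n → ℂ) ξ * Z i (y.1, ξ)) y.2 with hU
  have hZm : ∀ i, Measurable (Z i) := fun i => measurable_dampedFactor (hA i) ε hp
  have hUm : ∀ i, Measurable (U i) := fun i => by
    have h2 : Measurable (𝓕 (h i : Rn n → ℂ)) :=
      (continuous_fourier_of_integrable (h i).integrable).measurable
    have := hZm i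
    exact measurable_fourierInv_param
      (F := fun y : ℝ × Rn n => (q y.2 : ℂ) * 𝓕 (h i : Rn n → ℂ) y.2 * Z i y) (by fun_prop)
  obtain ⟨hb1, hb2⟩ := memLp_damping hε
  set b := (Set.Ioi (0 : ℝ)).indicator fun t => Real.exp (-ε * t) with hbdef
  -- For fixed `x` the damping dominates, so each time slice lies in `L¹ ∩ L²`, as Plancherel in
  -- time requires.
  have hUb : ∀ i t x, ‖U i (t, x)‖ ≤
      (∫ ξ, ‖(q ξ : ℂ) * 𝓕 (h i : Rn n → ℂ) ξ‖) * (volume (A i)).toReal * ‖b t‖ := by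
    intro i t x
    have hb0 : 0 ≤ b t := Set.indicator_nonneg (fun _ _ => (Real.exp_pos _).le) _
    refine (norm_fourierInv_le x).trans ?_
    rw [Real.norm_eq_abs, abs_of_nonneg hb0, mul_assoc, ← integral_mul_const]
    refine integral_mono_of_nonneg (ae_of_all _ fun _ => norm_nonneg _)
      ((hQ i).norm.mul_const _) (ae_of_all _ fun ξ => ?_)
    simp only
    rw [norm_mul]
    exact mul_le_mul_of_nonneg_left (norm_dampedFactor_le (hA i) (hA' i) ε p t ξ) (norm_nonneg _)
  have hUi : ∀ i x, Integrable fun t => U i (t, x) := fun i x =>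
    (hb1.norm.const_mul _).mono' ((hUm i).comp measurable_prodMk_right).aestronglyMeasurable
      (ae_of_all _ fun t => hUb i t x)
  have hU2 : ∀ i x, MemLp (fun t => U i (t, x)) 2 := fun i x =>
    hb2.of_le_mul ((hUm i).comp measurable_prodMk_right).aestronglyMeasurable
      (ae_of_all _ fun t => hUb i t x)
  set F : ℝ × Rn n → ℂ := fun y => ∑ i ∈ I, c i * U i y with hF
  have hFm : Measurable F := by fun_prop
  set f : ℝ × Rn n → ℂ := fun y => ∑ i ∈ I, c i * (dampedIndicator (A i) ε y.1 * h i y.2) with hf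
  have hfm : Measurable f := by
    have h1 := fun i => measurable_dampedIndicator (hA i) ε
    have h2 := fun i => (h i).continuous.measurable
    fun_prop
  -- the left-hand side
  have hL : ∫⁻ t in Set.Ioi 0, ENNReal.ofReal (Real.exp (-ε * t)) ^ 2 *
        wsq (-s) (fun x => ∑ i ∈ I, c i * duhamelField q p (A i) (h i) (t, x))
      = ∫⁻ t, wsq (-s) (fun x => F (t, x)) := by
    rw [← lintegral_indicator measurableSet_Ioi]
    refine lintegral_congr fun t => ?_
    by_cases ht : t ∈ Set.Ioi (0 : ℝ)
    · rw [Set.indicator_of_mem ht, wsq, wsq,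
        ← lintegral_const_mul' _ _ (ENNReal.pow_ne_top ENNReal.ofReal_ne_top)]
      refine lintegral_congr fun x => ?_
      have e : F (t, x) = (Real.exp (-ε * t) : ℂ) *
          ∑ i ∈ I, c i * duhamelField q p (A i) (h i) (t, x) := by
        simp only [hF, hU, hZ, fourierInv_dampedFactor, Set.indicator_of_mem ht, Finset.mul_sum]
        exact Finset.sum_congr rfl fun i _ => by ring
      rw [e, enorm_mul, ← ofReal_norm (Real.exp (-ε * t) : ℂ), Complex.norm_real, Real.norm_eq_abs,
        Real.abs_exp]
      ring
    · rw [Set.indicator_of_notMem ht]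
      simp only [hF, hU, hZ, fourierInv_dampedFactor, Set.indicator_of_notMem ht, wsq]
      simp
  -- Damping only decreases the source on `t > 0`, so the right-hand side no longer depends on `ε`.
  have hR : ∫⁻ t, wsq s (fun x => f (t, x)) ≤ ∫⁻ t in Set.Ioi 0,
        wsq s (fun x => ∑ i ∈ I, c i * ((A i).indicator (fun _ => (1 : ℂ)) t * h i x)) := by
    rw [← lintegral_indicator measurableSet_Ioi]
    refine lintegral_mono fun t => ?_
    by_cases ht : t ∈ Set.Ioi (0 : ℝ)
    · rw [Set.indicator_of_mem ht, wsq, wsq]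
      refine lintegral_mono fun x => ?_
      have e : f (t, x) = (Real.exp (-ε * t) : ℂ) *
          ∑ i ∈ I, c i * ((A i).indicator (fun _ => (1 : ℂ)) t * h i x) := by
        simp only [hf, dampedIndicator, Set.indicator_of_mem ht, Finset.mul_sum]
        exact Finset.sum_congr rfl fun i _ => by ring
      have h1 : ‖f (t, x)‖ₑ ≤
          ‖∑ i ∈ I, c i * ((A i).indicator (fun _ => (1 : ℂ)) t * h i x)‖ₑ := by
        rw [e, enorm_mul, ← ofReal_norm (Real.exp (-ε * t) : ℂ), Complex.norm_real,
          Real.norm_eq_abs, Real.abs_exp]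
        refine mul_le_of_le_one_left (zero_le) ?_
        rw [ENNReal.ofReal_le_one, Real.exp_le_one_iff]
        have : 0 < t := ht
        nlinarith
      gcongr
    · rw [Set.indicator_of_notMem ht]
      simp only [hf, dampedIndicator, Set.indicator_of_notMem ht, wsq]
      simp
  have hF' := lintegral_wsq_fourier hFm
      (fun x => integrable_finsetSum I fun i _ => (hUi i x).const_mul (c i))
      (fun x => memLp_finsetSum I fun i _ => (hU2 i x).const_mul (c i)) (-s)
  have hf' := lintegral_wsq_fourier hfm
      (fun x => integrable_finsetSum I fun i _ =>
        ((memLp_one_iff_integrable.1 (memLp_dampedIndicator (hA i) (hA' i) hε 1)).mul_const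
          (h i x)).const_mul (c i))
      (fun x => memLp_finsetSum I fun i _ =>
        ((memLp_dampedIndicator (hA i) (hA' i) hε 2).mul_const (h i x)).const_mul (c i)) s
  have hKtop : (K : ℝ≥0∞) ^ 2 ≠ ⊤ := by simp
  -- After Plancherel on both sides the estimate is proved frequency by frequency: it is the
  -- weighted resolvent bound at spectral parameter `2πl` with imaginary part `-ε`.
  refine le_of_eq_of_le (hL.trans hF'.symm) (le_trans ?_ (mul_le_mul_right (hf'.trans_le hR) _))
  refine le_of_le_of_eq ?_ (lintegral_const_mul' _ _ hKtop)
  refine lintegral_mono fun l => ?_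
  show wsq (-s) (fun x : Rn n => 𝓕 (fun t : ℝ => F (t, x)) l) ≤
    K ^ 2 * wsq s (fun x : Rn n => 𝓕 (fun t : ℝ => f (t, x)) l)
  -- the source at frequency `l`
  set H : 𝓢(Rn n, ℂ) := ∑ i ∈ I, (c i * 𝓕 (dampedIndicator (A i) ε) l) • h i with hH
  have hHx : ∀ x, H x = ∑ i ∈ I, (c i * 𝓕 (dampedIndicator (A i) ε) l) * h i x := fun x => by
    rw [hH, sum_apply]; rfl
  have e1 : (fun x => 𝓕 (fun t => f (t, x)) l) = H := by
    funext x
    simp only [hf]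
    rw [fourier_sum_mul I c (f := fun i t => dampedIndicator (A i) ε t * h i x) fun i _ =>
      (memLp_one_iff_integrable.1 (memLp_dampedIndicator (hA i) (hA' i) hε 1)).mul_const _, hHx]
    refine Finset.sum_congr rfl fun i _ => ?_
    rw [mul_assoc]
    congr 1
    simp_rw [Real.fourier_eq, ← integral_mul_const, Circle.smul_def, smul_eq_mul, mul_assoc]
  have e2 : ∀ x, 𝓕 (fun t => F (t, x)) l = Complex.I * 𝓕⁻ (fun ξ => (q ξ : ℂ) *
      𝓕 (H : Rn n → ℂ) ξ / (((p ξ - 2 * Real.pi * l : ℝ) : ℂ) -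
        Complex.I * ((-ε : ℝ) : ℂ))) x := by
    intro x
    rw [funext hHx]
    exact fourier_dampedField hp I c hA hA' (fun i => (h i).integrable) hQ hε x
      (fun i => hUi i x) l
  rw [e1]
  have e3 : wsq (-s) (fun x => 𝓕 (fun t => F (t, x)) l) = wsq (-s) (𝓕⁻ fun ξ => (q ξ : ℂ) *
      𝓕 (H : Rn n → ℂ) ξ / (((p ξ - 2 * Real.pi * l : ℝ) : ℂ) -
        Complex.I * ((-ε : ℝ) : ℂ))) := by
    rw [funext e2]
    refine lintegral_congr fun x => ?_
    simp only [enorm_mul, ← ofReal_norm Complex.I, Complex.norm_I, ENNReal.ofReal_one, one_mul]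
  rw [e3]
  refine hb.wsq_fourierInv_le hp hs H.continuous.measurable H.integrable (H.memLp 2)
    (wsq_schwartz_ne_top s H) ?_ _ (neg_ne_zero.2 hε.ne')
  rw [show 𝓕 (H : Rn n → ℂ) = (𝓕 H : 𝓢(Rn n, ℂ)) from (SchwartzMap.fourier_coe H).symm]
  exact hqi _

end HalfLine

/-! ### Removal of the damping and negative times -/

section FullLine

variable {n : ℕ} {s : ℝ} {α : Type*}

theorem tendsto_damping (t : ℝ) (x : ℝ≥0∞) :
    Filter.Tendsto (fun k : ℕ => ENNReal.ofReal (Real.exp (-(1 / ((k : ℝ) + 1)) * t)) ^ 2 * x)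
      Filter.atTop (nhds x) := by
  have h1 : Filter.Tendsto (fun k : ℕ => -(1 / ((k : ℝ) + 1)) * t) Filter.atTop (nhds 0) := by
    simpa using (tendsto_one_div_add_atTop_nhds_zero_nat (𝕜 := ℝ)).neg.mul_const t
  have h2 : Filter.Tendsto (fun k : ℕ => ENNReal.ofReal (Real.exp (-(1 / ((k : ℝ) + 1)) * t)) ^ 2)
      Filter.atTop (nhds 1) := by
    have := ENNReal.tendsto_ofReal ((Real.continuous_exp.tendsto 0).comp h1)
    simpa [Function.comp_def] using (ENNReal.continuous_pow 2).tendsto _ |>.comp this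
  simpa using ENNReal.Tendsto.mul_const h2 (Or.inl one_ne_zero)

/-- The smoothing estimate on the half line. -/
theorem ResolventBound.lintegral_Ioi_le {q p : Rn n → ℝ} {K : ℝ≥0}
    (hb : ResolventBound q p s K) (hq : Measurable q) (hp : Measurable p) (hs : 0 ≤ s)
    (hqi : ∀ φ : 𝓢(Rn n, ℂ), Integrable fun ξ => (q ξ : ℂ) * φ ξ) (I : Finset α) (c : α → ℂ)
    {A : α → Set ℝ} (hA : ∀ i, MeasurableSet (A i)) (hA' : ∀ i, volume (A i) ≠ ⊤)
    (h : α → 𝓢(Rn n, ℂ)) :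
    ∫⁻ t in Set.Ioi 0,
        wsq (-s) (fun x => ∑ i ∈ I, c i * duhamelField q p (A i) (h i) (t, x)) ≤
      K ^ 2 * ∫⁻ t in Set.Ioi 0,
        wsq s (fun x => ∑ i ∈ I, c i * ((A i).indicator (fun _ => (1 : ℂ)) t * h i x)) := by
  have hVm : Measurable fun y : ℝ × Rn n =>
      ∑ i ∈ I, c i * duhamelField q p (A i) (h i) y := by
    have := fun i => measurable_duhamelField hq hp (hA i) (h i).integrable
    fun_prop
  have hGm := measurable_wsq_param hVm (-s)
  -- Fatou's lemma along `ε = 1/(k+1)`; the damped bounds do not depend on `ε`.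
  have hle := lintegral_liminf_le (u := Filter.atTop) (μ := volume.restrict (Set.Ioi (0 : ℝ)))
    (f := fun (k : ℕ) t => ENNReal.ofReal (Real.exp (-(1 / ((k : ℝ) + 1)) * t)) ^ 2 *
        wsq (-s) (fun x => ∑ i ∈ I, c i * duhamelField q p (A i) (h i) (t, x)))
    (fun k => Measurable.mul (by fun_prop) hGm)
  simp only [(tendsto_damping _ _).liminf_eq] at hle
  refine hle.trans ?_
  refine Filter.liminf_le_of_le (by isBoundedDefault) fun b hb' => ?_
  obtain ⟨k, hk⟩ := hb'.exists
  exact hk.trans (hb.lintegral_damped_le hq hp hs hqi I c hA hA' h (by positivity))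

/-- Time reversal, by the substitution `τ ↦ -τ`: negative times are positive times for the phase
`-θ` and the reflected set. -/
theorem duhamelFactor_neg (A : Set ℝ) (θ t : ℝ) :
    duhamelFactor A θ (-t) = -duhamelFactor (-A) (-θ) t := by
  rw [duhamelFactor, duhamelFactor, intervalIntegral.integral_symm, neg_inj]
  have := intervalIntegral.integral_comp_neg (a := 0) (b := t) (fun τ : ℝ =>
    A.indicator (fun _ => (1 : ℂ)) τ * Complex.exp (Complex.I * ((-t - τ : ℝ) * θ)))
  rw [neg_zero] at this
  rw [← this]
  refine intervalIntegral.integral_congr fun τ _ => ?_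
  congr 1
  congr 1
  push_cast
  ring

theorem duhamelField_neg (q p : Rn n → ℝ) (A : Set ℝ) (h : Rn n → ℂ) (t : ℝ) (x : Rn n) :
    duhamelField q p A h (-t, x) = -duhamelField q (fun ξ => -p ξ) (-A) h (t, x) := by
  refine Eq.trans ?_ ((fourierInv_const_mul (-1) _ x).trans (neg_one_mul _))
  refine congrArg (fun F : Rn n → ℂ => 𝓕⁻ F x) (funext fun ξ => ?_)
  simp only [duhamelFactor_neg]
  ring

theorem lintegral_eq_Ioi_add (f : ℝ → ℝ≥0∞) :
    ∫⁻ t, f t = (∫⁻ t in Set.Ioi 0, f t) + ∫⁻ t in Set.Ioi 0, f (-t) := by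
  have h1 : ∫⁻ t in Set.Ioi 0, f (-t) = ∫⁻ t in Set.Iio 0, f t := by
    have := (Measure.measurePreserving_neg (volume : Measure ℝ)).setLIntegral_comp_preimage_emb
      (MeasurableEquiv.neg ℝ).measurableEmbedding f (Set.Iio 0)
    rw [← this]
    congr 2
    ext t; simp
  rw [h1, setLIntegral_congr Iio_ae_eq_Iic, add_comm, ← lintegral_add_compl f measurableSet_Iic,
    Set.compl_Iic]

/-- The smoothing estimate for finite sums of tensor products. -/
theorem ResolventBound.lintegral_duhamelField_le {q p : Rn n → ℝ} {K : ℝ≥0}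
    (hb : ResolventBound q p s K) (hq : Measurable q) (hp : Measurable p) (hs : 0 ≤ s)
    (hqi : ∀ φ : 𝓢(Rn n, ℂ), Integrable fun ξ => (q ξ : ℂ) * φ ξ) (I : Finset α) (c : α → ℂ)
    {A : α → Set ℝ} (hA : ∀ i, MeasurableSet (A i)) (hA' : ∀ i, volume (A i) ≠ ⊤)
    (h : α → 𝓢(Rn n, ℂ)) :
    ∫⁻ t, wsq (-s) (fun x => ∑ i ∈ I, c i * duhamelField q p (A i) (h i) (t, x)) ≤
      K ^ 2 * ∫⁻ t,
        wsq s (fun x => ∑ i ∈ I, c i * ((A i).indicator (fun _ => (1 : ℂ)) t * h i x)) := by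
  rw [lintegral_eq_Ioi_add, lintegral_eq_Ioi_add (fun t =>
    wsq s (fun x => ∑ i ∈ I, c i * ((A i).indicator (fun _ => (1 : ℂ)) t * h i x))), mul_add]
  refine add_le_add (hb.lintegral_Ioi_le hq hp hs hqi I c hA hA' h) ?_
  have hA2 : ∀ i, volume (-A i) ≠ ⊤ := fun i => by rw [Measure.measure_neg]; exact hA' i
  refine le_trans (le_of_eq ?_) ((hb.neg.lintegral_Ioi_le hq hp.neg hs hqi I c
    (fun i => (hA i).neg) hA2 h).trans (le_of_eq ?_))
  · refine lintegral_congr fun t => lintegral_congr fun x => ?_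
    congr 2
    simp only [duhamelField_neg, mul_neg, Finset.sum_neg_distrib, enorm_neg]
  · congr 1

end FullLine

/-! ### Weighted norms and time slices -/

section Weighted

variable {n : ℕ}

theorem enorm_weighted_sq (r : ℝ) (f : ℝ × Rn n → ℂ) (y : ℝ × Rn n) :
    ‖weighted r f y‖ₑ ^ 2 = ENNReal.ofReal ((1 + ‖y.2‖ ^ 2) ^ r) * ‖f y‖ₑ ^ 2 := by
  have h0 : (0 : ℝ) ≤ 1 + ‖y.2‖ ^ 2 := by positivity
  rw [weighted, enorm_mul, mul_pow, ← ofReal_norm (((Real.sqrt (1 + ‖y.2‖ ^ 2) ^ r : ℝ) : ℂ)),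
    Complex.norm_real, Real.norm_eq_abs, abs_of_nonneg (by positivity),
    ← ENNReal.ofReal_pow (by positivity), ← Real.rpow_natCast, ← Real.rpow_mul (Real.sqrt_nonneg _),
    Real.sqrt_eq_rpow, ← Real.rpow_mul h0]
  congr 3
  push_cast
  ring

theorem measurable_japanese (r : ℝ) :
    Measurable fun y : ℝ × Rn n => ((Real.sqrt (1 + ‖y.2‖ ^ 2) ^ r : ℝ) : ℂ) := by
  fun_prop

theorem aestronglyMeasurable_weighted (r : ℝ) {f : ℝ × Rn n → ℂ}
    (hf : AEStronglyMeasurable f) : AEStronglyMeasurable (weighted r f) :=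
  (measurable_japanese r).aestronglyMeasurable.mul hf

theorem weighted_weighted (a b : ℝ) (f : ℝ × Rn n → ℂ) :
    weighted a (weighted b f) = weighted (a + b) f := by
  funext y
  have h0 : 0 < Real.sqrt (1 + ‖y.2‖ ^ 2) := Real.sqrt_pos.2 (by positivity)
  simp only [weighted]
  rw [Real.rpow_add h0]
  push_cast
  ring

theorem weighted_zero (f : ℝ × Rn n → ℂ) : weighted 0 f = f := by
  funext y; simp [weighted]

theorem weighted_neg_weighted (r : ℝ) (f : ℝ × Rn n → ℂ) :
    weighted (-r) (weighted r f) = f := by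
  rw [weighted_weighted, neg_add_cancel, weighted_zero]

theorem aestronglyMeasurable_of_weighted (r : ℝ) {f : ℝ × Rn n → ℂ}
    (hf : AEStronglyMeasurable (weighted r f)) : AEStronglyMeasurable f := by
  rw [← weighted_neg_weighted r f]
  exact aestronglyMeasurable_weighted _ hf

theorem weighted_sum {α : Type*} (r : ℝ) (I : Finset α) (c : α → ℂ) (f : α → ℝ × Rn n → ℂ) :
    weighted r (fun y => ∑ i ∈ I, c i * f i y) = fun y => ∑ i ∈ I, c i * weighted r (f i) y := by
  funext y
  simp only [weighted, Finset.mul_sum]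
  exact Finset.sum_congr rfl fun i _ => by ring

theorem lintegral_wsq_eq_eLpNorm (r : ℝ) {f : ℝ × Rn n → ℂ} (hf : AEStronglyMeasurable f) :
    ∫⁻ t, wsq r (fun x => f (t, x)) = eLpNorm (weighted r f) 2 volume ^ 2 := by
  rw [← lintegral_enorm_sq_eq, Measure.volume_eq_prod, lintegral_prod]
  · simp_rw [enorm_weighted_sq]
    rfl
  · exact (aestronglyMeasurable_weighted r hf).enorm.pow_const 2

theorem wsq_zero (f : Rn n → ℂ) : wsq 0 f = ∫⁻ x, ‖f x‖ₑ ^ 2 := by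
  simp [wsq]

theorem lintegral_slice_sq {f : ℝ × Rn n → ℂ} (hf : AEStronglyMeasurable f) :
    ∫⁻ t : ℝ, ∫⁻ x : Rn n, ‖f (t, x)‖ₑ ^ 2 = eLpNorm f 2 volume ^ 2 := by
  have := lintegral_wsq_eq_eLpNorm 0 hf
  rw [weighted_zero] at this
  simpa only [wsq_zero] using this

theorem eLpNorm_weighted_mono {a b : ℝ} (hab : a ≤ b) (f : ℝ × Rn n → ℂ) :
    eLpNorm (weighted a f) 2 volume ≤ eLpNorm (weighted b f) 2 volume := by
  refine eLpNorm_mono fun y => ?_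
  simp only [weighted, norm_mul]
  gcongr 1
  rw [Complex.norm_real, Complex.norm_real, Real.norm_eq_abs, Real.norm_eq_abs,
    abs_of_nonneg (by positivity), abs_of_nonneg (by positivity)]
  refine Real.rpow_le_rpow_of_exponent_le ?_ hab
  rw [Real.one_le_sqrt]
  nlinarith [sq_nonneg ‖y.2‖]

theorem memLp_slice {f : ℝ × Rn n → ℂ} (hf : MemLp f 2 volume) :
    ∀ᵐ t : ℝ, MemLp (fun x => f (t, x)) 2 volume := by
  have h1 : AEStronglyMeasurable f ((volume : Measure ℝ).prod volume) := hf.1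
  have h2 := lintegral_slice_sq hf.1
  have h3 : AEMeasurable (fun t : ℝ => ∫⁻ x : Rn n, ‖f (t, x)‖ₑ ^ 2) :=
    (h1.enorm.pow_const 2).lintegral_prod_right'
  have h4 := ae_lt_top' h3 (by rw [h2]; exact ENNReal.pow_ne_top hf.2.ne)
  filter_upwards [h1.prodMk_left, h4] with t ht ht'
  refine ⟨ht, ?_⟩
  rw [lintegral_enorm_sq_eq] at ht'
  by_contra h
  rw [not_lt, top_le_iff] at h
  rw [h] at ht'
  simp at ht'

theorem slice_coeFn {f : ℝ × Rn n → ℂ} {τ : ℝ} (h : MemLp (fun x => f (τ, x)) 2 volume) :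
    slice f τ =ᵐ[volume] fun x => f (τ, x) := by
  rw [slice, dif_pos h]
  exact h.coeFn_toLp

theorem enorm_L2_sq (u : L2 n) : ‖u‖ₑ ^ 2 = ∫⁻ x, ‖u x‖ₑ ^ 2 := by
  rw [lintegral_enorm_sq_eq, Lp.enorm_def]

/-- Slices depend on the function isometrically. -/
theorem enorm_slice_sub_sq {f g : ℝ × Rn n → ℂ} {τ : ℝ} (hf : MemLp (fun x => f (τ, x)) 2 volume)
    (hg : MemLp (fun x => g (τ, x)) 2 volume) :
    ‖slice f τ - slice g τ‖ₑ ^ 2 = ∫⁻ x, ‖f (τ, x) - g (τ, x)‖ₑ ^ 2 := by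
  rw [enorm_L2_sq]
  refine lintegral_congr_ae ?_
  filter_upwards [Lp.coeFn_sub (slice f τ) (slice g τ), slice_coeFn hf, slice_coeFn hg]
    with x h1 h2 h3
  rw [h1, Pi.sub_apply, h2, h3]

end Weighted

/-! ### The propagator as a strongly continuous family of isometries -/

section Propagator

variable {n : ℕ} {a : Rn n → ℝ}

theorem propagator_eq_of_fourier (ha : Measurable a) {t : ℝ} {g u : L2 n}
    (h : (𝓕 u : L2 n) =ᵐ[volume] fun ξ : Rn n =>
      Complex.exp (Complex.I * t * a ((2 * Real.pi) • ξ)) * (𝓕 g : L2 n) ξ) :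
    propagator a t g = u := by
  have h1 : (𝓕 (propagator a t g) : L2 n) = 𝓕 u :=
    Lp.ext ((fourier_propagator ha t g).trans h.symm)
  exact (Lp.fourierTransformₗᵢ (Rn n) ℂ).injective h1

theorem propagator_add (ha : Measurable a) (t : ℝ) (g h : L2 n) :
    propagator a t (g + h) = propagator a t g + propagator a t h := by
  refine propagator_eq_of_fourier ha ?_
  rw [FourierTransform.fourier_add, FourierTransform.fourier_add]
  filter_upwards [Lp.coeFn_add (𝓕 g : L2 n) (𝓕 h : L2 n),
    Lp.coeFn_add (𝓕 (propagator a t g) : L2 n) (𝓕 (propagator a t h) : L2 n),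
    fourier_propagator ha t g, fourier_propagator ha t h] with ξ h1 h2 h3 h4
  rw [h1, h2, Pi.add_apply, Pi.add_apply, h3, h4]
  ring

theorem propagator_smul (ha : Measurable a) (t : ℝ) (c : ℂ) (g : L2 n) :
    propagator a t (c • g) = c • propagator a t g := by
  refine propagator_eq_of_fourier ha ?_
  rw [FourierTransform.fourier_smul, FourierTransform.fourier_smul]
  filter_upwards [Lp.coeFn_smul c (𝓕 g : L2 n),
    Lp.coeFn_smul c (𝓕 (propagator a t g) : L2 n), fourier_propagator ha t g] with ξ h1 h2 h3
  rw [h1, h2, Pi.smul_apply, Pi.smul_apply, h3, smul_eq_mul, smul_eq_mul]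
  ring

theorem norm_exp_I_mul_mul (t x : ℝ) : ‖Complex.exp (Complex.I * t * x)‖ = 1 := by
  rw [mul_assoc]; exact norm_exp_I_mul t x

theorem norm_propagator (ha : Measurable a) (t : ℝ) (g : L2 n) : ‖propagator a t g‖ = ‖g‖ := by
  rw [← Lp.norm_fourier_eq, ← Lp.norm_fourier_eq g, Lp.norm_def, Lp.norm_def]
  congr 1
  refine eLpNorm_congr_norm_ae ?_
  filter_upwards [fourier_propagator ha t g] with ξ h
  rw [h, norm_mul, norm_exp_I_mul_mul, one_mul]

/-- `propagator a t` as a linear isometry. -/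
def propagatorLI (ha : Measurable a) (t : ℝ) : L2 n →ₗᵢ[ℂ] L2 n where
  toFun := propagator a t
  map_add' := propagator_add ha t
  map_smul' := propagator_smul ha t
  norm_map' := norm_propagator ha t

/-- Dominated convergence on the Fourier side, with majorant `(2 |𝓕 g|)²`. Measurability in `τ` of
the Duhamel integrand rests on this. -/
theorem continuous_propagator (ha : Measurable a) (g : L2 n) :
    Continuous fun t => propagator a t g := by
  refine continuous_iff_continuousAt.2 fun t₀ => ?_
  have key : Filter.Tendsto (fun t : ℝ => ∫⁻ ξ : Rn n,
      ‖(Complex.exp (Complex.I * t * a ((2 * Real.pi) • ξ)) -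
        Complex.exp (Complex.I * t₀ * a ((2 * Real.pi) • ξ))) * (𝓕 g : L2 n) ξ‖ₑ ^ 2)
      (nhds t₀) (nhds 0) := by
    have hgm := (Lp.stronglyMeasurable (𝓕 g : L2 n)).measurable
    have := tendsto_lintegral_filter_of_dominated_convergence (μ := volume) (l := nhds t₀)
      (F := fun (t : ℝ) (ξ : Rn n) => ‖(Complex.exp (Complex.I * t * a ((2 * Real.pi) • ξ)) -
        Complex.exp (Complex.I * t₀ * a ((2 * Real.pi) • ξ))) * (𝓕 g : L2 n) ξ‖ₑ ^ 2)
      (f := fun _ => 0) (fun ξ => (2 * ‖(𝓕 g : L2 n) ξ‖ₑ) ^ 2)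
      (Filter.Eventually.of_forall fun t => by fun_prop)
      (Filter.Eventually.of_forall fun t => ae_of_all _ fun ξ => ?_) ?_ (ae_of_all _ fun ξ => ?_)
    · simpa using this
    · rw [enorm_mul]
      gcongr
      refine (enorm_sub_le).trans (le_of_eq ?_)
      rw [← ofReal_norm, ← ofReal_norm, norm_exp_I_mul_mul, norm_exp_I_mul_mul]
      norm_num
    · simp_rw [mul_pow]
      rw [lintegral_const_mul' _ _ (by simp), ← enorm_L2_sq]
      exact ENNReal.mul_ne_top (by simp) (by simp)
    · have hc : Continuous fun t : ℝ => ‖(Complex.exp (Complex.I * t * a ((2 * Real.pi) • ξ)) -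
        Complex.exp (Complex.I * t₀ * a ((2 * Real.pi) • ξ))) * (𝓕 g : L2 n) ξ‖ₑ ^ 2 := by
        refine (ENNReal.continuous_pow 2).comp (continuous_enorm.comp ?_)
        fun_prop
      simpa using hc.tendsto t₀
  have h2 : ∀ t, ‖propagator a t g - propagator a t₀ g‖ₑ ^ 2 = ∫⁻ ξ : Rn n,
      ‖(Complex.exp (Complex.I * t * a ((2 * Real.pi) • ξ)) -
        Complex.exp (Complex.I * t₀ * a ((2 * Real.pi) • ξ))) * (𝓕 g : L2 n) ξ‖ₑ ^ 2 := by
    intro t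
    have e : ‖propagator a t g - propagator a t₀ g‖ₑ
        = ‖(𝓕 (propagator a t g) : L2 n) - 𝓕 (propagator a t₀ g)‖ₑ := by
      rw [← ofReal_norm, ← ofReal_norm, ← Lp.norm_fourier_eq]
      exact congrArg (fun u : L2 n => ENNReal.ofReal ‖u‖) ((Lp.fourierTransformₗᵢ (Rn n) ℂ).map_sub _ _)
    rw [e, enorm_L2_sq]
    refine lintegral_congr_ae ?_
    filter_upwards [Lp.coeFn_sub (𝓕 (propagator a t g) : L2 n) (𝓕 (propagator a t₀ g)),
      fourier_propagator ha t g, fourier_propagator ha t₀ g] with ξ h1 h3 h4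
    rw [h1, Pi.sub_apply, h3, h4, sub_mul]
  simp_rw [← h2] at key
  rw [ContinuousAt, tendsto_iff_norm_sub_tendsto_zero]
  have h3 := (ENNReal.tendsto_toReal ENNReal.zero_ne_top).comp key
  have h4 := (Real.continuous_sqrt.tendsto _).comp h3
  simpa [Function.comp_def, Real.sqrt_sq] using h4

end Propagator

/-! ### The operator `|D|^κ` as a pairing with Schwartz functions -/

section Pairing

variable {n : ℕ} {κ : ℝ}

/-- The symbol of `|D|^κ`. -/
def absPow (κ : ℝ) (ξ : Rn n) : ℝ := ‖(2 * Real.pi) • ξ‖ ^ κ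

theorem measurable_absPow (κ : ℝ) : Measurable (absPow (n := n) κ) := by
  unfold absPow; fun_prop

theorem memLp_absPow_mul (hκ : 0 ≤ κ) (φ : 𝓢(Rn n, ℂ)) (p : ℝ≥0∞) :
    MemLp (fun ξ => (absPow κ ξ : ℂ) * φ ξ) p := by
  refine ((SchwartzMap.smulLeftCLM ℂ (fun x : Rn n => (1 + ‖x‖ ^ 2) ^ (κ / 2)) φ).memLp
    p).of_le_mul (c := (2 * Real.pi) ^ κ) ?_ (ae_of_all _ fun ξ => ?_)
  · have := measurable_absPow (n := n) κ
    have := φ.continuous.measurable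
    exact Measurable.aestronglyMeasurable (by fun_prop)
  · have hπ := Real.pi_pos
    have e1 : ‖(absPow κ ξ : ℂ)‖ = (2 * Real.pi) ^ κ * ‖ξ‖ ^ κ := by
      rw [Complex.norm_real, absPow, Real.norm_of_nonneg (by positivity), norm_smul,
        Real.norm_of_nonneg (by positivity), Real.mul_rpow (by positivity) (norm_nonneg _)]
    have e2 : ‖(1 + ‖ξ‖ ^ 2) ^ (κ / 2)‖ = (1 + ‖ξ‖ ^ 2) ^ (κ / 2) :=
      Real.norm_of_nonneg (by positivity)
    rw [SchwartzMap.smulLeftCLM_apply_apply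
      (Function.hasTemperateGrowth_one_add_norm_sq_rpow (Rn n) (κ / 2)), norm_smul, norm_mul, e1, e2,
      ← mul_assoc]
    gcongr
    have h1 : ‖ξ‖ = (‖ξ‖ ^ 2) ^ (1 / 2 : ℝ) := by
      rw [← Real.sqrt_eq_rpow, Real.sqrt_sq (norm_nonneg _)]
    calc ‖ξ‖ ^ κ = (‖ξ‖ ^ 2) ^ (κ / 2) := by
          conv_lhs => rw [h1]
          rw [← Real.rpow_mul (by positivity)]
          congr 1; ring
      _ ≤ (1 + ‖ξ‖ ^ 2) ^ (κ / 2) :=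
          Real.rpow_le_rpow (by positivity) (by linarith) (by linarith)

/-- The functional `u ↦ ∫ |2πξ|^κ (𝓕 u)(ξ) φ(ξ) dξ`. -/
def absPairing (hκ : 0 ≤ κ) (φ : 𝓢(Rn n, ℂ)) : L2 n →L[ℂ] ℂ :=
  (innerSL ℂ ((memLp_absPow_mul hκ φ 2).star.toLp _)).comp
    (Lp.fourierTransformₗᵢ (Rn n) ℂ).toContinuousLinearEquiv.toContinuousLinearMap

theorem absPairing_apply (hκ : 0 ≤ κ) (φ : 𝓢(Rn n, ℂ)) (u : L2 n) :
    absPairing hκ φ u = ∫ ξ, (absPow κ ξ : ℂ) * (𝓕 u : L2 n) ξ * φ ξ := by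
  have h0 : absPairing hκ φ u
      = inner ℂ ((memLp_absPow_mul hκ φ 2).star.toLp _) (𝓕 u : L2 n) := rfl
  rw [h0, L2.inner_def]
  refine integral_congr_ae ?_
  filter_upwards [(memLp_absPow_mul hκ φ 2).star.coeFn_toLp] with ξ h
  rw [h, RCLike.inner_apply, Pi.star_apply, RCLike.star_def, RCLike.conj_conj]
  ring

/-- In this form the dependence on `u` is a continuous linear functional, which commutes with
Bochner integrals, finite sums and limits. -/
theorem isAbsDPow_iff (hκ : 0 ≤ κ) (u : L2 n) (v : Rn n → ℂ) :
    IsAbsDPow κ u v ↔ ∀ φ : 𝓢(Rn n, ℂ),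
      Integrable (fun x : Rn n => v x * (𝓕 φ : 𝓢(Rn n, ℂ)) x) ∧
      ∫ x : Rn n, v x * (𝓕 φ : 𝓢(Rn n, ℂ)) x = absPairing hκ φ u := by
  simp_rw [absPairing_apply]
  rfl

theorem IsAbsDPow.sum (hκ : 0 ≤ κ) {α : Type*} (I : Finset α) (c : α → ℂ) {u : α → L2 n}
    {v : α → Rn n → ℂ} (h : ∀ i ∈ I, IsAbsDPow κ (u i) (v i)) :
    IsAbsDPow κ (∑ i ∈ I, c i • u i) (fun x => ∑ i ∈ I, c i * v i x) := by
  rw [isAbsDPow_iff hκ]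
  intro φ
  have h1 : (fun x : Rn n => (∑ i ∈ I, c i * v i x) * (𝓕 φ : 𝓢(Rn n, ℂ)) x)
      = fun x => ∑ i ∈ I, c i * (v i x * (𝓕 φ : 𝓢(Rn n, ℂ)) x) := by
    funext x
    rw [Finset.sum_mul]
    exact Finset.sum_congr rfl fun i _ => by ring
  have h2 : ∀ i ∈ I, Integrable fun x => c i * (v i x * (𝓕 φ : 𝓢(Rn n, ℂ)) x) := fun i hi =>
    ((isAbsDPow_iff hκ _ _).1 (h i hi) φ).1.const_mul _
  rw [h1]
  refine ⟨integrable_finsetSum I h2, ?_⟩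
  rw [integral_finsetSum I h2, map_sum]
  refine Finset.sum_congr rfl fun i hi => ?_
  rw [integral_const_mul, ((isAbsDPow_iff hκ _ _).1 (h i hi) φ).2, map_smul, smul_eq_mul]

end Pairing

/-! ### The Duhamel integral of a tensor product -/

section Tensor

variable {n : ℕ} {κ s : ℝ} {a : Rn n → ℝ} {A : Set ℝ}

/-- The function `1_A ⊗ h`. -/
def tensor (A : Set ℝ) (h : Rn n → ℂ) (y : ℝ × Rn n) : ℂ :=
  A.indicator (fun _ => (1 : ℂ)) y.1 * h y.2

theorem measurable_tensor (hA : MeasurableSet A) (h : 𝓢(Rn n, ℂ)) :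
    Measurable (tensor A h) := by
  have h1 : Measurable (A.indicator fun _ => (1 : ℂ)) := measurable_const.indicator hA
  have h2 := h.continuous.measurable
  unfold tensor
  fun_prop

theorem memLp_tensor_slice (h : 𝓢(Rn n, ℂ)) (τ : ℝ) :
    MemLp (fun x => tensor A h (τ, x)) 2 := (h.memLp 2 volume).const_mul (A.indicator (fun _ => (1 : ℂ)) τ)

theorem slice_tensor (h : 𝓢(Rn n, ℂ)) (τ : ℝ) :
    slice (tensor A h) τ = A.indicator (fun _ => (1 : ℂ)) τ • h.toLp 2 volume := by
  rw [slice, dif_pos (memLp_tensor_slice h τ)]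
  rfl

theorem slice_sum_tensor {α : Type*} (I : Finset α) (c : α → ℂ) (A : α → Set ℝ)
    (h : α → 𝓢(Rn n, ℂ)) (τ : ℝ) :
    slice (fun y => ∑ i ∈ I, c i * tensor (A i) (h i) y) τ
      = ∑ i ∈ I, c i • slice (tensor (A i) (h i)) τ := by
  have hm : MemLp (fun x => ∑ i ∈ I, c i * tensor (A i) (h i) (τ, x)) 2 :=
    memLp_finsetSum I fun i _ => (memLp_tensor_slice (h i) τ).const_mul _
  refine Lp.ext ?_
  have h1 : ∀ i, (c i • slice (tensor (A i) (h i)) τ : L2 n) =ᵐ[volume]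
      fun x => c i * tensor (A i) (h i) (τ, x) := fun i => by
    filter_upwards [Lp.coeFn_smul (c i) (slice (tensor (A i) (h i)) τ),
      slice_coeFn (memLp_tensor_slice (A := A i) (h i) τ)] with x h1 h2
    rw [h1, Pi.smul_apply, h2, smul_eq_mul]
  have h2 : (∑ i ∈ I, c i • slice (tensor (A i) (h i)) τ : L2 n) =ᵐ[volume]
      fun x => ∑ i ∈ I, c i * tensor (A i) (h i) (τ, x) := by
    have h3 : ∀ᵐ x, ∀ i ∈ I, (c i • slice (tensor (A i) (h i)) τ : L2 n) x
        = c i * tensor (A i) (h i) (τ, x) :=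
      (Filter.eventually_all_finset I).2 fun i _ => h1 i
    filter_upwards [Lp.coeFn_finsetSum I fun i => (c i • slice (tensor (A i) (h i)) τ : L2 n), h3]
      with x h4 h5
    rw [h4]
    simp only [Finset.sum_apply]
    exact Finset.sum_congr rfl fun i hi => h5 i hi
  exact (slice_coeFn hm).trans h2.symm

theorem propagator_slice_tensor (ha : Measurable a) (h : 𝓢(Rn n, ℂ)) (t τ : ℝ) :
    propagator a (t - τ) (slice (tensor A h) τ)
      = A.indicator (fun _ => (1 : ℂ)) τ • propagator a (t - τ) (h.toLp 2 volume) := by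
  rw [slice_tensor, propagator_smul ha]

theorem aestronglyMeasurable_propagator_tensor (ha : Measurable a) (hA : MeasurableSet A)
    (h : 𝓢(Rn n, ℂ)) (t : ℝ) :
    AEStronglyMeasurable fun τ => propagator a (t - τ) (slice (tensor A h) τ) := by
  simp_rw [propagator_slice_tensor ha]
  have h1 : Measurable (A.indicator fun _ => (1 : ℂ)) := measurable_const.indicator hA
  have h2 : Continuous fun τ => propagator a (t - τ) (h.toLp 2 volume) :=
    (continuous_propagator ha _).comp (by fun_prop)
  exact h1.aestronglyMeasurable.smul h2.aestronglyMeasurable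

theorem intervalIntegrable_propagator_tensor (ha : Measurable a) (hA : MeasurableSet A)
    (h : 𝓢(Rn n, ℂ)) (t b : ℝ) :
    IntervalIntegrable (fun τ => propagator a (t - τ) (slice (tensor A h) τ)) volume 0 b := by
  refine (intervalIntegrable_const (c := ‖h.toLp 2 volume‖)).mono_fun
    (aestronglyMeasurable_propagator_tensor ha hA h t).restrict (ae_of_all _ fun τ => ?_)
  simp only [propagator_slice_tensor ha, norm_smul, norm_propagator ha, norm_norm]
  refine mul_le_of_le_one_left (norm_nonneg _) ?_
  by_cases hτ : τ ∈ A
  · simp [hτ]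
  · simp [hτ]

/-- This links the abstract Bochner integral with the explicit `duhamelField`: the functional
`absPairing` is moved inside the integral, and Fubini turns the integral over `τ` into
`duhamelFactor`. -/
theorem isAbsDPow_duhamel_tensor (hκ : 0 ≤ κ) (ha : Measurable a) (hA : MeasurableSet A)
    (hA' : volume A ≠ ⊤) (h : 𝓢(Rn n, ℂ)) (t : ℝ) :
    IsAbsDPow κ (duhamel a (tensor A h) t) (fun x =>
      duhamelField (absPow κ) (fun ξ => a ((2 * Real.pi) • ξ)) A h (t, x)) := by
  have hp : Measurable fun ξ : Rn n => a ((2 * Real.pi) • ξ) := by fun_prop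
  have hfc : (𝓕 (h : Rn n → ℂ)) = (𝓕 h : 𝓢(Rn n, ℂ)) := (SchwartzMap.fourier_coe h).symm
  have hS : Measurable fun ξ : Rn n => duhamelFactor A (a ((2 * Real.pi) • ξ)) t :=
    (measurable_duhamelFactor hA).comp
      (f := fun ξ : Rn n => (a ((2 * Real.pi) • ξ), t)) (by fun_prop)
  have hG : Integrable fun ξ => (absPow κ ξ : ℂ) * 𝓕 (h : Rn n → ℂ) ξ *
      duhamelFactor A (a ((2 * Real.pi) • ξ)) t := by
    have h1 : Integrable fun ξ => (absPow κ ξ : ℂ) * 𝓕 (h : Rn n → ℂ) ξ := by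
      rw [hfc]; exact memLp_one_iff_integrable.1 (memLp_absPow_mul hκ _ 1)
    exact h1.mul_bdd (c := (volume A).toReal) hS.aestronglyMeasurable
      (ae_of_all _ fun ξ => norm_duhamelFactor_le hA hA' _ _)
  rw [isAbsDPow_iff hκ]
  intro φ
  refine ⟨?_, ?_⟩
  · refine Integrable.bdd_mul (c := ∫ ξ, ‖(absPow κ ξ : ℂ) * 𝓕 (h : Rn n → ℂ) ξ *
      duhamelFactor A (a ((2 * Real.pi) • ξ)) t‖) (𝓕 φ : 𝓢(Rn n, ℂ)).integrable ?_
      (ae_of_all _ fun x => norm_fourierInv_le x)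
    exact (continuous_fourierInv_of_integrable hG).aestronglyMeasurable
  · have h1 : ∫ x : Rn n, duhamelField (absPow κ) (fun ξ => a ((2 * Real.pi) • ξ)) A h (t, x) *
        (𝓕 φ : 𝓢(Rn n, ℂ)) x = ∫ ξ, φ ξ * ((absPow κ ξ : ℂ) * 𝓕 (h : Rn n → ℂ) ξ *
        duhamelFactor A (a ((2 * Real.pi) • ξ)) t) := by
      have h2 := integral_mul_fourierInv (𝓕 φ : 𝓢(Rn n, ℂ)).integrable hG
      have h3 : 𝓕⁻ ((𝓕 φ : 𝓢(Rn n, ℂ)) : Rn n → ℂ) = φ := by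
        rw [← SchwartzMap.fourierInv_coe, FourierTransform.fourierInv_fourier_eq]
      rw [h3] at h2
      rw [← h2]
      exact integral_congr_ae (ae_of_all _ fun x => mul_comm _ _)
    rw [h1, duhamel, ← ContinuousLinearMap.intervalIntegral_comp_comm _
      (intervalIntegrable_propagator_tensor ha hA h t t)]
    have h4 : ∀ τ, absPairing hκ φ (propagator a (t - τ) (slice (tensor A h) τ)) =
        ∫ ξ, ((absPow κ ξ : ℂ) * φ ξ * 𝓕 (h : Rn n → ℂ) ξ) *
          (A.indicator (fun _ => (1 : ℂ)) τ *
            Complex.exp (Complex.I * ((t - τ : ℝ) * a ((2 * Real.pi) • ξ)))) := by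
      intro τ
      rw [propagator_slice_tensor ha, map_smul, absPairing_apply, smul_eq_mul, ← integral_const_mul]
      have h5 : (𝓕 (h.toLp 2 volume) : L2 n) =ᵐ[volume] 𝓕 (h : Rn n → ℂ) := by
        rw [SchwartzMap.toLp_fourier_eq, hfc]
        exact SchwartzMap.coeFn_toLp _ _ _
      refine integral_congr_ae ?_
      filter_upwards [fourier_propagator ha (t - τ) (h.toLp 2 volume), h5] with ξ h6 h7
      rw [h6, h7, mul_assoc Complex.I]
      ring
    simp_rw [h4]
    have hgi : Integrable fun ξ => (absPow κ ξ : ℂ) * φ ξ * 𝓕 (h : Rn n → ℂ) ξ := by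
      rw [hfc]
      exact (memLp_absPow_mul hκ φ 2).integrable_mul ((𝓕 h : 𝓢(Rn n, ℂ)).memLp 2)
    have hAm : Measurable (A.indicator fun _ => (1 : ℂ)) := measurable_const.indicator hA
    have hA1 : ∀ τ, ‖A.indicator (fun _ => (1 : ℂ)) τ‖ ≤ 1 := fun τ => by
      by_cases hτ : τ ∈ A <;> simp [hτ]
    rw [intervalIntegral_integral_swap]
    · refine integral_congr_ae (ae_of_all _ fun ξ => ?_)
      simp only
      rw [intervalIntegral.integral_const_mul, ← duhamelFactor]
      ring
    · have : IsFiniteMeasure ((volume : Measure ℝ).restrict (Set.uIoc 0 t)) :=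
        ⟨by simp [Set.uIoc]⟩
      refine ((integrable_const (1 : ℝ)).mul_prod hgi.norm).mono ?_ (ae_of_all _ fun y => ?_)
      · have hm : Measurable fun y : ℝ × Rn n => A.indicator (fun _ => (1 : ℂ)) y.1 *
            Complex.exp (Complex.I * ((t - y.1 : ℝ) * a ((2 * Real.pi) • y.2))) := by fun_prop
        exact hgi.aestronglyMeasurable.comp_snd.mul hm.aestronglyMeasurable
      · simp only [Function.uncurry, one_mul, norm_norm]
        rw [norm_mul, norm_mul (A.indicator _ _), norm_exp_I_mul, mul_one]
        exact mul_le_of_le_one_right (norm_nonneg _) (hA1 _)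

theorem propagator_slice_sum_tensor (ha : Measurable a) {α : Type*} (I : Finset α) (c : α → ℂ)
    (A : α → Set ℝ) (h : α → 𝓢(Rn n, ℂ)) (t τ : ℝ) :
    propagator a (t - τ) (slice (fun y => ∑ i ∈ I, c i * tensor (A i) (h i) y) τ)
      = ∑ i ∈ I, c i • propagator a (t - τ) (slice (tensor (A i) (h i)) τ) := by
  rw [slice_sum_tensor]
  simp_rw [← propagator_smul ha]
  exact map_sum (propagatorLI ha (t - τ)) _ _

theorem duhamel_sum_tensor (ha : Measurable a) {α : Type*} (I : Finset α) (c : α → ℂ)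
    {A : α → Set ℝ} (hA : ∀ i, MeasurableSet (A i)) (h : α → 𝓢(Rn n, ℂ)) (t : ℝ) :
    duhamel a (fun y => ∑ i ∈ I, c i * tensor (A i) (h i) y) t
      = ∑ i ∈ I, c i • duhamel a (tensor (A i) (h i)) t := by
  simp only [duhamel]
  simp_rw [propagator_slice_sum_tensor ha]
  rw [intervalIntegral.integral_finsetSum]
  · simp_rw [intervalIntegral.integral_smul]
  · exact fun i _ => (intervalIntegrable_propagator_tensor ha (hA i) (h i) t t).smul (c i)

end Tensor

/-! ### Density of weighted tensor products -/

section Density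

variable {n : ℕ} {s : ℝ}

theorem memLp_weighted {r : ℝ} {f : ℝ × Rn n → ℂ} (hf : AEStronglyMeasurable f)
    (h : ∫⁻ t, wsq r (fun x => f (t, x)) ≠ ⊤) : MemLp (weighted r f) 2 volume := by
  refine ⟨aestronglyMeasurable_weighted r hf, ?_⟩
  rw [lintegral_wsq_eq_eLpNorm r hf] at h
  exact lt_top_iff_ne_top.2 fun h0 => h (by rw [h0]; simp)

theorem lintegral_wsq_tensor {A : Set ℝ} (hA : MeasurableSet A) (r : ℝ) (h : Rn n → ℂ) :
    ∫⁻ t, wsq r (fun x => tensor A h (t, x)) = wsq r h * volume A := by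
  rw [← setLIntegral_const, ← lintegral_indicator hA]
  refine lintegral_congr fun t => ?_
  by_cases ht : t ∈ A
  · simp [tensor, ht]
  · simp [tensor, ht, wsq]

theorem memLp_weighted_tensor {A : Set ℝ} (hA : MeasurableSet A) (hA' : volume A ≠ ⊤) (r : ℝ)
    (h : 𝓢(Rn n, ℂ)) : MemLp (weighted r (tensor A h)) 2 volume := by
  refine memLp_weighted (measurable_tensor hA h).aestronglyMeasurable ?_
  rw [lintegral_wsq_tensor hA]
  exact ENNReal.mul_ne_top (wsq_schwartz_ne_top r h) hA'

/-- Index set of the tensor products `1_A ⊗ h`. -/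
abbrev TensorIndex (n : ℕ) : Type :=
  {A : Set ℝ // MeasurableSet A ∧ volume A ≠ ⊤} × 𝓢(Rn n, ℂ)

/-- The space `L²(ℝ × ℝⁿ)`. -/
abbrev L2time (n : ℕ) : Type := Lp (α := ℝ × Rn n) ℂ 2

/-- `⟨x⟩^s (1_A ⊗ h)` as an element of `L²(ℝ × ℝⁿ)`. -/
def tensorLp (s : ℝ) (i : TensorIndex n) : L2time n :=
  (memLp_weighted_tensor i.1.2.1 i.1.2.2 s i.2).toLp _

/-- Multiplication by `⟨x⟩^{-s}` preserves the Schwartz space, so the weighted tensor products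
include all unweighted ones, and density need only be tested without weights. -/
theorem weighted_tensor_schwartz (A : Set ℝ) (g : 𝓢(Rn n, ℂ)) :
    weighted s (tensor A (SchwartzMap.smulLeftCLM ℂ
      (fun x : Rn n => (1 + ‖x‖ ^ 2) ^ (-s / 2)) g)) = tensor A g := by
  funext y
  have h0 : (0 : ℝ) < 1 + ‖y.2‖ ^ 2 := by positivity
  simp only [weighted, tensor]
  rw [SchwartzMap.smulLeftCLM_apply_apply
    (Function.hasTemperateGrowth_one_add_norm_sq_rpow (Rn n) (-s / 2)), Complex.real_smul]
  have h1 : Real.sqrt (1 + ‖y.2‖ ^ 2) ^ s * (1 + ‖y.2‖ ^ 2) ^ (-s / 2) = 1 := by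
    rw [Real.sqrt_eq_rpow, ← Real.rpow_mul h0.le, ← Real.rpow_add h0]
    ring_nf
    exact Real.rpow_zero _
  have h2 : ((Real.sqrt (1 + ‖y.2‖ ^ 2) ^ s : ℝ) : ℂ) * (((1 + ‖y.2‖ ^ 2) ^ (-s / 2) : ℝ) : ℂ)
      = 1 := by
    rw [← Complex.ofReal_mul, h1, Complex.ofReal_one]
  linear_combination (A.indicator (fun _ => (1 : ℂ)) y.1 * g y.2) * h2

/-- A function orthogonal to all tensor products vanishes. -/
theorem eq_zero_of_inner_tensorLp (W : L2time n) (hW : ∀ i, inner ℂ (tensorLp s i) W = 0) :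
    W = 0 := by
  have hWm : MemLp W 2 ((volume : Measure ℝ).prod (volume : Measure (Rn n))) := Lp.memLp W
  have hprod : ∀ (A : Set ℝ), MeasurableSet A → volume A ≠ ⊤ → ∀ g : 𝓢(Rn n, ℂ),
      Integrable (fun y : ℝ × Rn n => (starRingEnd ℂ) (tensor A g y) * W y)
        ((volume : Measure ℝ).prod volume) ∧
      ∫ y : ℝ × Rn n, (starRingEnd ℂ) (tensor A g y) * W y = 0 := by
    intro A hA hA' g
    have hT : MemLp (tensor A g) 2 volume := by
      have := memLp_weighted_tensor hA hA' 0 g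
      rwa [weighted_zero] at this
    refine ⟨hT.star.integrable_mul hWm, ?_⟩
    rw [← hW (⟨A, hA, hA'⟩, SchwartzMap.smulLeftCLM ℂ
      (fun x : Rn n => (1 + ‖x‖ ^ 2) ^ (-s / 2)) g), L2.inner_def]
    refine integral_congr_ae ?_
    filter_upwards [(memLp_weighted_tensor hA hA' s (SchwartzMap.smulLeftCLM ℂ
      (fun x : Rn n => (1 + ‖x‖ ^ 2) ^ (-s / 2)) g)).coeFn_toLp] with y hy
    rw [tensorLp, hy, weighted_tensor_schwartz, RCLike.inner_apply]
    ring
  have hslice := memLp_slice (Lp.memLp W)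
  have hg : ∀ g : 𝓢(Rn n, ℂ), ∀ᵐ t : ℝ, inner ℂ (g.toLp 2 volume) (slice W t) = 0 := by
    intro g
    set Φ : ℝ → ℂ := fun t => ∫ x, (starRingEnd ℂ) (g x) * W (t, x) with hΦ
    have hind : ∀ A : Set ℝ, (fun t => ∫ x, (starRingEnd ℂ) (tensor A g (t, x)) * W (t, x))
        = A.indicator Φ := by
      intro A
      funext t
      by_cases ht : t ∈ A
      · simp [tensor, ht, hΦ]
      · simp [tensor, ht]
    -- Orthogonality to `1_A ⊗ g` for every `A` of finite measure says that all integrals of `Φ`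
    -- over such sets vanish.
    have hzero : Φ =ᵐ[volume] 0 := by
      refine ae_eq_zero_of_forall_setIntegral_eq_of_sigmaFinite (fun A hA hA' => ?_)
        fun A hA hA' => ?_
      · have := (hprod A hA hA'.ne g).1.integral_prod_left
        rw [hind A, integrable_indicator_iff hA] at this
        exact this
      · have h1 := (hprod A hA hA'.ne g).2
        have h2 := integral_prod _ (hprod A hA hA'.ne g).1
        rw [hind A, integral_indicator hA] at h2
        exact h2.symm.trans h1
    filter_upwards [hzero, hslice] with t ht hs
    rw [L2.inner_def, ← (show Φ t = 0 from ht)]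
    refine integral_congr_ae ?_
    filter_upwards [slice_coeFn hs, g.coeFn_toLp 2 volume] with x h1 h2
    rw [h1, h2, RCLike.inner_apply]
    ring
  have hd : DenseRange (SchwartzMap.toLpCLM ℂ (E := Rn n) ℂ 2 volume) :=
    SchwartzMap.denseRange_toLpCLM ENNReal.ofNat_ne_top
  have : Fact ((2 : ℝ≥0∞) ≠ ⊤) := ⟨by simp⟩
  have : SecondCountableTopology (L2 n) := Lp.SecondCountableTopology
  -- The exceptional null set of times depends on `g`; a countable dense family allows one null set
  -- for all of them.
  obtain ⟨S, hSsub, hSc, hSd⟩ := Dense.exists_countable_dense_subset hd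
  have hS : ∀ᵐ t : ℝ, ∀ u ∈ S, inner ℂ u (slice W t) = 0 := by
    refine (ae_ball_iff hSc).2 fun u hu => ?_
    obtain ⟨g, rfl⟩ := hSsub hu
    exact hg g
  have hz : ∀ᵐ t : ℝ, ∫⁻ x : Rn n, ‖W (t, x)‖ₑ ^ 2 = 0 := by
    filter_upwards [hS, hslice] with t h1 h2
    have h3 : slice W t = 0 := by
      have h4 : (fun u : L2 n => (inner ℂ u (slice W t) : ℂ)) = fun _ => 0 :=
        Continuous.ext_on hSd (by fun_prop) continuous_const h1
      exact inner_self_eq_zero.1 (congrFun h4 (slice W t))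
    have h5 := enorm_L2_sq (slice W t)
    rw [h3, enorm_zero, zero_pow two_ne_zero] at h5
    have h6 := slice_coeFn h2
    rw [h3] at h6
    rw [h5]
    refine lintegral_congr_ae ?_
    filter_upwards [h6] with x hx
    rw [hx]
  have h7 := lintegral_slice_sq (Lp.memLp W).1
  rw [lintegral_congr_ae hz, lintegral_zero] at h7
  have h8 : eLpNorm W 2 volume = 0 := by simpa using h7.symm
  rw [← enorm_eq_zero, Lp.enorm_def]
  exact h8

/-- Finite sums of weighted tensor products. -/
def tensorSum (n : ℕ) (s : ℝ) : (TensorIndex n →₀ ℂ) →ₗ[ℂ] L2time n :=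
  Finsupp.linearCombination ℂ (tensorLp s)

theorem denseRange_tensorSum (n : ℕ) (s : ℝ) : DenseRange (tensorSum n s) := by
  have h1 : Dense ((LinearMap.range (tensorSum n s) : Submodule ℂ (L2time n)) : Set (L2time n)) := by
    rw [tensorSum, Finsupp.range_linearCombination, Submodule.dense_iff_topologicalClosure_eq_top,
      Submodule.topologicalClosure_eq_top_iff, Submodule.eq_bot_iff]
    intro W hW
    exact eq_zero_of_inner_tensorLp W fun i =>
      (Submodule.mem_orthogonal _ _).1 hW _ (Submodule.subset_span ⟨i, rfl⟩)
  exact h1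

theorem coeFn_linearCombination_toLp {α β : Type*} [MeasurableSpace β] {μ : Measure β}
    {f : α → β → ℂ} (hf : ∀ i, MemLp (f i) 2 μ) (D : α →₀ ℂ) :
    (Finsupp.linearCombination ℂ (fun i => (hf i).toLp (f i)) D : Lp ℂ 2 μ) =ᵐ[μ]
      fun y => ∑ i ∈ D.support, D i * f i y := by
  rw [Finsupp.linearCombination_apply, Finsupp.sum]
  have h3 : ∀ᵐ y ∂μ, ∀ i ∈ D.support, (D i • (hf i).toLp (f i) : Lp ℂ 2 μ) y = D i * f i y := by
    refine (Filter.eventually_all_finset _).2 fun i _ => ?_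
    filter_upwards [Lp.coeFn_smul (D i) ((hf i).toLp (f i)), (hf i).coeFn_toLp] with y h1 h2
    rw [h1, Pi.smul_apply, h2, smul_eq_mul]
  filter_upwards [Lp.coeFn_finsetSum D.support fun i => (D i • (hf i).toLp (f i) : Lp ℂ 2 μ), h3]
    with y h4 h5
  rw [h4]
  simp only [Finset.sum_apply]
  exact Finset.sum_congr rfl fun i hi => h5 i hi

end Density

/-! ### Passage to the limit in `|D|^κ u = v` -/

section Limit

variable {n : ℕ} {κ s : ℝ}

theorem tendsto_of_enorm_sub_sq {E ι : Type*} [NormedAddCommGroup E] {l : Filter ι} {u : ι → E}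
    {v : E} (h : Filter.Tendsto (fun i => ‖u i - v‖ₑ ^ 2) l (nhds 0)) :
    Filter.Tendsto u l (nhds v) := by
  rw [tendsto_iff_norm_sub_tendsto_zero]
  have h3 := (ENNReal.tendsto_toReal ENNReal.zero_ne_top).comp h
  have h4 := (Real.continuous_sqrt.tendsto _).comp h3
  simpa [Function.comp_def, Real.sqrt_sq] using h4

theorem tendsto_zero_of_sq_le {ι : Type*} {l : Filter ι} {x y : ι → ℝ≥0∞} {c : ℝ≥0∞} (hc : c ≠ ⊤)
    (hxy : ∀ i, x i ^ 2 ≤ y i * c) (hy : Filter.Tendsto y l (nhds 0)) :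
    Filter.Tendsto x l (nhds 0) := by
  have h1 : Filter.Tendsto (fun i => y i * c) l (nhds 0) := by
    simpa using ENNReal.Tendsto.mul_const hy (Or.inr hc)
  have h2 : Filter.Tendsto (fun i => x i ^ 2) l (nhds 0) :=
    tendsto_of_tendsto_of_tendsto_of_le_of_le tendsto_const_nhds h1 (fun _ => zero_le) hxy
  have h3 := (ENNReal.continuous_rpow_const (y := 1 / 2)).tendsto 0 |>.comp h2
  refine (h3.congr fun i => ?_).trans_eq (by simp)
  simp only [Function.comp_apply]
  rw [← ENNReal.rpow_two, ← ENNReal.rpow_mul]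
  norm_num

/-- Cauchy–Schwarz with cancelling weights: the duality between the spaces with weights `-s` and
`s`. -/
theorem lintegral_mul_sq_le_wsq {w g : Rn n → ℂ} (hw : AEStronglyMeasurable w)
    (hg : AEStronglyMeasurable g) :
    (∫⁻ x, ‖w x * g x‖ₑ) ^ 2 ≤ wsq (-s) w * wsq s g := by
  have hm : ∀ r : ℝ, AEMeasurable fun x : Rn n => ENNReal.ofReal ((1 + ‖x‖ ^ 2) ^ r) := fun r =>
    (measurable_weight r).ennreal_ofReal.aemeasurable
  have h := lintegral_mul_sq_le ((hm (-s / 2)).mul hw.enorm) ((hm (s / 2)).mul hg.enorm)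
  refine le_of_eq_of_le ?_ (h.trans (le_of_eq ?_))
  · congr 1
    refine lintegral_congr fun x => ?_
    simp only [Pi.mul_apply]
    rw [mul_mul_mul_comm, ofReal_weight_mul, enorm_mul, neg_div, neg_add_cancel, Real.rpow_zero,
      ENNReal.ofReal_one, one_mul]
  · simp only [Pi.mul_apply, mul_pow, wsq]
    simp_rw [sq (ENNReal.ofReal _), ofReal_weight_mul, add_halves]

/-- Both sides of the defining identity converge: the pairing with `v k` because `𝓕 φ` has finite
dual weighted norm, the other side because `absPairing` is continuous on `L²`. -/
theorem isAbsDPow_of_tendsto (hκ : 0 ≤ κ) {u : ℕ → L2 n} {u' : L2 n} {v : ℕ → Rn n → ℂ}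
    {v' : Rn n → ℂ} (hu : Filter.Tendsto u Filter.atTop (nhds u'))
    (h : ∀ k, IsAbsDPow κ (u k) (v k)) (hvm : ∀ k, AEStronglyMeasurable (v k))
    (hvm' : AEStronglyMeasurable v') (hv' : wsq (-s) v' ≠ ⊤)
    (hlim : Filter.Tendsto (fun k => wsq (-s) (fun x => v k x - v' x)) Filter.atTop (nhds 0)) :
    IsAbsDPow κ u' v' := by
  rw [isAbsDPow_iff hκ]
  intro φ
  have hφm : AEStronglyMeasurable ((𝓕 φ : 𝓢(Rn n, ℂ)) : Rn n → ℂ) :=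
    (𝓕 φ : 𝓢(Rn n, ℂ)).continuous.aestronglyMeasurable
  have hφ := wsq_schwartz_ne_top s (𝓕 φ : 𝓢(Rn n, ℂ))
  refine ⟨⟨hvm'.mul hφm, ?_⟩, ?_⟩
  · have h1 := lintegral_mul_sq_le_wsq (s := s) hvm' hφm
    refine lt_top_iff_ne_top.2 fun h0 => ?_
    rw [h0] at h1
    have := ENNReal.mul_ne_top hv' hφ
    simp at h1
    exact this h1
  · have h1 : Filter.Tendsto (fun k => ∫⁻ x, ‖v k x * (𝓕 φ : 𝓢(Rn n, ℂ)) x -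
        v' x * (𝓕 φ : 𝓢(Rn n, ℂ)) x‖ₑ) Filter.atTop (nhds 0) := by
      refine tendsto_zero_of_sq_le hφ (fun k => ?_) hlim
      simp_rw [← sub_mul]
      exact lintegral_mul_sq_le_wsq ((hvm k).sub hvm') hφm
    have h2 := tendsto_integral_of_L1 _ (hvm'.mul hφm)
      (Filter.Eventually.of_forall fun k => ((isAbsDPow_iff hκ _ _).1 (h k) φ).1) h1
    simp_rw [((isAbsDPow_iff hκ _ _).1 (h _) φ).2] at h2
    exact tendsto_nhds_unique h2 (((absPairing hκ φ).continuous.tendsto u').comp hu)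

/-- Geometric decay makes the sum of the `g k` integrable, hence finite almost everywhere, so its
terms tend to zero without passing to a subsequence. -/
theorem ae_tendsto_zero_of_lintegral_le {β : Type*} [MeasurableSpace β] {μ : Measure β}
    {g : ℕ → β → ℝ≥0∞} (hg : ∀ k, AEMeasurable (g k) μ) {c : ℝ≥0∞} (hc : c ≠ ⊤)
    (h : ∀ k, ∫⁻ x, g k x ∂μ ≤ c * 2⁻¹ ^ k) :
    ∀ᵐ x ∂μ, Filter.Tendsto (fun k => g k x) Filter.atTop (nhds 0) := by
  have h1 : ∫⁻ x, ∑' k, g k x ∂μ ≠ ⊤ := by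
    rw [lintegral_tsum hg]
    refine ne_top_of_le_ne_top ?_ (ENNReal.tsum_le_tsum h)
    rw [ENNReal.tsum_mul_left, ENNReal.tsum_geometric]
    exact ENNReal.mul_ne_top hc (by simp)
  filter_upwards [ae_lt_top' (AEMeasurable.tsum hg) h1] with x hx
  exact ENNReal.tendsto_atTop_zero_of_tsum_ne_top hx.ne

theorem aemeasurable_wsq {f : ℝ × Rn n → ℂ} (hf : AEStronglyMeasurable f) (r : ℝ) :
    AEMeasurable fun t => wsq r (fun x => f (t, x)) := by
  have hf' : AEStronglyMeasurable f ((volume : Measure ℝ).prod volume) := hf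
  have := measurable_weight (n := n) r
  have h2 : AEMeasurable (fun y : ℝ × Rn n => ENNReal.ofReal ((1 + ‖y.2‖ ^ 2) ^ r) * ‖f y‖ₑ ^ 2)
      ((volume : Measure ℝ).prod volume) := by
    refine AEMeasurable.mul (Measurable.aemeasurable (by fun_prop)) (hf'.enorm.pow_const 2)
  exact h2.lintegral_prod_right'

theorem lintegral_sq_le_wsq (hs : 0 ≤ s) (f : Rn n → ℂ) : ∫⁻ x, ‖f x‖ₑ ^ 2 ≤ wsq s f := by
  refine lintegral_mono fun x => ?_
  refine le_mul_of_one_le_left zero_le ?_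
  rw [ENNReal.one_le_ofReal]
  exact Real.one_le_rpow (by nlinarith [sq_nonneg ‖x‖]) hs

end Limit

/-! ### Integrability and continuity of the Duhamel integral -/

section Duhamel

variable {n : ℕ} {a : Rn n → ℝ}

theorem lintegral_enorm_slice_sq {f : ℝ × Rn n → ℂ} (hf : MemLp f 2 volume) :
    ∫⁻ τ, ‖slice f τ‖ₑ ^ 2 = eLpNorm f 2 volume ^ 2 := by
  rw [← lintegral_slice_sq hf.1]
  refine lintegral_congr_ae ?_
  filter_upwards [memLp_slice hf] with τ h
  rw [enorm_L2_sq]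
  refine lintegral_congr_ae ?_
  filter_upwards [slice_coeFn h] with x hx
  rw [hx]

theorem enorm_propagator (ha : Measurable a) (t : ℝ) (g : L2 n) :
    ‖propagator a t g‖ₑ = ‖g‖ₑ := by
  rw [← ofReal_norm, ← ofReal_norm, norm_propagator ha]

theorem propagator_sub (ha : Measurable a) (t : ℝ) (g h : L2 n) :
    propagator a t (g - h) = propagator a t g - propagator a t h :=
  map_sub (propagatorLI ha t) g h

theorem lintegral_uIoc_sq_le (t : ℝ) {g : ℝ → ℝ≥0∞} (hg : AEMeasurable g) :
    (∫⁻ τ in Set.uIoc 0 t, g τ) ^ 2 ≤ (∫⁻ τ, g τ ^ 2) * ENNReal.ofReal |t| := by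
  have h := lintegral_mul_sq_le (μ := volume.restrict (Set.uIoc 0 t)) hg.restrict
    (aemeasurable_const (b := (1 : ℝ≥0∞)))
  simp only [mul_one, one_pow, lintegral_const, one_mul, Measure.restrict_apply_univ,
    Real.volume_uIoc, sub_zero] at h
  exact h.trans (mul_le_mul_left (setLIntegral_le_lintegral _ _) _)

/-- The propagator is isometric and the slice norms are square integrable in time, so Cauchy–Schwarz
on the bounded interval suffices once measurability is known. -/
theorem intervalIntegrable_propagator_slice (ha : Measurable a) {f : ℝ × Rn n → ℂ}
    (hf : MemLp f 2 volume) {t : ℝ}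
    (hm : AEStronglyMeasurable fun τ => propagator a (t - τ) (slice f τ)) :
    IntervalIntegrable (fun τ => propagator a (t - τ) (slice f τ)) volume 0 t := by
  rw [intervalIntegrable_iff]
  refine ⟨hm.restrict, ?_⟩
  have h := lintegral_uIoc_sq_le t hm.enorm
  simp_rw [enorm_propagator ha, lintegral_enorm_slice_sq hf] at h
  refine lt_top_iff_ne_top.2 fun h0 => ?_
  simp_rw [enorm_propagator ha] at h0
  rw [h0] at h
  have h1 : eLpNorm f 2 volume ^ 2 * ENNReal.ofReal |t| ≠ ⊤ :=
    ENNReal.mul_ne_top (ENNReal.pow_ne_top hf.2.ne) ENNReal.ofReal_ne_top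
  simp at h
  exact h1 h

/-- The Duhamel integral depends continuously on the source. -/
theorem enorm_duhamel_sub_sq_le (ha : Measurable a) {f g : ℝ × Rn n → ℂ}
    (hf : MemLp f 2 volume) (hg : MemLp g 2 volume) {t : ℝ}
    (hfm : AEStronglyMeasurable fun τ => propagator a (t - τ) (slice f τ))
    (hgm : AEStronglyMeasurable fun τ => propagator a (t - τ) (slice g τ)) :
    ‖duhamel a f t - duhamel a g t‖ₑ ^ 2 ≤
      (∫⁻ τ, ∫⁻ x, ‖f (τ, x) - g (τ, x)‖ₑ ^ 2) * ENNReal.ofReal |t| := by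
  rw [duhamel, duhamel, ← intervalIntegral.integral_sub
    (intervalIntegrable_propagator_slice ha hf hfm)
    (intervalIntegrable_propagator_slice ha hg hgm)]
  have h1 : ‖∫ τ in (0 : ℝ)..t, (propagator a (t - τ) (slice f τ) -
      propagator a (t - τ) (slice g τ))‖ₑ ≤ ∫⁻ τ in Set.uIoc 0 t,
      ‖propagator a (t - τ) (slice f τ) - propagator a (t - τ) (slice g τ)‖ₑ := by
    rw [← ofReal_norm, intervalIntegral.norm_intervalIntegral_eq, ofReal_norm]
    exact enorm_integral_le_lintegral_enorm _
  refine (pow_le_pow_left' h1 2).trans ((lintegral_uIoc_sq_le t (hfm.sub hgm).enorm).trans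
    (le_of_eq ?_))
  congr 1
  refine lintegral_congr_ae ?_
  filter_upwards [memLp_slice hf, memLp_slice hg] with τ h2 h3
  rw [← enorm_slice_sub_sq h2 h3, Pi.sub_apply, ← propagator_sub ha, enorm_propagator ha]

end Duhamel

/-! ### Extension from tensor sums to general sources -/

section Estimate

variable {n : ℕ} {κ s : ℝ} {a : Rn n → ℝ} {K : ℝ≥0}

theorem aestronglyMeasurable_propagator_sum_tensor (ha : Measurable a) {α : Type*} (I : Finset α)
    (c : α → ℂ) {A : α → Set ℝ} (hA : ∀ i, MeasurableSet (A i)) (h : α → 𝓢(Rn n, ℂ)) (t : ℝ) :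
    AEStronglyMeasurable fun τ =>
      propagator a (t - τ) (slice (fun y => ∑ i ∈ I, c i * tensor (A i) (h i) y) τ) := by
  simp_rw [propagator_slice_sum_tensor ha]
  refine Finset.aestronglyMeasurable_fun_sum I fun i _ => ?_
  exact (aestronglyMeasurable_propagator_tensor ha (hA i) (h i) t).const_smul (c i)

/-- The sum of tensor products with coefficients `D`. -/
def source (D : TensorIndex n →₀ ℂ) (y : ℝ × Rn n) : ℂ :=
  ∑ i ∈ D.support, D i * tensor i.1.1 i.2 y

/-- `|D|^κ` applied to the Duhamel integral of `source D`. -/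
def response (κ : ℝ) (a : Rn n → ℝ) (D : TensorIndex n →₀ ℂ) (y : ℝ × Rn n) : ℂ :=
  ∑ i ∈ D.support, D i *
    duhamelField (absPow κ) (fun ξ => a ((2 * Real.pi) • ξ)) i.1.1 i.2 y

theorem measurable_source (D : TensorIndex n →₀ ℂ) : Measurable (source D) := by
  have := fun i : TensorIndex n => measurable_tensor i.1.2.1 i.2
  unfold source
  fun_prop

theorem measurable_response (κ : ℝ) (ha : Measurable a) (D : TensorIndex n →₀ ℂ) :
    Measurable (response κ a D) := by
  have := fun i : TensorIndex n => measurable_duhamelField (measurable_absPow κ)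
    (show Measurable fun ξ : Rn n => a ((2 * Real.pi) • ξ) by fun_prop) i.1.2.1 i.2.integrable
  unfold response
  fun_prop

theorem coeFn_tensorSum (s : ℝ) (D : TensorIndex n →₀ ℂ) :
    tensorSum n s D =ᵐ[volume] weighted s (source D) := by
  have h := coeFn_linearCombination_toLp
    (fun i : TensorIndex n => memLp_weighted_tensor i.1.2.1 i.1.2.2 s i.2) D
  have h2 : weighted s (source D) = _ :=
    weighted_sum s D.support D (fun i => tensor i.1.1 i.2)
  rw [h2]
  exact h

theorem ResolventBound.lintegral_response_le
    (hb : ResolventBound (absPow κ) (fun ξ : Rn n => a ((2 * Real.pi) • ξ)) s K)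
    (ha : Measurable a) (hκ : 0 ≤ κ) (hs : 0 ≤ s) {α : Type*} (I : Finset α) (c : α → ℂ)
    (i : α → TensorIndex n) :
    ∫⁻ t, wsq (-s) (fun x => ∑ k ∈ I, c k * duhamelField (absPow κ)
        (fun ξ => a ((2 * Real.pi) • ξ)) (i k).1.1 (i k).2 (t, x)) ≤
      K ^ 2 * ∫⁻ t, wsq s (fun x => ∑ k ∈ I, c k * tensor (i k).1.1 (i k).2 (t, x)) :=
  hb.lintegral_duhamelField_le (measurable_absPow κ) (by fun_prop) hs
    (fun φ => memLp_one_iff_integrable.1 (memLp_absPow_mul hκ φ 1)) I c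
    (fun k => (i k).1.2.1) (fun k => (i k).1.2.2) fun k => (i k).2

theorem ResolventBound.memLp_weighted_duhamelField
    (hb : ResolventBound (absPow κ) (fun ξ : Rn n => a ((2 * Real.pi) • ξ)) s K)
    (ha : Measurable a) (hκ : 0 ≤ κ) (hs : 0 ≤ s) (i : TensorIndex n) :
    MemLp (weighted (-s) (duhamelField (absPow κ) (fun ξ => a ((2 * Real.pi) • ξ)) i.1.1 i.2)) 2
      volume := by
  refine memLp_weighted (measurable_duhamelField (measurable_absPow κ) (by fun_prop) i.1.2.1
    i.2.integrable).aestronglyMeasurable ?_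
  have h := hb.lintegral_response_le ha hκ hs {()} (fun _ => 1) (fun _ => i)
  simp only [Finset.sum_singleton, one_mul] at h
  refine ne_top_of_le_ne_top ?_ h
  rw [lintegral_wsq_tensor i.1.2.1]
  exact ENNReal.mul_ne_top (by simp) (ENNReal.mul_ne_top (wsq_schwartz_ne_top s i.2) i.1.2.2)

/-- The smoothing estimate for the Duhamel integral, given a resolvent bound. -/
theorem ResolventBound.exists_smoothing
    (hb : ResolventBound (absPow κ) (fun ξ : Rn n => a ((2 * Real.pi) • ξ)) s K)
    (ha : Measurable a) (hκ : 0 ≤ κ) (hs : 0 ≤ s) {f : ℝ × Rn n → ℂ}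
    (hf : MemLp (weighted s f) 2 volume) :
    (∀ t : ℝ, IntervalIntegrable (fun τ : ℝ => propagator a (t - τ) (slice f τ)) volume 0 t) ∧
      ∃ v : ℝ × Rn n → ℂ, (∀ᵐ t : ℝ, IsAbsDPow κ (duhamel a f t) (fun x => v (t, x))) ∧
        MemLp (weighted (-s) v) 2 volume ∧
        eLpNorm (weighted (-s) v) 2 volume ≤ K * eLpNorm (weighted s f) 2 volume := by
  have hF := hb.memLp_weighted_duhamelField ha hκ hs
  set R : (TensorIndex n →₀ ℂ) →ₗ[ℂ] L2time n :=
    Finsupp.linearCombination ℂ fun i => (hF i).toLp _ with hR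
  have hRc : ∀ D, R D =ᵐ[volume] weighted (-s) (response κ a D) := fun D => by
    have h2 : weighted (-s) (response κ a D) = _ :=
      weighted_sum (-s) D.support D (fun i => duhamelField (absPow κ)
        (fun ξ => a ((2 * Real.pi) • ξ)) i.1.1 i.2)
    rw [h2]
    exact coeFn_linearCombination_toLp hF D
  have hdense := denseRange_tensorSum n s
  -- This also shows that `R D` depends on the sum alone and not on its representation `D`, so that
  -- `R` induces a bounded operator on the closure.
  have hbound : ∀ D, ‖R D‖ ≤ K * ‖tensorSum n s D‖ := by
    intro D
    have h1 : ‖R D‖ₑ ^ 2 ≤ (K * ‖tensorSum n s D‖ₑ) ^ 2 := by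
      rw [mul_pow, Lp.enorm_def, Lp.enorm_def, eLpNorm_congr_ae (hRc D),
        eLpNorm_congr_ae (coeFn_tensorSum s D),
        ← lintegral_wsq_eq_eLpNorm _ (measurable_response κ ha D).aestronglyMeasurable,
        ← lintegral_wsq_eq_eLpNorm _ (measurable_source D).aestronglyMeasurable]
      exact hb.lintegral_response_le ha hκ hs D.support D id
    have h2 : ‖R D‖ₑ ≤ K * ‖tensorSum n s D‖ₑ := (ENNReal.pow_le_pow_left_iff two_ne_zero).1 h1
    have h3 := ENNReal.toReal_mono (ENNReal.mul_ne_top (by simp) (by simp)) h2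
    simpa using h3
  set T : L2time n →L[ℂ] L2time n := R.extendOfNorm (tensorSum n s) with hT
  have hTR : ∀ D, T (tensorSum n s D) = R D := LinearMap.extendOfNorm_eq hdense ⟨K, hbound⟩
  have hTn : ∀ W, ‖T W‖ ≤ K * ‖W‖ := LinearMap.norm_extendOfNorm_apply_le hdense K hbound
  have hTe : ∀ W, ‖T W‖ₑ ≤ K * ‖W‖ₑ := fun W => by
    rw [← ofReal_norm, ← ofReal_norm, ← ENNReal.ofReal_coe_nnreal,
      ← ENNReal.ofReal_mul K.coe_nonneg]
    exact ENNReal.ofReal_le_ofReal (hTn W)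
  set W : L2time n := hf.toLp _ with hW
  set v : ℝ × Rn n → ℂ := weighted s (T W) with hv
  have hvw : weighted (-s) v = T W := weighted_neg_weighted s _
  have hvm : AEStronglyMeasurable v :=
    aestronglyMeasurable_weighted s (Lp.aestronglyMeasurable (T W))
  have hfm : AEStronglyMeasurable f := aestronglyMeasurable_of_weighted s hf.1
  have hf2 : MemLp f 2 volume := by
    refine ⟨hfm, lt_of_le_of_lt ?_ hf.2⟩
    have := eLpNorm_weighted_mono hs f
    rwa [weighted_zero] at this
  -- Geometric speed of approximation, so that the weighted norms of the slices converge for almost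
  -- every time.
  have hex : ∀ k : ℕ, ∃ D, ‖tensorSum n s D - W‖ ≤ (1 / 2) ^ k := fun k => by
    obtain ⟨D, hD⟩ := hdense.exists_dist_lt W (show (0 : ℝ) < (1 / 2) ^ k by positivity)
    exact ⟨D, by rw [← dist_eq_norm, dist_comm]; exact hD.le⟩
  choose D hD using hex
  have hDe : ∀ k, ‖tensorSum n s (D k) - W‖ₑ ^ 2 ≤ 2⁻¹ ^ k := fun k => by
    have h1 : ‖tensorSum n s (D k) - W‖ₑ ≤ 2⁻¹ ^ k := by
      rw [← ofReal_norm]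
      refine (ENNReal.ofReal_le_ofReal (hD k)).trans (le_of_eq ?_)
      rw [ENNReal.ofReal_pow (by norm_num), one_div, ENNReal.ofReal_inv_of_pos two_pos,
        ENNReal.ofReal_ofNat]
    calc _ = ‖tensorSum n s (D k) - W‖ₑ * ‖tensorSum n s (D k) - W‖ₑ := sq _
      _ ≤ 2⁻¹ ^ k * 1 := mul_le_mul' h1 (h1.trans (pow_le_one' (by simp) k))
      _ = _ := mul_one _
  -- the weighted differences
  have hdiffm : ∀ k, AEStronglyMeasurable fun y => source (D k) y - f y := fun k =>
    (measurable_source (D k)).aestronglyMeasurable.sub hfm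
  have hdiff : ∀ k, ∫⁻ t, wsq s (fun x => source (D k) (t, x) - f (t, x)) ≤ 2⁻¹ ^ k := by
    intro k
    refine le_of_eq_of_le ?_ (hDe k)
    rw [lintegral_wsq_eq_eLpNorm s (hdiffm k), Lp.enorm_def]
    congr 1
    refine eLpNorm_congr_ae ?_
    filter_upwards [Lp.coeFn_sub (tensorSum n s (D k)) W, coeFn_tensorSum s (D k), hf.coeFn_toLp]
      with y h1 h2 h3
    rw [h1, Pi.sub_apply, h2, hW, h3]
    simp only [weighted]
    ring
  have hrespm : ∀ k, AEStronglyMeasurable fun y => response κ a (D k) y - v y := fun k =>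
    (measurable_response κ ha (D k)).aestronglyMeasurable.sub hvm
  have hresp : ∀ k, ∫⁻ t, wsq (-s) (fun x => response κ a (D k) (t, x) - v (t, x)) ≤
      (K : ℝ≥0∞) ^ 2 * 2⁻¹ ^ k := by
    intro k
    have h0 : ‖R (D k) - T W‖ₑ ^ 2 ≤ (K : ℝ≥0∞) ^ 2 * 2⁻¹ ^ k := by
      rw [← hTR, ← map_sub]
      calc _ ≤ (K * ‖tensorSum n s (D k) - W‖ₑ) ^ 2 := pow_le_pow_left' (hTe _) 2
        _ = K ^ 2 * ‖tensorSum n s (D k) - W‖ₑ ^ 2 := mul_pow _ _ _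
        _ ≤ _ := mul_le_mul_right (hDe k) _
    refine le_of_eq_of_le ?_ h0
    rw [lintegral_wsq_eq_eLpNorm (-s) (hrespm k), Lp.enorm_def]
    congr 1
    refine eLpNorm_congr_ae ?_
    filter_upwards [Lp.coeFn_sub (R (D k)) (T W), hRc (D k)] with y h1 h2
    rw [h1, Pi.sub_apply, h2, ← congrFun hvw y]
    simp only [weighted]
    ring
  have hsource2 : ∀ k, MemLp (source (D k)) 2 volume := fun k => by
    refine ⟨(measurable_source (D k)).aestronglyMeasurable, lt_of_le_of_lt ?_
      (Lp.memLp (tensorSum n s (D k))).2⟩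
    rw [eLpNorm_congr_ae (coeFn_tensorSum s (D k))]
    have := eLpNorm_weighted_mono hs (source (D k))
    rwa [weighted_zero] at this
  have hsrcm : ∀ k t, AEStronglyMeasurable fun τ => propagator a (t - τ) (slice (source (D k)) τ) :=
    fun k t => aestronglyMeasurable_propagator_sum_tensor ha (D k).support (D k)
      (A := fun i => i.1.1) (fun i => i.1.2.1) (fun i => i.2) t
  have hslim : ∀ᵐ τ, Filter.Tendsto (fun k => slice (source (D k)) τ) Filter.atTop
      (nhds (slice f τ)) := by
    have h1 := ae_tendsto_zero_of_lintegral_le (fun k => aemeasurable_wsq (hdiffm k) s)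
      ENNReal.one_ne_top (fun k => by rw [one_mul]; exact hdiff k)
    filter_upwards [h1, ae_all_iff.2 fun k => memLp_slice (hsource2 k), memLp_slice hf2]
      with τ h2 h3 h4
    refine tendsto_of_enorm_sub_sq (tendsto_of_tendsto_of_tendsto_of_le_of_le tendsto_const_nhds
      h2 (fun _ => zero_le) fun k => ?_)
    simp only [enorm_slice_sub_sq (h3 k) h4]
    exact lintegral_sq_le_wsq hs _
  -- For a general source the integrand is measurable as an almost everywhere limit of the
  -- integrands of tensor sums. The null set in `hslim` does not involve `t`, so this holds for
  -- every `t`.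
  have hpm : ∀ t, AEStronglyMeasurable fun τ => propagator a (t - τ) (slice f τ) := by
    intro t
    refine aestronglyMeasurable_of_tendsto_ae Filter.atTop (hsrcm · t) ?_
    filter_upwards [hslim] with τ hτ
    exact ((propagatorLI ha (t - τ)).continuous.tendsto _).comp hτ
  refine ⟨fun t => intervalIntegrable_propagator_slice ha hf2 (hpm t), v, ?_, ?_, ?_⟩
  · have h1 := ae_tendsto_zero_of_lintegral_le (fun k => aemeasurable_wsq (hrespm k) (-s))
      (by simp) hresp
    have hvfin : ∀ᵐ t, wsq (-s) (fun x => v (t, x)) < ⊤ := by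
      refine ae_lt_top' (aemeasurable_wsq hvm (-s)) ?_
      rw [lintegral_wsq_eq_eLpNorm _ hvm, hvw]
      exact ENNReal.pow_ne_top (Lp.memLp (T W)).2.ne
    have hvsl : ∀ᵐ t : ℝ, AEStronglyMeasurable fun x => v (t, x) :=
      AEStronglyMeasurable.prodMk_left (show AEStronglyMeasurable v
        ((volume : Measure ℝ).prod volume) from hvm)
    filter_upwards [h1, hvfin, hvsl] with t h2 h3 h4
    -- The Duhamel integrals converge in `L²` for each fixed `t`, the responses in weighted norm for
    -- almost every `t`; together they identify `v (t, ·)`.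
    refine isAbsDPow_of_tendsto hκ (u := fun k => duhamel a (source (D k)) t)
      (v := fun k x => response κ a (D k) (t, x)) (tendsto_of_enorm_sub_sq ?_) (fun k => ?_)
      (fun k => ((measurable_response κ ha (D k)).comp
        measurable_prodMk_left).aestronglyMeasurable) h4 h3.ne h2
    · have h5 : Filter.Tendsto (fun k : ℕ => (2⁻¹ : ℝ≥0∞) ^ k * ENNReal.ofReal |t|) Filter.atTop
          (nhds 0) := by
        have := ENNReal.Tendsto.mul_const (b := ENNReal.ofReal |t|)
          (ENNReal.tendsto_pow_atTop_nhds_zero_of_lt_one (r := 2⁻¹) (by simp))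
          (Or.inr ENNReal.ofReal_ne_top)
        simpa using this
      refine tendsto_of_tendsto_of_tendsto_of_le_of_le tendsto_const_nhds h5 (fun _ => zero_le)
        fun k => ?_
      refine (enorm_duhamel_sub_sq_le ha (hsource2 k) hf2 (hsrcm k t) (hpm t)).trans ?_
      refine mul_le_mul_left (le_trans (lintegral_mono fun τ => ?_) (hdiff k)) _
      exact lintegral_sq_le_wsq hs _
    · have h6 : duhamel a (source (D k)) t = _ := duhamel_sum_tensor ha (D k).support (D k)
        (A := fun i => i.1.1) (fun i => i.1.2.1) (fun i => i.2) t
      rw [h6]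
      exact IsAbsDPow.sum hκ _ _ fun i _ =>
        isAbsDPow_duhamel_tensor hκ ha i.1.2.1 i.1.2.2 i.2 t
  · rw [hvw]; exact Lp.memLp _
  · rw [hvw, ← eLpNorm_congr_ae hf.coeFn_toLp, ← Lp.enorm_def, ← Lp.enorm_def]
    exact hTe W

end Estimate

/-! ### The resolvent bound for dispersive symbols and the conclusion -/

section Dispersive

variable {k : ℕ} {κ κ₀ C s : ℝ}

/-- Dispersive symbols satisfy the resolvent bound with smoothing of order `κ`. -/
theorem IsDispersive.exists_resolventBound {a : Rn (k + 2) → ℝ}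
    {D : Fin (k + 2) → Rn (k + 2) → ℝ} {G : Fin (k + 2) → Ext (k + 2) → ℝ}
    (hp : IsDispersive κ κ₀ C a D G) (hκ : 0 ≤ κ) (hC : 0 ≤ C) (hs : 1 / 2 < s) (hs1 : s < 1) :
    ∃ K : ℝ≥0, ResolventBound (absPow κ) (fun ξ : Rn (k + 2) => a ((2 * Real.pi) • ξ)) s K := by
  have hπ : 0 < 2 * Real.pi := by have := Real.pi_pos; positivity
  -- The rescaled symbol `a(2πξ)` is again dispersive; `absPow` differs from `‖ξ‖^κ` by the constant
  -- `(2π)^κ`.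
  obtain ⟨K, hK⟩ := (hp.comp_smul hπ).exists_bilinear hκ (by positivity) hs hs1
  refine ⟨((2 * Real.pi) ^ κ).toNNReal * K, ?_⟩
  intro h g hm hi h2 hw gm gi g2 gw lam ε hε
  have e : ∫ ξ, (absPow κ ξ : ℂ) * (𝓕 h ξ * (starRingEnd ℂ) (𝓕 g ξ)) /
        (((a ((2 * Real.pi) • ξ) - lam : ℝ) : ℂ) - Complex.I * ε) =
      (((2 * Real.pi) ^ κ : ℝ) : ℂ) * ∫ ξ, ((‖ξ‖ ^ κ : ℝ) : ℂ) *
        (𝓕 h ξ * (starRingEnd ℂ) (𝓕 g ξ)) /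
        (((a ((2 * Real.pi) • ξ) - lam : ℝ) : ℂ) - Complex.I * ε) := by
    rw [← integral_const_mul]
    refine integral_congr_ae (ae_of_all _ fun ξ => ?_)
    have e1 : absPow κ ξ = (2 * Real.pi) ^ κ * ‖ξ‖ ^ κ := by
      rw [absPow, norm_smul, Real.norm_of_nonneg hπ.le, Real.mul_rpow hπ.le (norm_nonneg _)]
    simp only [e1]
    push_cast
    ring
  rw [e, enorm_mul, ← ofReal_norm (((2 * Real.pi) ^ κ : ℝ) : ℂ), Complex.norm_real,
    Real.norm_of_nonneg (by positivity), ENNReal.coe_mul, mul_assoc]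
  exact mul_le_mul_right (hK h g hm hi h2 hw gm gi g2 gw lam ε hε) _

end Dispersive

end Smoothing

end

theorem theorem7p1 (n : ℕ) (hn : 2 ≤ n) (m s : ℝ) (hm : 1 ≤ m) (hs : 1 / 2 < s)
    (a am : Smoothing.Rn n → ℝ) (ham : Smoothing.IsPrincipalSymbol m am)
    (ha : Smoothing.DispersiveH a am ∨ Smoothing.DispersiveL m a am) :
    ∃ C : ℝ≥0, ∀ f : ℝ × Smoothing.Rn n → ℂ,
      MemLp (Smoothing.weighted s f) 2 volume →
      (∀ t : ℝ, IntervalIntegrable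
        (fun τ : ℝ => Smoothing.propagator a (t - τ) (Smoothing.slice f τ)) volume 0 t) ∧
      ∃ v : ℝ × Smoothing.Rn n → ℂ,
        (∀ᵐ t : ℝ, Smoothing.IsAbsDPow (m - 1) (Smoothing.duhamel a f t) (fun x => v (t, x))) ∧
        MemLp (Smoothing.weighted (-s) v) 2 volume ∧
        eLpNorm (Smoothing.weighted (-s) v) 2 volume ≤
          C * eLpNorm (Smoothing.weighted s f) 2 volume := by
  obtain ⟨k, rfl⟩ : ∃ k, n = k + 2 := ⟨n - 2, by omega⟩
  -- The Hardy inequality requires `s < 1`. Lowering the exponent is free: it strengthens the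
  -- estimate on both sides.
  obtain ⟨s', hs', hs'1, hss'⟩ : ∃ s' : ℝ, 1 / 2 < s' ∧ s' < 1 ∧ s' ≤ s :=
    ⟨min s (3 / 4), lt_min hs (by norm_num), (min_le_right _ _).trans_lt (by norm_num),
      min_le_left _ _⟩
  have hκ : 0 ≤ m - 1 := by linarith
  have hs0 : 0 ≤ s' := by linarith
  obtain ⟨κ₀, C, D, G, hC, hp⟩ : ∃ κ₀ C D G, 0 ≤ C ∧ Smoothing.IsDispersive (m - 1) κ₀ C a D G := by
    rcases ha with ha | ha
    · obtain ⟨C, D, G, h⟩ := ha.exists_isDispersive ham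
      exact ⟨0, C, D, G, h⟩
    · obtain ⟨C, D, G, h⟩ := ha.exists_isDispersive ham
      exact ⟨1, C, D, G, h⟩
  obtain ⟨K, hK⟩ := Smoothing.IsDispersive.exists_resolventBound hp hκ hC hs' hs'1
  refine ⟨K, fun f hf => ?_⟩
  have hmono := Smoothing.eLpNorm_weighted_mono hss' f
  have hf' : MemLp (Smoothing.weighted s' f) 2 volume :=
    ⟨Smoothing.aestronglyMeasurable_weighted s' (Smoothing.aestronglyMeasurable_of_weighted s hf.1),
      hmono.trans_lt hf.2⟩
  obtain ⟨h1, v, hv, hv2, hle⟩ := hK.exists_smoothing hp.measurable hκ hs0 hf'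
  have hmono' := Smoothing.eLpNorm_weighted_mono (neg_le_neg hss') v
  exact ⟨h1, v, hv, ⟨Smoothing.aestronglyMeasurable_weighted _
    (Smoothing.aestronglyMeasurable_of_weighted _ hv2.1), hmono'.trans_lt hv2.2⟩,
    hmono'.trans (hle.trans (mul_le_mul_right hmono _))⟩
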